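/- A base station with $N$ antennas serves users with $M$ antennas each, $1\le M<N$. User $k$ has the channel $H_k=R_k^{1/2}\widetilde H_k\in\mathbb C^{M\times N}$, where $R_k$ is an arbitrary positive-definite receive correlation matrix and the $\widetilde H_k$ are independent with independent $\mathcal{CN}(0,1)$ entries; the receiver noise is $\mathcal{CN}(0,I_M)$ and the total transmit power is $P$, split equally over $N$ streams. The base station knows only estimates of the channels from uplink training, with training power $\Psi=\Psi(P)>0$ per user and independent $\mathcal{CN}(0,\sigma^2)$ noise, $\sigma^2>0$; it computes the precoders by treating the estimates as the true channels, and users treat interference as noise. (BD) A fixed set $S$ of $N/M$ users is scheduled. The estimate $\widehat H_k$ is the MMSE estimate of $H_k$ from $H_k^TT_k+(\text{noise})$ with a training matrix $T_k=T_k(P)\in\mathbb C^{M\times M}$, $\mathrm{tr}(T_k^HT_k)=\Psi$. User $k$ gets a semi-unitary precoder $\widehat W_k\in\mathbb C^{N\times M}$ with $\widehat H_\ell\widehat W_k=0$ for $\ell\in S\setminus\{k\}$, and $f(P)=\sum_{k\in S}\mathbb E\log_2\frac{\det(I+\frac PN\sum_{\ell\in S}H_k\widehat W_\ell\widehat W_\ell^HH_k^H)}{\det(I+\frac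 PN\sum_{\ell\in S\setminus\{k\}}H_k\widehat W_\ell\widehat W_\ell^HH_k^H)}$. (ZFC) A fixed set $S$ of $N$ users is scheduled. User $k$ combines its antennas with the dominating left singular vector $\tilde c_k$ of $H_k$ (an eigenvector of $H_kH_k^H$ selected as a measurable function of $H_kH_k^H$), which gives the effective channel $h_k^H=\tilde c_k^HH_k$; $\hat h_k^H$ is its LMMSE estimate from a pilot of power $\Psi$. User $k$ gets a unit-norm beamformer $\hat w_k$ with $\hat h_\ell^H\hat w_k=0$ for $\ell\in S\setminus\{k\}$, and $f(P)=\sum_{k\in S}\mathbb E\log_2\Big(1+\frac{\frac PN|h_k^H\hat w_k|^2}{1+\frac PN\sum_{\ell\in S\setminus\{k\}}|h_k^H\hat w_\ell|^2}\Big)$. In both cases, to achieve the maximal multiplexing gain $N$ it is necessary and sufficient to scale the training power linearly with the transmit power, in the following two senses as $P\to\infty$: 1. $f(P)=N\log_2P+O(1)$ if and only if $P/\Psi=O(1)$. 2. $f(P)=N\log_2P+r+o(1)$ for some finite rate offset $r$ if and only if $P/\Psi$ converges to a finite constant. For BD, the necessity in 1 holds for all training matrices; the sufficiency in 1 is for training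 matrices such that, for some $\kappa>0$ and all large $P$, $T_kT_k^H\succeq\kappa\Psi I_M$ for all $k\in S$; and 2 is for training matrices such that $T_kT_k^H/\Psi$ converges to a positive-definite matrix for each $k\in S$. -/

import Mathlib

open MeasureTheory ProbabilityTheory Filter Topology Matrix
open scoped NNReal ComplexOrder

noncomputable section

/-- Matrices carry the product (entrywise) Borel structure. -/
instance matrixMeasurableSpace {m n : ℕ} : MeasurableSpace (Matrix (Fin m) (Fin n) ℂ) :=
  inferInstanceAs (MeasurableSpace (Fin m → Fin n → ℂ))

/-- The circularly-symmetric complex Gaussian law `CN(0, v)`: real and imaginary parts are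
independent `N(0, v / 2)`. -/
def complexGaussian (v : ℝ≥0) : Measure ℂ :=
  ((gaussianReal 0 (v / 2)).prod (gaussianReal 0 (v / 2))).map (fun p => (⟨p.1, p.2⟩ : ℂ))

/-- The law of a vector with independent `CN(0, v)` entries. -/
def gaussianVector (n : ℕ) (v : ℝ≥0) : Measure (Fin n → ℂ) :=
  Measure.pi fun _ => complexGaussian v

/-- The law of an `m × n` matrix with independent `CN(0, v)` entries. -/
def gaussianMatrix (m n : ℕ) (v : ℝ≥0) : Measure (Matrix (Fin m) (Fin n) ℂ) :=
  Measure.pi fun _ : Fin m => gaussianVector n v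

/-- MMSE estimate of a channel `H : d × N` with independent `CN(0, C)` columns from the training
observation `Y = Hᵀ * T + (noise)`, the noise having independent `CN(0, s)` entries:
`(1 / s) E (Tᵀ)ᴴ Yᵀ`, where `E = (C⁻¹ + (Tᵀ)ᴴ Tᵀ / s)⁻¹`. This is the unvectorized form of
`vec (Ĥᵀ) = (1 / s) (E ⊗ I) (Tᵀ ⊗ I)ᴴ vec Y`. -/
def mmseEstimate {d N : ℕ} (C T : Matrix (Fin d) (Fin d) ℂ) (s : ℝ≥0)
    (Y : Matrix (Fin N) (Fin d) ℂ) : Matrix (Fin d) (Fin N) ℂ :=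
  ((s : ℂ)⁻¹) • ((C⁻¹ + ((s : ℂ)⁻¹) • (Tᵀᴴ * Tᵀ))⁻¹ * Tᵀᴴ * Yᵀ)

section BlockDiagonalization

variable {ι : Type*} [Fintype ι] [DecidableEq ι] {M N : ℕ}

/-- A (measurable) block-diagonalization rule: to the channels `G` of the scheduled users it assigns
semi-unitary `N × M` precoders, the `k`-th of which is annihilated by all co-user channels. -/
structure IsBDPrecoder
    (W : (ι → Matrix (Fin M) (Fin N) ℂ) → ι → Matrix (Fin N) (Fin M) ℂ) : Prop where
  measurable : Measurable W
  semiUnitary : ∀ G k, (W G k)ᴴ * W G k = 1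
  zeroForcing : ∀ G k l, l ≠ k → G l * W G k = 0

/-- Covariance of the signal received over the channel `H` from the streams of the users in `s`,
with equal power `P / N` per stream. -/
def bdCovariance (P : ℝ) (H : Matrix (Fin M) (Fin N) ℂ) (W : ι → Matrix (Fin N) (Fin M) ℂ)
    (s : Finset ι) : Matrix (Fin M) (Fin M) ℂ :=
  ∑ l ∈ s, ((P / N : ℝ) : ℂ) • (H * W l * (W l)ᴴ * Hᴴ)

/-- Information rate of user `k` with channel `H`, under precoders `W`, total power `P` and unit
noise; inter-user interference is treated as noise. (The determinants are real and positive.) -/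
def bdRate (P : ℝ) (H : Matrix (Fin M) (Fin N) ℂ) (W : ι → Matrix (Fin N) (Fin M) ℂ) (k : ι) : ℝ :=
  Real.logb 2 ((1 + bdCovariance P H W Finset.univ).det.re /
    (1 + bdCovariance P H W (Finset.univ.erase k)).det.re)

/-- Joint law of the white channel matrices (first components) and of the uplink training noise
(second components) of the scheduled users, which are all independent. -/
def bdLaw (ι : Type*) [Fintype ι] (M N : ℕ) (s : ℝ≥0) :
    Measure (ι → Matrix (Fin M) (Fin N) ℂ × Matrix (Fin N) (Fin M) ℂ) :=
  Measure.pi fun _ => (gaussianMatrix M N 1).prod (gaussianMatrix N M s)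

/-- The MMSE estimates of the channels `A k * X k` from uplink training with the matrices `T k`. -/
def bdEstimate (R A T : ι → Matrix (Fin M) (Fin M) ℂ) (s : ℝ≥0)
    (ω : ι → Matrix (Fin M) (Fin N) ℂ × Matrix (Fin N) (Fin M) ℂ) (k : ι) :
    Matrix (Fin M) (Fin N) ℂ :=
  mmseEstimate (R k) (T k) s ((A k * (ω k).1)ᵀ * T k + (ω k).2)

/-- Average sum rate of block-diagonalization under estimated channels: the precoders are computed
from the estimates, the rates are achieved over the true channels `A k * X k`. -/
def bdSumRate (W : (ι → Matrix (Fin M) (Fin N) ℂ) → ι → Matrix (Fin N) (Fin M) ℂ)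
    (R A T : ι → Matrix (Fin M) (Fin M) ℂ) (s : ℝ≥0) (P : ℝ) : ℝ :=
  ∫ ω, ∑ k, bdRate P (A k * (ω k).1) (W (bdEstimate R A T s ω)) k ∂(bdLaw ι M N s)

end BlockDiagonalization

section ZeroForcing

variable {ι : Type*} [Fintype ι] [DecidableEq ι] {M N : ℕ}

/-- A (measurable) rule for maximum ratio combining: to the Gram matrix `H * Hᴴ` of a channel it
assigns a unit-norm dominating eigenvector, i.e. a dominating left singular vector of `H`. -/
structure IsMRC (c : Matrix (Fin M) (Fin M) ℂ → Fin M → ℂ) : Prop where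
  measurable : Measurable c
  unit : ∀ G, star (c G) ⬝ᵥ c G = 1
  dominating : ∀ G, G.PosSemidef → ∀ u : Fin M → ℂ, star u ⬝ᵥ u = 1 →
    (star u ⬝ᵥ (G *ᵥ u)).re ≤ (star (c G) ⬝ᵥ (G *ᵥ c G)).re

/-- The effective channel (a row vector) `c̃ᴴ * H` after maximum ratio combining. -/
def effectiveChannel (c : Matrix (Fin M) (Fin M) ℂ → Fin M → ℂ) (H : Matrix (Fin M) (Fin N) ℂ) :
    Fin N → ℂ :=
  star (c (H * Hᴴ)) ᵥ* H

/-- The mean squared norm of the effective channel of a user with channel `A * X`. -/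
def meanGain (N : ℕ) (c : Matrix (Fin M) (Fin M) ℂ → Fin M → ℂ) (A : Matrix (Fin M) (Fin M) ℂ) :
    ℝ :=
  ∫ X, ∑ j, ‖effectiveChannel c (A * X) j‖ ^ 2 ∂(gaussianMatrix M N 1)

/-- A (measurable) zero-forcing rule: to the effective channels `g` (row vectors) of the scheduled
users it assigns unit-norm beamformers, the `k`-th of which is orthogonal to all co-user channels. -/
structure IsZFPrecoder (w : (ι → Fin N → ℂ) → ι → Fin N → ℂ) : Prop where
  measurable : Measurable w
  unit : ∀ g k, star (w g k) ⬝ᵥ w g k = 1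
  zeroForcing : ∀ g k l, l ≠ k → g l ⬝ᵥ w g k = 0

/-- Information rate of user `k` with effective channel `g`, under beamformers `w`, equal powers
`P / N` and unit noise. -/
def zfRate (P : ℝ) (g : Fin N → ℂ) (w : ι → Fin N → ℂ) (k : ι) : ℝ :=
  Real.logb 2 (1 + P / N * ‖g ⬝ᵥ w k‖ ^ 2 /
    (1 + ∑ l ∈ Finset.univ.erase k, P / N * ‖g ⬝ᵥ w l‖ ^ 2))

/-- Joint law of the white channel matrices (first components) and of the uplink training noise
(second components) of the scheduled users, which are all independent. -/
def zfLaw (ι : Type*) [Fintype ι] (M N : ℕ) (s : ℝ≥0) :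
    Measure (ι → Matrix (Fin M) (Fin N) ℂ × (Fin N → ℂ)) :=
  Measure.pi fun _ => (gaussianMatrix M N 1).prod (gaussianVector N s)

/-- The LMMSE estimates of the effective channels from the uplink observations `t g + (noise)`; the
effective channel `g` is isotropic, so it has mean `0` and covariance `(meanGain / N) I`. -/
def zfEstimate (c : Matrix (Fin M) (Fin M) ℂ → Fin M → ℂ) (A : ι → Matrix (Fin M) (Fin M) ℂ)
    (t : ι → ℂ) (s : ℝ≥0) (ω : ι → Matrix (Fin M) (Fin N) ℂ × (Fin N → ℂ)) (k : ι) : Fin N → ℂ :=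
  (((s : ℂ)⁻¹) * (((meanGain N c (A k) / N : ℝ) : ℂ)⁻¹ + (s : ℂ)⁻¹ * (star (t k) * t k))⁻¹ *
    star (t k)) • (t k • effectiveChannel c (A k * (ω k).1) + (ω k).2)

/-- Average sum rate of zero-forcing with combining under estimated effective channels. -/
def zfSumRate (c : Matrix (Fin M) (Fin M) ℂ → Fin M → ℂ) (w : (ι → Fin N → ℂ) → ι → Fin N → ℂ)
    (A : ι → Matrix (Fin M) (Fin M) ℂ) (t : ι → ℂ) (s : ℝ≥0) (P : ℝ) : ℝ :=
  ∫ ω, ∑ k, zfRate P (effectiveChannel c (A k * (ω k).1)) (w (zfEstimate c A t s ω)) k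
    ∂(zfLaw ι M N s)

end ZeroForcing

/-- The rate `f` has multiplexing gain `m` up to a bounded term: `f P = m log₂ P + O(1)`. -/
def HasMultiplexingGain (f : ℝ → ℝ) (m : ℝ) : Prop :=
  (fun P => f P - m * Real.logb 2 P) =O[atTop] (fun _ => (1 : ℝ))

/-- The rate `f` has multiplexing gain `m` and a rate offset `r`: `f P = m log₂ P + r + o(1)`. -/
def HasMultiplexingGainWithOffset (f : ℝ → ℝ) (m : ℝ) : Prop :=
  ∃ r : ℝ, Tendsto (fun P => f P - m * Real.logb 2 P) atTop (𝓝 r)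

end

open scoped ENNReal

noncomputable section

/-! ### Resampling one coordinate of a product measure -/

section Resample

/-! Write `H` for a channel, `Z` for training noise and `W` for a precoder. The (L)MMSE estimate is
a matrix `J` times the transposed observation `Tᵀ H + Zᵀ`. When `J` and `T` are invertible, nulling
the estimates is the same as nulling `H + T⁻ᵀ Zᵀ`, so on the streams of the other users `H W = -T⁻ᵀ
Zᵀ W`. For well-conditioned training this interference has power of order `P / Ψ`, and that ratio
decides everything. The argument runs for abstract channels (`IsChannelFamily`) with finite power
and a uniformly bounded negative moment of `det (h V)`. Block-diagonalization is the Gaussian case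
with `d = M`; zero-forcing is the case `d = 1` with the effective channel as the only row.

The sum rate is a difference of ergodic log-determinants: signal plus interference, minus
interference. A trace bound keeps the first below `d log P + O(1)` per user. It is also at least `d
log P - O(1)`, because the projector `W Wᴴ` of a user is determined almost surely by the data of the
others (`mul_conjTranspose_eq_nullProj`). It is therefore independent of the user's own channel, and
the negative moment applies (`exists_exp_moment_le`). What remains is to decide when the
interference term is bounded.

Sufficiency: that term is at most linear in `P ‖T⁻¹‖²`, hence in `P / Ψ` when the training power is
spread over all dimensions.

Necessity for Gaussian channels: a joint shift of channel and noise that leaves the observation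
unchanged leaves all precoders unchanged as well. Refreshing the Gaussian component along such a
direction (`measurePreserving_rotation`) makes an interference entry an affine Gaussian form with
coefficient of order at least `1 / √(1 + Ψ)`, whatever the training matrix. Its inverse moment
bounds the mean logarithm from below.

Necessity after combining: the effective channel is no longer Gaussian, so a deterministic estimate
is used instead. With the observations scaled by `1 / √(1 + Ψ)`, the interference power of a unit
beamformer is at least `1 / ((1 + Ψ) ‖D⁻¹‖²)`, where `D` stacks the channel of one user, its noise
and the observations of the others (`card_le_frobSq_inv_mul`). By compactness `D` converges along a
subsequence to an almost surely invertible matrix, and Fatou's lemma makes the mean log-interference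
unbounded.

Rate offset: if `P / Ψ` tends to `a` along a filter, the zero-forcing projectors converge almost
surely and both terms converge, so the gap to `N log₂ P` tends to an explicit function of `a`
(`tendsto_trainSumRate_sub`). This function is strictly decreasing, because more training noise
strictly increases the loss (`strictMonoOn_noiseLoss`). A convergent gap therefore leaves the
bounded ratio `P / Ψ` only one cluster point. -/

theorem measurable_update_prod {ι : Type*} [DecidableEq ι] {Ω : Type*} [MeasurableSpace Ω] (k : ι) :
    Measurable (fun p : (ι → Ω) × Ω => Function.update p.1 k p.2) := by
  rw [measurable_pi_iff]
  intro i
  by_cases h : i = k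
  · subst h
    simpa using measurable_snd
  · simp only [Function.update_of_ne h]
    exact (measurable_pi_apply i).comp measurable_fst

variable {ι : Type*} [Fintype ι] [DecidableEq ι] {Ω : Type*} [MeasurableSpace Ω]

theorem measurePreserving_update (μ : ι → Measure Ω) [∀ i, IsProbabilityMeasure (μ i)] (k : ι) :
    MeasurePreserving (fun p : (ι → Ω) × Ω => Function.update p.1 k p.2)
      ((Measure.pi μ).prod (μ k)) (Measure.pi μ) := by
  refine ⟨measurable_update_prod k, ?_⟩
  symm
  apply Measure.pi_eq
  intro s hs
  rw [Measure.map_apply (measurable_update_prod k) (MeasurableSet.univ_pi hs)]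
  have : (fun p : (ι → Ω) × Ω => Function.update p.1 k p.2) ⁻¹' (Set.univ.pi s) =
      (Set.univ.pi (Function.update s k Set.univ)) ×ˢ s k := by
    ext ⟨a, b⟩
    simp only [Set.mem_preimage, Set.mem_pi, Set.mem_univ, true_imp_iff, Set.mem_prod]
    constructor
    · intro h
      refine ⟨fun i => ?_, by simpa using h k⟩
      by_cases hi : i = k
      · subst hi; simp
      · simpa [Function.update_of_ne hi] using h i
    · rintro ⟨h, hk⟩ i
      by_cases hi : i = k
      · subst hi; simpa using hk
      · simpa [Function.update_of_ne hi] using h i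
  rw [this, Measure.prod_prod, Measure.pi_pi, ← Finset.prod_erase_mul _ _ (Finset.mem_univ k),
    ← Finset.prod_erase_mul Finset.univ (fun i => μ i (s i)) (Finset.mem_univ k)]
  simp only [Function.update_self, measure_univ, mul_one]
  congr 1
  refine Finset.prod_congr rfl fun i hi => ?_
  rw [Function.update_of_ne (Finset.ne_of_mem_erase hi)]

/-- Independence in the form used throughout: a fresh copy of one coordinate does not change the
law, so a bound on the inner integral that is uniform in the other coordinates passes to the whole
integral. -/
theorem lintegral_pi_update (μ : ι → Measure Ω) [∀ i, IsProbabilityMeasure (μ i)] (k : ι)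
    {f : (ι → Ω) → ℝ≥0∞} (hf : Measurable f) :
    ∫⁻ ω, f ω ∂(Measure.pi μ) =
      ∫⁻ ω, ∫⁻ x, f (Function.update ω k x) ∂(μ k) ∂(Measure.pi μ) := by
  rw [← (measurePreserving_update μ k).lintegral_comp hf, lintegral_prod]
  exact (hf.comp (measurable_update_prod k)).aemeasurable

theorem ae_pi_update (μ : ι → Measure Ω) [∀ i, IsProbabilityMeasure (μ i)] (k : ι)
    {p : (ι → Ω) → Prop} (hp : MeasurableSet {ω | p ω}) :
    (∀ᵐ ω ∂(Measure.pi μ), p ω) ↔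
      ∀ᵐ ω ∂(Measure.pi μ), ∀ᵐ x ∂(μ k), p (Function.update ω k x) := by
  have h := (measurePreserving_update μ k)
  rw [← h.map_eq, ae_map_iff h.measurable.aemeasurable hp, h.map_eq]
  exact Measure.ae_prod_iff_ae_ae (h.measurable hp)

end Resample

/-! ### Complex Gaussian laws -/

instance (v : ℝ≥0) : IsProbabilityMeasure (complexGaussian v) := by
  unfold complexGaussian
  apply Measure.isProbabilityMeasure_map
  exact Complex.measurableEquivRealProd.symm.measurable.aemeasurable

instance (n : ℕ) (v : ℝ≥0) : IsProbabilityMeasure (gaussianVector n v) := by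
  unfold gaussianVector
  infer_instance

instance (m n : ℕ) (v : ℝ≥0) : IsProbabilityMeasure (gaussianMatrix m n v) := by
  unfold gaussianMatrix
  exact inferInstanceAs (IsProbabilityMeasure (Measure.pi fun _ : Fin m => gaussianVector n v))

instance {m n : ℕ} : BorelSpace (Matrix (Fin m) (Fin n) ℂ) :=
  inferInstanceAs (BorelSpace (Fin m → Fin n → ℂ))

instance {m n : ℕ} : SecondCountableTopology (Matrix (Fin m) (Fin n) ℂ) :=
  inferInstanceAs (SecondCountableTopology (Fin m → Fin n → ℂ))

theorem map_complexGaussian_eq (v : ℝ≥0) :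
    complexGaussian v = ((gaussianReal 0 (v / 2)).prod (gaussianReal 0 (v / 2))).map
      Complex.equivRealProdCLM.symm := by
  rfl

theorem integrable_norm_sq_complexGaussian (v : ℝ≥0) :
    Integrable (fun z : ℂ => ‖z‖ ^ 2) (complexGaussian v) := by
  rw [map_complexGaussian_eq, integrable_map_measure (by fun_prop) (by fun_prop)]
  have h : Integrable (fun x : ℝ => x ^ 2) (gaussianReal 0 (v / 2)) :=
    (memLp_id_gaussianReal 2).integrable_sq
  have h1 := (h.comp_fst (gaussianReal 0 (v / 2))).add (h.comp_snd (gaussianReal 0 (v / 2)))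
  refine h1.congr (ae_of_all _ fun p => ?_)
  simp only [Function.comp, Complex.sq_norm, Complex.normSq_apply]
  simp [Complex.equivRealProdCLM_symm_apply, sq]

theorem integrable_entry_sq_gaussianVector (n : ℕ) (v : ℝ≥0) (j : Fin n) :
    Integrable (fun x => ‖x j‖ ^ 2) (gaussianVector n v) :=
  (measurePreserving_eval (fun _ : Fin n => complexGaussian v) j).integrable_comp_of_integrable
    (integrable_norm_sq_complexGaussian v)

theorem integrable_entry_sq_gaussianMatrix (m n : ℕ) (v : ℝ≥0) (i : Fin m) (j : Fin n) :
    Integrable (fun X => ‖X i j‖ ^ 2) (gaussianMatrix m n v) :=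
  (measurePreserving_eval (fun _ : Fin m => gaussianVector n v) i).integrable_comp_of_integrable
    (integrable_entry_sq_gaussianVector n v j)

/-! ### Negative moments -/

theorem lintegral_inv_sqrt_Icc_lt_top :
    ∫⁻ y in Set.Icc (-1 : ℝ) 1, (‖y‖ₑ ^ (1 / 2 : ℝ))⁻¹ < ∞ := by
  have h1 : IntegrableOn (fun y : ℝ => y ^ (-(1 / 2) : ℝ)) (Set.Ioc 0 1) :=
    (intervalIntegrable_iff_integrableOn_Ioc_of_le zero_le_one).1
      (intervalIntegral.intervalIntegrable_rpow' (by norm_num))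
  have h2 : ∫⁻ y in Set.Ioc (0 : ℝ) 1, (‖y‖ₑ ^ (1 / 2 : ℝ))⁻¹ < ∞ := by
    refine lt_of_le_of_lt (le_of_eq ?_) h1.2
    refine setLIntegral_congr_fun measurableSet_Ioc fun y hy => ?_
    simp only [Real.enorm_eq_ofReal_abs, abs_of_pos hy.1]
    rw [abs_of_pos (Real.rpow_pos_of_pos hy.1 _), ← ENNReal.rpow_neg,
      ENNReal.ofReal_rpow_of_pos hy.1]
  have h3 : ∫⁻ y in Set.Ico (-1 : ℝ) 0, (‖y‖ₑ ^ (1 / 2 : ℝ))⁻¹ < ∞ := by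
    have := (Measure.measurePreserving_neg (volume : Measure ℝ)).setLIntegral_comp_preimage
      (s := Set.Ioc (0 : ℝ) 1) (f := fun y : ℝ => (‖y‖ₑ ^ (1 / 2 : ℝ))⁻¹) measurableSet_Ioc
      (by fun_prop)
    simp only [enorm_neg] at this
    have e : (Neg.neg ⁻¹' Set.Ioc (0 : ℝ) 1) = Set.Ico (-1 : ℝ) 0 := by
      ext x
      simp only [Set.mem_preimage, Set.mem_Ioc, Set.mem_Ico]
      constructor <;> rintro ⟨a, b⟩ <;> constructor <;> linarith
    rw [← e, this]; exact h2
  have h4 : ∫⁻ y in ({0} : Set ℝ), (‖y‖ₑ ^ (1 / 2 : ℝ))⁻¹ < ∞ := by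
    rw [setLIntegral_measure_zero _ _ (by simp)]; simp
  refine lt_of_le_of_lt (lintegral_mono_set (t := Set.Ioc 0 1 ∪ (Set.Ico (-1) 0 ∪ {0})) ?_) ?_
  · intro x hx
    rcases lt_trichotomy x 0 with h | h | h
    · exact Or.inr (Or.inl ⟨hx.1, h⟩)
    · exact Or.inr (Or.inr h)
    · exact Or.inl ⟨h, hx.2⟩
  · exact lt_of_le_of_lt (lintegral_union_le _ _ _) (ENNReal.add_lt_top.2
      ⟨h2, lt_of_le_of_lt (lintegral_union_le _ _ _) (ENNReal.add_lt_top.2 ⟨h3, h4⟩)⟩)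

/-- The integrand is at most `1` outside `[-1, 1]`. Inside, the density is replaced by its maximum,
and translation invariance of Lebesgue measure makes the bound uniform in the shift. -/
theorem exists_lintegral_inv_sqrt_gaussianReal_le {v : ℝ≥0} (hv : v ≠ 0) :
    ∃ K : ℝ≥0, ∀ b : ℝ, ∫⁻ x, (‖x + b‖ₑ ^ (1 / 2 : ℝ))⁻¹ ∂(gaussianReal 0 v) ≤ K := by
  set I := ∫⁻ y in Set.Icc (-1 : ℝ) 1, (‖y‖ₑ ^ (1 / 2 : ℝ))⁻¹ with hI
  have hIt : I < ∞ := lintegral_inv_sqrt_Icc_lt_top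
  set D : ℝ≥0∞ := ENNReal.ofReal ((√(2 * Real.pi * v))⁻¹) with hD
  have hlt : 1 + D * I < ∞ := by
    rw [ENNReal.add_lt_top]
    exact ⟨by simp, ENNReal.mul_lt_top ENNReal.ofReal_lt_top hIt⟩
  refine ⟨(1 + D * I).toNNReal, fun b => ?_⟩
  rw [ENNReal.coe_toNNReal hlt.ne]
  have hm : Measurable fun y : ℝ => (‖y‖ₑ ^ (1 / 2 : ℝ))⁻¹ := by fun_prop
  have h1 : ∀ y : ℝ, (‖y‖ₑ ^ (1 / 2 : ℝ))⁻¹ ≤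
      1 + (Set.Icc (-1 : ℝ) 1).indicator (fun y => (‖y‖ₑ ^ (1 / 2 : ℝ))⁻¹) y := by
    intro y
    by_cases hy : y ∈ Set.Icc (-1 : ℝ) 1
    · rw [Set.indicator_of_mem hy]; exact le_add_self
    · rw [Set.indicator_of_notMem hy, add_zero, ENNReal.inv_le_one]
      apply ENNReal.one_le_rpow _ (by norm_num)
      have : 1 ≤ ‖y‖ := by
        rw [Real.norm_eq_abs]
        by_contra hlt
        exact hy (abs_le.1 (not_le.1 hlt).le)
      rw [← ofReal_norm]
      simpa using this
  calc ∫⁻ x, (‖x + b‖ₑ ^ (1 / 2 : ℝ))⁻¹ ∂(gaussianReal 0 v)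
      ≤ ∫⁻ x, (1 + (Set.Icc (-1 : ℝ) 1).indicator (fun y => (‖y‖ₑ ^ (1 / 2 : ℝ))⁻¹) (x + b))
          ∂(gaussianReal 0 v) := lintegral_mono fun x => h1 _
    _ = 1 + ∫⁻ x, (Set.Icc (-1 : ℝ) 1).indicator (fun y => (‖y‖ₑ ^ (1 / 2 : ℝ))⁻¹) (x + b)
          ∂(gaussianReal 0 v) := by
        rw [lintegral_add_left measurable_const]; simp
    _ ≤ 1 + D * I := by
        gcongr
        have hmi : Measurable ((Set.Icc (-1 : ℝ) 1).indicator
          (fun y : ℝ => (‖y‖ₑ ^ (1 / 2 : ℝ))⁻¹)) := hm.indicator measurableSet_Icc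
        have hmb : Measurable fun x => (Set.Icc (-1 : ℝ) 1).indicator
          (fun y : ℝ => (‖y‖ₑ ^ (1 / 2 : ℝ))⁻¹) (x + b) := hmi.comp (measurable_add_const b)
        rw [gaussianReal_of_var_ne_zero 0 hv, lintegral_withDensity_eq_lintegral_mul _
          (measurable_gaussianPDF 0 v) hmb]
        calc _ ≤ ∫⁻ x, D * (Set.Icc (-1 : ℝ) 1).indicator
                (fun y => (‖y‖ₑ ^ (1 / 2 : ℝ))⁻¹) (x + b) := by
              refine lintegral_mono fun x => ?_
              simp only [Pi.mul_apply]
              gcongr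
              rw [gaussianPDF, hD]
              apply ENNReal.ofReal_le_ofReal
              rw [gaussianPDFReal]
              apply mul_le_of_le_one_right (by positivity)
              rw [Real.exp_le_one_iff]
              apply div_nonpos_of_nonpos_of_nonneg
              · nlinarith [sq_nonneg (x - 0)]
              · positivity
          _ = D * I := by
              rw [lintegral_const_mul _ hmb,
                lintegral_add_right_eq_self
                  (fun x => (Set.Icc (-1 : ℝ) 1).indicator (fun y => (‖y‖ₑ ^ (1 / 2 : ℝ))⁻¹) x) b,
                lintegral_indicator measurableSet_Icc]

/-- Since `|re z| |im z| ≤ |z|²`, the singularity splits into two independent real factors, each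
with the integrable exponent `1 / 2`. -/
theorem inv_enorm_le_mul (z : ℂ) :
    ‖z‖ₑ⁻¹ ≤ (‖z.re‖ₑ ^ (1 / 2 : ℝ))⁻¹ * (‖z.im‖ₑ ^ (1 / 2 : ℝ))⁻¹ := by
  rw [← ENNReal.mul_inv (Or.inr (by simp)) (Or.inl (by simp)), ENNReal.inv_le_inv,
    ← ENNReal.mul_rpow_of_nonneg _ _ (by norm_num)]
  have h : ‖z.re‖ₑ * ‖z.im‖ₑ ≤ ‖z‖ₑ ^ (2 : ℝ) := by
    rw [ENNReal.rpow_two, sq]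
    gcongr <;> rw [enorm_le_iff_norm_le]
    · exact Complex.abs_re_le_norm z
    · exact Complex.abs_im_le_norm z
  calc _ ≤ (‖z‖ₑ ^ (2 : ℝ)) ^ (1 / 2 : ℝ) := by gcongr
    _ = ‖z‖ₑ := by rw [← ENNReal.rpow_mul]; norm_num

theorem exists_lintegral_inv_complexGaussian_le {v : ℝ≥0} (hv : v ≠ 0) :
    ∃ K : ℝ≥0, ∀ b : ℂ, ∫⁻ z, ‖z + b‖ₑ⁻¹ ∂(complexGaussian v) ≤ K := by
  obtain ⟨K, hK⟩ := exists_lintegral_inv_sqrt_gaussianReal_le (v := v / 2) (by simpa using hv)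
  refine ⟨K * K, fun b => ?_⟩
  rw [map_complexGaussian_eq, lintegral_map (by fun_prop) (by fun_prop)]
  calc _ ≤ ∫⁻ p : ℝ × ℝ, (‖p.1 + b.re‖ₑ ^ (1 / 2 : ℝ))⁻¹ * (‖p.2 + b.im‖ₑ ^ (1 / 2 : ℝ))⁻¹
          ∂((gaussianReal 0 (v / 2)).prod (gaussianReal 0 (v / 2))) := by
        refine lintegral_mono fun p => ?_
        refine (inv_enorm_le_mul _).trans (le_of_eq ?_)
        simp [Complex.equivRealProdCLM_symm_apply]
    _ = (∫⁻ x, (‖x + b.re‖ₑ ^ (1 / 2 : ℝ))⁻¹ ∂(gaussianReal 0 (v / 2))) *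
          ∫⁻ x, (‖x + b.im‖ₑ ^ (1 / 2 : ℝ))⁻¹ ∂(gaussianReal 0 (v / 2)) :=
        lintegral_prod_mul (f := fun x : ℝ => (‖x + b.re‖ₑ ^ (1 / 2 : ℝ))⁻¹)
          (g := fun x : ℝ => (‖x + b.im‖ₑ ^ (1 / 2 : ℝ))⁻¹) (by fun_prop) (by fun_prop)
    _ ≤ _ := by push_cast; gcongr <;> apply hK

/-- The supremum over all shifts of the first negative moment of `CN(0, v)` (zero if `v = 0`). -/
def invMoment (v : ℝ≥0) : ℝ≥0 :=
  if hv : v ≠ 0 then (exists_lintegral_inv_complexGaussian_le hv).choose else 0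

theorem lintegral_inv_complexGaussian_le {v : ℝ≥0} (hv : v ≠ 0) (b : ℂ) :
    ∫⁻ z, ‖z + b‖ₑ⁻¹ ∂(complexGaussian v) ≤ invMoment v := by
  rw [invMoment, dif_pos hv]
  exact (exists_lintegral_inv_complexGaussian_le hv).choose_spec b

theorem lintegral_inv_affine_complexGaussian_le {v : ℝ≥0} (hv : v ≠ 0) (a b : ℂ) (ha : a ≠ 0) :
    ∫⁻ z, ‖z * a + b‖ₑ⁻¹ ∂(complexGaussian v) ≤ invMoment v * ‖a‖ₑ⁻¹ := by
  have : ∀ z : ℂ, ‖z * a + b‖ₑ⁻¹ = ‖z + b / a‖ₑ⁻¹ * ‖a‖ₑ⁻¹ := by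
    intro z
    rw [← ENNReal.mul_inv (Or.inr (by simp)) (Or.inl (by simp)), ← enorm_mul]
    congr 2
    field_simp
  simp_rw [this]
  rw [lintegral_mul_const _ (by fun_prop)]
  gcongr
  exact lintegral_inv_complexGaussian_le hv _

/-- First negative moment of an affine form of a Gaussian vector. -/
theorem lintegral_inv_affine_gaussianVector_le {n : ℕ} {v : ℝ≥0} (hv : v ≠ 0) (a : Fin n → ℂ)
    (b : ℂ) (j : Fin n) :
    ∫⁻ x, ‖x ⬝ᵥ a + b‖ₑ⁻¹ ∂(gaussianVector n v) ≤ invMoment v * ‖a j‖ₑ⁻¹ := by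
  by_cases ha : a j = 0
  -- The right side is `∞` unless the moment bound itself vanishes (`0 * ∞ = 0`). That is
  -- impossible, since the inverse norm of a complex number is never `0` in `ℝ≥0∞`.
  · by_cases hK : invMoment v = 0
    · have := lintegral_inv_complexGaussian_le hv 0
      rw [hK, ENNReal.coe_zero, nonpos_iff_eq_zero, lintegral_eq_zero_iff (by fun_prop)] at this
      have h2 : ∀ᵐ z ∂(complexGaussian v), False := by
        filter_upwards [this] with z hz
        simp at hz
      exact absurd h2 (by simp [IsProbabilityMeasure.ne_zero])
    · rw [ha, enorm_zero, ENNReal.inv_zero, ENNReal.mul_top (by simpa using hK)]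
      exact le_top
  have hm : Measurable fun x : Fin n → ℂ => ‖x ⬝ᵥ a + b‖ₑ⁻¹ := by
    unfold dotProduct; fun_prop
  rw [gaussianVector, lintegral_pi_update _ j hm]
  calc _ ≤ ∫⁻ _x, (invMoment v * ‖a j‖ₑ⁻¹ : ℝ≥0∞) ∂(gaussianVector n v) := by
        refine lintegral_mono fun x => ?_
        have : ∀ z : ℂ, Function.update x j z ⬝ᵥ a + b =
            z * a j + (∑ i ∈ Finset.univ.erase j, x i * a i + b) := by
          intro z
          rw [dotProduct, ← Finset.add_sum_erase _ _ (Finset.mem_univ j), Function.update_self,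
            add_assoc]
          congr 2
          refine Finset.sum_congr rfl fun i hi => ?_
          rw [Function.update_of_ne (Finset.ne_of_mem_erase hi)]
        simp_rw [this]
        exact lintegral_inv_affine_complexGaussian_le hv _ _ ha
    _ = _ := by simp

/-- By pigeonhole some coefficient satisfies `‖a j‖ ≥ r / √n`, and the one-coordinate bound is
applied to that `j`. -/
theorem lintegral_inv_affine_gaussianVector_le_of_sq {n : ℕ} {v : ℝ≥0} (hv : v ≠ 0)
    (a : Fin n → ℂ) (b : ℂ) {r : ℝ} (hr : 0 < r) (h : r ^ 2 ≤ ∑ j, ‖a j‖ ^ 2) :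
    ∫⁻ x, ‖x ⬝ᵥ a + b‖ₑ⁻¹ ∂(gaussianVector n v) ≤
      ENNReal.ofReal (invMoment v * √n) * (ENNReal.ofReal r)⁻¹ := by
  have hn : 0 < n := by
    rcases Nat.eq_zero_or_pos n with rfl | h0
    · simp at h; nlinarith
    · exact h0
  obtain ⟨j, -, hj⟩ : ∃ j ∈ (Finset.univ : Finset (Fin n)), r ^ 2 / n ≤ ‖a j‖ ^ 2 := by
    apply Finset.exists_le_of_sum_le ⟨⟨0, hn⟩, Finset.mem_univ _⟩
    simp only [Finset.sum_const, Finset.card_univ, Fintype.card_fin, nsmul_eq_mul]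
    rwa [mul_div_cancel₀]
    positivity
  refine (lintegral_inv_affine_gaussianVector_le hv a b j).trans ?_
  rw [ENNReal.ofReal_mul (by positivity), mul_assoc, ← ENNReal.ofReal_inv_of_pos hr,
    ← ENNReal.ofReal_mul (by positivity)]
  have h0 : r / √n ≤ ‖a j‖ := by
    rw [← Real.sqrt_sq (norm_nonneg (a j)), ← Real.sqrt_sq hr.le, ← Real.sqrt_div (by positivity)]
    exact Real.sqrt_le_sqrt hj
  have h1 : 0 < r / √n := by positivity
  rw [← ofReal_norm, ← ENNReal.ofReal_inv_of_pos (h1.trans_le h0)]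
  refine mul_le_mul' (by simp) (ENNReal.ofReal_le_ofReal ?_)
  calc ‖a j‖⁻¹ ≤ (r / √n)⁻¹ := inv_anti₀ h1 h0
    _ = _ := by rw [inv_div]; rfl

/-! ### Characteristic functions of Gaussian matrices and invariance of their laws -/

theorem charFunDual_gaussianReal_of_eq (v : ℝ≥0) (L : StrongDual ℝ ℝ) (t : ℝ)
    (h : ∀ x, L x = t * x) :
    charFunDual (gaussianReal 0 v) L = Complex.exp (-(v * t ^ 2 / 2)) := by
  have h1 : charFunDual (gaussianReal 0 v) L = charFun (gaussianReal 0 v) t := by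
    rw [charFunDual_apply, charFun_apply_real]
    simp [h]
  rw [h1, charFun_gaussianReal]
  simp

/-- Every real functional on `ℂ` is `z ↦ Re (a z)`. Each real component has variance `v / 2`, which
gives `v / 4` in the exponent. -/
theorem charFunDual_complexGaussian (v : ℝ≥0) (L : StrongDual ℝ ℂ) (a : ℂ)
    (h : ∀ z, L z = (a * z).re) :
    charFunDual (complexGaussian v) L = Complex.exp (-(v / 4 * ‖a‖ ^ 2 : ℝ)) := by
  have hm := charFunDual_map (μ := (gaussianReal 0 (v / 2)).prod (gaussianReal 0 (v / 2)))
    (Complex.equivRealProdCLM.symm : ℝ × ℝ →L[ℝ] ℂ) L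
  rw [map_complexGaussian_eq]
  refine hm.trans ?_
  rw [charFunDual_prod, charFunDual_gaussianReal_of_eq _ _ a.re,
    charFunDual_gaussianReal_of_eq _ _ (-a.im), ← Complex.exp_add]
  · congr 1
    rw [Complex.sq_norm, Complex.normSq_apply]
    push_cast
    ring
  · intro x
    simp [h, Complex.equivRealProdCLM_symm_apply]
  · intro x
    simp [h, Complex.equivRealProdCLM_symm_apply]

theorem charFunDual_gaussianVector (n : ℕ) (v : ℝ≥0) (L : StrongDual ℝ (Fin n → ℂ))
    (a : Fin n → ℂ) (h : ∀ x, L x = (∑ j, a j * x j).re) :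
    charFunDual (gaussianVector n v) L = Complex.exp (-(v / 4 * ∑ j, ‖a j‖ ^ 2 : ℝ)) := by
  rw [gaussianVector, charFunDual_pi]
  rw [Finset.prod_congr rfl fun j _ => charFunDual_complexGaussian v _ (a j) ?_,
    ← Complex.exp_sum]
  · congr 1
    rw [Finset.mul_sum]
    push_cast
    rw [Finset.sum_neg_distrib]
  · intro z
    simp [h, Pi.single_apply]

/-- The law of an `m × n` array with independent `CN(0, v)` entries. -/
abbrev gaussianArray (m n : ℕ) (v : ℝ≥0) : Measure (Fin m → Fin n → ℂ) :=
  Measure.pi fun _ => gaussianVector n v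

theorem charFunDual_gaussianArray (m n : ℕ) (v : ℝ≥0) (L : StrongDual ℝ (Fin m → Fin n → ℂ))
    (a : Fin m → Fin n → ℂ) (h : ∀ x, L x = (∑ i, ∑ j, a i j * x i j).re) :
    charFunDual (gaussianArray m n v) L =
      Complex.exp (-(v / 4 * ∑ i, ∑ j, ‖a i j‖ ^ 2 : ℝ)) := by
  rw [charFunDual_pi]
  rw [Finset.prod_congr rfl fun i _ => charFunDual_gaussianVector n v _ (a i) ?_,
    ← Complex.exp_sum]
  · congr 1
    rw [Finset.mul_sum]
    push_cast
    rw [Finset.sum_neg_distrib]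
  · intro z
    simp only [h, ContinuousLinearMap.comp_apply, ContinuousLinearMap.single_apply]
    rw [Finset.sum_eq_single i]
    · simp
    · intro b _ hb
      simp [Pi.single_eq_of_ne hb]
    · simp

theorem exists_coeff_of_dual_complex (L : StrongDual ℝ ℂ) : ∃ a : ℂ, ∀ z, L z = (a * z).re := by
  refine ⟨⟨L 1, -L Complex.I⟩, fun z => ?_⟩
  have hz : z = z.re • (1 : ℂ) + z.im • Complex.I := by
    simp [Complex.re_add_im]
  conv_lhs => rw [hz]
  rw [map_add, map_smul, map_smul]
  simp
  ring

theorem exists_coeff_of_dual_vector {n : ℕ} (L : StrongDual ℝ (Fin n → ℂ)) :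
    ∃ a : Fin n → ℂ, ∀ x, L x = (∑ j, a j * x j).re := by
  choose a ha using fun j =>
    exists_coeff_of_dual_complex (L.comp (ContinuousLinearMap.single ℝ (fun _ : Fin n => ℂ) j))
  refine ⟨a, fun x => ?_⟩
  rw [← L.sum_comp_single (v := x), Complex.re_sum]
  exact Finset.sum_congr rfl fun j _ => ha j (x j)

theorem exists_coeff_of_dual_matrix {m n : ℕ} (L : StrongDual ℝ (Fin m → Fin n → ℂ)) :
    ∃ a : Fin m → Fin n → ℂ, ∀ x, L x = (∑ i, ∑ j, a i j * x i j).re := by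
  choose a ha using fun i =>
    exists_coeff_of_dual_vector
      (L.comp (ContinuousLinearMap.single ℝ (fun _ : Fin m => Fin n → ℂ) i))
  refine ⟨a, fun x => ?_⟩
  rw [← L.sum_comp_single (v := x), Complex.re_sum]
  exact Finset.sum_congr rfl fun j _ => ha j (x j)

theorem map_swap_gaussianArray (m n : ℕ) (v : ℝ≥0) (Φ : (Fin m → Fin n → ℂ) →L[ℝ] (Fin n → Fin m → ℂ))
    (hΦ : ∀ X i j, Φ X j i = X i j) :
    (gaussianArray m n v).map Φ = gaussianArray n m v := by
  have : IsProbabilityMeasure ((gaussianArray m n v).map Φ) :=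
    Measure.isProbabilityMeasure_map Φ.continuous.measurable.aemeasurable
  refine Measure.ext_of_charFunDual (funext fun L => ?_)
  obtain ⟨a, ha⟩ := exists_coeff_of_dual_matrix L
  rw [charFunDual_gaussianArray n m v L a ha, charFunDual_map,
    charFunDual_gaussianArray m n v _ (fun i j => a j i), Finset.sum_comm]
  intro X
  rw [ContinuousLinearMap.comp_apply, ha, Finset.sum_comm]
  simp_rw [hΦ]

/-- The transpose of a Gaussian matrix with independent entries is again one. -/
theorem measurePreserving_transpose (m n : ℕ) (v : ℝ≥0) :
    MeasurePreserving (fun X : Matrix (Fin m) (Fin n) ℂ => Xᵀ)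
      (gaussianMatrix m n v) (gaussianMatrix n m v) := by
  have hc : Continuous (fun X : Matrix (Fin m) (Fin n) ℂ => Xᵀ) := by fun_prop
  let Φ : (Fin m → Fin n → ℂ) →L[ℝ] (Fin n → Fin m → ℂ) :=
    { toFun := fun X j i => X i j
      map_add' := fun _ _ => rfl
      map_smul' := fun _ _ => rfl
      cont := by fun_prop }
  exact ⟨hc.measurable, map_swap_gaussianArray m n v Φ fun _ _ _ => rfl⟩

theorem measurePreserving_mulVec {n : ℕ} (v : ℝ≥0) (U : Matrix (Fin n) (Fin n) ℂ)
    (hU : U * Uᴴ = 1) :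
    MeasurePreserving (fun x => U *ᵥ x) (gaussianVector n v) (gaussianVector n v) := by
  let Φ : (Fin n → ℂ) →L[ℝ] (Fin n → ℂ) :=
    { toFun := fun x => U *ᵥ x
      map_add' := fun _ _ => mulVec_add _ _ _
      map_smul' := fun _ _ => mulVec_smul _ _ _
      cont := by fun_prop }
  refine ⟨Φ.continuous.measurable, ?_⟩
  have : IsProbabilityMeasure (Measure.map Φ (gaussianVector n v)) :=
    Measure.isProbabilityMeasure_map Φ.continuous.measurable.aemeasurable
  refine Measure.ext_of_charFunDual (μ := Measure.map Φ (gaussianVector n v)) (funext fun L => ?_)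
  obtain ⟨a, ha⟩ := exists_coeff_of_dual_vector L
  rw [charFunDual_gaussianVector n v L a ha]
  refine (charFunDual_map Φ L).trans ?_
  rw [charFunDual_gaussianVector n v _ (a ᵥ* U)]
  · congr 4
    have h1 : ∀ b : Fin n → ℂ, ((∑ j, ‖b j‖ ^ 2 : ℝ) : ℂ) = b ⬝ᵥ star b := by
      intro b
      rw [dotProduct]
      push_cast
      exact Finset.sum_congr rfl fun j _ => by simp [Complex.mul_conj']
    apply Complex.ofReal_injective
    rw [h1, h1, star_vecMul, ← dotProduct_mulVec, mulVec_mulVec, hU, one_mulVec]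
  · intro x
    rw [ContinuousLinearMap.comp_apply, ha]
    congr 1
    change a ⬝ᵥ (U *ᵥ x) = (a ᵥ* U) ⬝ᵥ x
    exact dotProduct_mulVec _ _ _

/-- Right invariance of Gaussian matrices under unitary matrices. -/
theorem measurePreserving_mul_unitary {m n : ℕ} (v : ℝ≥0) (U : Matrix (Fin n) (Fin n) ℂ)
    (hU : U * Uᴴ = 1) :
    MeasurePreserving (fun X : Matrix (Fin m) (Fin n) ℂ => X * U)
      (gaussianMatrix m n v) (gaussianMatrix m n v) := by
  have h1 : Uᵀ * Uᵀᴴ = 1 := by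
    have : Uᴴ * U = 1 := mul_eq_one_comm.1 hU
    rw [show Uᵀᴴ = Uᴴᵀ from rfl, ← transpose_mul, this, transpose_one]
  have := measurePreserving_pi (fun _ : Fin m => gaussianVector n v)
    (fun _ : Fin m => gaussianVector n v) (fun _ => measurePreserving_mulVec v Uᵀ h1)
  have h2 : (fun X : Fin m → Fin n → ℂ => fun i => Uᵀ *ᵥ X i) =
      fun X : Matrix (Fin m) (Fin n) ℂ => X * U := by
    funext X i
    rw [mulVec_transpose]
    rfl
  rw [h2] at this
  exact this

/-- The component of a pair `(X, Z)` of arrays along `(x, z)`, with respect to the covariance. -/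
def rotationCoeff {m d n : ℕ} (s : ℝ≥0) (x : Fin m → ℂ) (z : Fin d → ℂ)
    (X : Fin m → Fin n → ℂ) (Z : Fin n → Fin d → ℂ) (j : Fin n) : ℂ :=
  ∑ i, star (x i) * X i j + ∑ i, star (z i) / s * Z j i

/-- Pythagoras for the covariance form with weights `1` and `s`: `q` is the component of the
functional `(a, b)` along the normalized direction `(x, z)`. Removing that component and adding back
an independent one of variance `‖q‖²` preserves the quadratic form, which is why the rotated pair
has the original characteristic function. -/
theorem sum_norm_sq_sub_projection {m d : ℕ} {s : ℝ≥0} (hs : s ≠ 0)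
    (x : Fin m → ℂ) (z : Fin d → ℂ)
    (h : ∑ i, ‖x i‖ ^ 2 + (∑ i, ‖z i‖ ^ 2) / s = 1) (a : Fin m → ℂ) (b : Fin d → ℂ) :
    ∑ i, ‖a i - (∑ i, a i * x i + ∑ i, b i * z i) * star (x i)‖ ^ 2 +
        s * ∑ i, ‖b i - (∑ i, a i * x i + ∑ i, b i * z i) * (star (z i) / s)‖ ^ 2 +
        ‖∑ i, a i * x i + ∑ i, b i * z i‖ ^ 2 =
      ∑ i, ‖a i‖ ^ 2 + s * ∑ i, ‖b i‖ ^ 2 := by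
  set q := ∑ i, a i * x i + ∑ i, b i * z i with hq
  have hs' : (s : ℂ) ≠ 0 := by exact_mod_cast hs
  have hqs : star q = ∑ i, star (a i) * star (x i) + ∑ i, star (b i) * star (z i) := by
    rw [hq, star_add, star_sum, star_sum]
    simp only [star_mul']
  have h' : ∑ i, x i * star (x i) + (∑ i, z i * star (z i)) / s = 1 := by
    have h2 : ((∑ i, ‖x i‖ ^ 2 + (∑ i, ‖z i‖ ^ 2) / s : ℝ) : ℂ) = 1 := by rw [h]; simp
    push_cast at h2
    rw [← h2]
    simp [Complex.mul_conj']
  apply Complex.ofReal_injective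
  push_cast
  have n2 : ∀ w : ℂ, (‖w‖ : ℂ) ^ 2 = w * star w := fun w => by simp [Complex.mul_conj']
  simp only [n2]
  have e1 : ∀ i, (a i - q * star (x i)) * star (a i - q * star (x i)) =
      a i * star (a i) - star q * (a i * x i) - q * (star (a i) * star (x i)) +
        q * star q * (x i * star (x i)) := by
    intro i; simp only [star_sub, star_mul', star_star]; ring
  have e2 : ∀ i, s * ((b i - q * (star (z i) / s)) * star (b i - q * (star (z i) / s))) =
      s * (b i * star (b i)) - star q * (b i * z i) - q * (star (b i) * star (z i)) +
        q * star q * ((z i * star (z i)) / s) := by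
    intro i
    have : star (s : ℂ) = s := Complex.conj_ofReal _
    simp only [star_sub, star_mul', star_star, star_div₀, this]
    field_simp
    ring
  simp only [Finset.mul_sum, e2]
  simp only [e1, Finset.sum_add_distrib, Finset.sum_sub_distrib, ← Finset.mul_sum,
    ← Finset.sum_div]
  linear_combination q * star q * h' - star q * (-hq) + q * hqs

theorem map_rotation_gaussianArray {m d n : ℕ} {s : ℝ≥0} (hs : s ≠ 0)
    (x : Fin m → ℂ) (z : Fin d → ℂ)
    (h : ∑ i, ‖x i‖ ^ 2 + (∑ i, ‖z i‖ ^ 2) / s = 1)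
    (Φ : ((Fin m → Fin n → ℂ) × (Fin n → Fin d → ℂ)) × (Fin n → ℂ) →L[ℝ]
      ((Fin m → Fin n → ℂ) × (Fin n → Fin d → ℂ)))
    (hΦ1 : ∀ X Z g i j, (Φ ((X, Z), g)).1 i j =
      X i j + x i * (g j - rotationCoeff s x z X Z j))
    (hΦ2 : ∀ X Z g i j, (Φ ((X, Z), g)).2 j i =
      Z j i + (g j - rotationCoeff s x z X Z j) * z i) :
    (((gaussianArray m n 1).prod (gaussianArray n d s)).prod (gaussianVector n 1)).map Φ =
      (gaussianArray m n 1).prod (gaussianArray n d s) := by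
  have : IsProbabilityMeasure
      ((((gaussianArray m n 1).prod (gaussianArray n d s)).prod (gaussianVector n 1)).map Φ) :=
    Measure.isProbabilityMeasure_map Φ.continuous.measurable.aemeasurable
  refine Measure.ext_of_charFunDual (funext fun L => ?_)
  obtain ⟨a, ha⟩ := exists_coeff_of_dual_matrix (L.comp (.inl ℝ _ _))
  obtain ⟨b, hb⟩ := exists_coeff_of_dual_matrix (L.comp (.inr ℝ _ _))
  have hL : ∀ p, L p = (∑ i, ∑ j, a i j * p.1 i j + ∑ j, ∑ i, b j i * p.2 j i).re := by
    intro p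
    rw [Complex.add_re, ← ha, ← hb]
    simp [← map_add]
  let q : Fin n → ℂ := fun j => ∑ i, a i j * x i + ∑ i, b j i * z i
  have hLΦ : ∀ X Z g, L (Φ ((X, Z), g)) = (∑ i, ∑ j, a i j * X i j + ∑ j, ∑ i, b j i * Z j i +
      ∑ j, q j * (g j - rotationCoeff s x z X Z j)).re := by
    intro X Z g
    rw [hL]
    simp only [hΦ1, hΦ2, q]
    congr 1
    simp only [mul_add, add_mul, Finset.sum_add_distrib, Finset.sum_mul]
    rw [Finset.sum_comm (f := fun j i => a i j * x i * _)]
    simp only [mul_assoc, mul_comm (_ - _) (z _)]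
    ring
  rw [charFunDual_map, charFunDual_prod, charFunDual_prod, charFunDual_prod,
    charFunDual_gaussianArray m n 1 _ a ha, charFunDual_gaussianArray n d s _ b hb,
    charFunDual_gaussianArray m n 1 _ (fun i j => a i j - q j * star (x i)),
    charFunDual_gaussianArray n d s _ (fun j i => b j i - q j * (star (z i) / s)),
    charFunDual_gaussianVector n 1 _ q]
  · rw [← Complex.exp_add, ← Complex.exp_add, ← Complex.exp_add]
    congr 1
    have key : ∀ j, ∑ i, ‖a i j - q j * star (x i)‖ ^ 2 +
        s * ∑ i, ‖b j i - q j * (star (z i) / s)‖ ^ 2 + ‖q j‖ ^ 2 =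
        ∑ i, ‖a i j‖ ^ 2 + s * ∑ i, ‖b j i‖ ^ 2 := fun j =>
      sum_norm_sq_sub_projection hs x z h (fun i => a i j) (b j)
    have key2 := Finset.sum_congr rfl fun j (_ : j ∈ Finset.univ) => key j
    simp only [Finset.sum_add_distrib, ← Finset.mul_sum] at key2
    rw [Finset.sum_comm, Finset.sum_comm (f := fun i j => ‖a i j‖ ^ 2)]
    norm_cast
    push_cast
    linear_combination (-1 / 4 : ℝ) * key2
  · intro g
    simp [hLΦ, rotationCoeff]
  · intro Z
    simp only [ContinuousLinearMap.comp_apply, ContinuousLinearMap.inl_apply,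
      ContinuousLinearMap.inr_apply, hLΦ, rotationCoeff, Pi.zero_apply, mul_zero,
      Finset.sum_const_zero, zero_add, zero_sub]
    congr 1
    simp only [sub_mul, Finset.sum_sub_distrib, mul_neg, Finset.mul_sum, Finset.sum_neg_distrib,
      mul_assoc, ← sub_eq_add_neg]
  · intro X
    simp only [ContinuousLinearMap.comp_apply, ContinuousLinearMap.inl_apply,
      hLΦ, rotationCoeff, Pi.zero_apply, mul_zero,
      Finset.sum_const_zero, add_zero, zero_sub]
    congr 1
    rw [Finset.sum_comm (f := fun i j => (a i j - q j * star (x i)) * X i j),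
      Finset.sum_comm (f := fun i j => a i j * X i j)]
    simp only [sub_mul, Finset.sum_sub_distrib, mul_neg, Finset.mul_sum, Finset.sum_neg_distrib,
      mul_assoc, ← sub_eq_add_neg]

/-- A random translation of a Gaussian pair `(X, Z)` along a fixed direction `(x, z)`, normalized
with respect to the covariance, which replaces the components along it by fresh Gaussian ones. -/
theorem measurePreserving_rotation {m d n : ℕ} {s : ℝ≥0} (hs : s ≠ 0)
    (x : Fin m → ℂ) (z : Fin d → ℂ)
    (h : ∑ i, ‖x i‖ ^ 2 + (∑ i, ‖z i‖ ^ 2) / s = 1) :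
    MeasurePreserving
      (fun q : (Matrix (Fin m) (Fin n) ℂ × Matrix (Fin n) (Fin d) ℂ) × (Fin n → ℂ) =>
        ((q.1.1 + vecMulVec x (q.2 - rotationCoeff s x z q.1.1 q.1.2),
          q.1.2 + vecMulVec (q.2 - rotationCoeff s x z q.1.1 q.1.2) z) :
          Matrix (Fin m) (Fin n) ℂ × Matrix (Fin n) (Fin d) ℂ))
      (((gaussianMatrix m n 1).prod (gaussianMatrix n d s)).prod (gaussianVector n 1))
      ((gaussianMatrix m n 1).prod (gaussianMatrix n d s)) := by
  let Φ : ((Fin m → Fin n → ℂ) × (Fin n → Fin d → ℂ)) × (Fin n → ℂ) →L[ℝ]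
      ((Fin m → Fin n → ℂ) × (Fin n → Fin d → ℂ)) :=
    { toFun := fun q =>
        (fun i j => q.1.1 i j + x i * (q.2 j - rotationCoeff s x z q.1.1 q.1.2 j),
          fun j i => q.1.2 j i + (q.2 j - rotationCoeff s x z q.1.1 q.1.2 j) * z i)
      map_add' := by
        intro p q
        have : ∀ j, rotationCoeff s x z (p + q).1.1 (p + q).1.2 j =
            rotationCoeff s x z p.1.1 p.1.2 j + rotationCoeff s x z q.1.1 q.1.2 j := by
          intro j
          simp only [rotationCoeff, Prod.fst_add, Prod.snd_add, Pi.add_apply, mul_add,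
            Finset.sum_add_distrib]
          ring
        ext i j
        · simp only [Prod.fst_add, Prod.snd_add, Pi.add_apply] at this ⊢
          rw [this]
          ring
        · simp only [Prod.fst_add, Prod.snd_add, Pi.add_apply] at this ⊢
          rw [this]
          ring
      map_smul' := by
        intro c p
        have : ∀ j, rotationCoeff s x z (c • p).1.1 (c • p).1.2 j =
            c * rotationCoeff s x z p.1.1 p.1.2 j := by
          intro j
          simp only [rotationCoeff, Prod.smul_fst, Prod.smul_snd, Pi.smul_apply,
            Complex.real_smul, mul_add, Finset.mul_sum]
          congr 1 <;> exact Finset.sum_congr rfl fun i _ => by ring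
        ext i j
        · simp only [Prod.smul_fst, Prod.smul_snd, Pi.smul_apply, Complex.real_smul,
            RingHom.id_apply] at this ⊢
          rw [this]
          ring
        · simp only [Prod.smul_fst, Prod.smul_snd, Pi.smul_apply, Complex.real_smul,
            RingHom.id_apply] at this ⊢
          rw [this]
          ring
      cont := by
        unfold rotationCoeff
        fun_prop }
  exact ⟨Φ.continuous.measurable, map_rotation_gaussianArray hs x z h Φ
    (fun _ _ _ _ _ => rfl) (fun _ _ _ _ _ => rfl)⟩

/-! ### Negative moments of determinants -/

theorem det_updateRow_eq_dotProduct {n : Type*} [Fintype n] [DecidableEq n] (A : Matrix n n ℂ)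
    (i : n) (r : n → ℂ) : (A.updateRow i r).det = r ⬝ᵥ fun j => A.adjugate j i := by
  rw [det_eq_sum_mul_adjugate_row _ i]
  refine Finset.sum_congr rfl fun j _ => ?_
  rw [updateRow_self, adjugate_apply, updateRow_idem, ← adjugate_apply]

theorem sum_norm_sq_mulVec_of_semiUnitary {m n : Type*} [Fintype m] [Fintype n] [DecidableEq n]
    {W : Matrix m n ℂ} (hW : Wᴴ * W = 1) (x : n → ℂ) :
    ∑ j, ‖(W *ᵥ x) j‖ ^ 2 = ∑ j, ‖x j‖ ^ 2 := by
  have h : ∀ {k : Type _} [Fintype k] (y : k → ℂ), ((∑ j, ‖y j‖ ^ 2 : ℝ) : ℂ) = star y ⬝ᵥ y := by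
    intro k _ y
    rw [dotProduct]
    push_cast
    exact Finset.sum_congr rfl fun j _ => by simp [Complex.conj_mul']
  have h2 : ((∑ j, ‖(W *ᵥ x) j‖ ^ 2 : ℝ) : ℂ) = star (W *ᵥ x) ⬝ᵥ (W *ᵥ x) := by
    rw [dotProduct]
    push_cast
    exact Finset.sum_congr rfl fun j _ => by simp [Complex.conj_mul']
  apply Complex.ofReal_injective
  rw [h2, h, star_mulVec, dotProduct_mulVec, vecMul_vecMul, hW, vecMul_one]

/-- The first negative moment of the determinant of an affine image of a Gaussian matrix. -/
theorem lintegral_inv_det_gaussianMatrix_le {m n : ℕ} {v : ℝ≥0} (hv : v ≠ 0)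
    {W : Matrix (Fin n) (Fin m) ℂ} (hW : Wᴴ * W = 1) (B : Matrix (Fin m) (Fin m) ℂ) :
    ∫⁻ X, ‖(B + X * W).det‖ₑ⁻¹ ∂(gaussianMatrix m n v) ≤
      (ENNReal.ofReal (invMoment v * √n) + 1) ^ m := by
  set C : ℝ≥0∞ := ENNReal.ofReal (invMoment v * √n) + 1 with hC
  -- Interpolation from the identity matrix to `B + X * W`: the rows in `s` are random, the others
  -- are still unit vectors. Each newly inserted row costs one factor `C`.
  let A : Finset (Fin m) → Matrix (Fin m) (Fin n) ℂ → Matrix (Fin m) (Fin m) ℂ :=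
    fun s X i => if i ∈ s then B i + X i ᵥ* W else Pi.single i 1
  have hAc : ∀ s, Continuous (A s) := by
    intro s
    refine continuous_pi fun i => ?_
    by_cases hi : i ∈ s
    · simp only [A, if_pos hi]
      fun_prop
    · simp only [A, if_neg hi]
      fun_prop
  have key : ∀ s : Finset (Fin m),
      ∫⁻ X, ‖(A s X).det‖ₑ⁻¹ ∂(gaussianMatrix m n v) ≤ C ^ s.card := by
    intro s
    induction s using Finset.induction_on with
    | empty =>
      have : ∀ X, A ∅ X = 1 := by
        intro X
        ext i j
        simp [A, Matrix.one_apply, Pi.single_apply, eq_comm]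
      simp [this]
    | insert k s hk ih =>
      rw [Finset.card_insert_of_notMem hk, pow_succ, mul_comm]
      have hm : Measurable fun X => ‖(A (insert k s) X).det‖ₑ⁻¹ :=
        ((hAc _).matrix_det.measurable.enorm).inv
      have hm2 : Measurable fun X => ‖(A s X).det‖ₑ⁻¹ :=
        ((hAc _).matrix_det.measurable.enorm).inv
      refine (lintegral_pi_update (fun _ : Fin m => gaussianVector n v) k hm).trans_le ?_
      refine le_trans ?_ (mul_le_mul_right ih C)
      rw [← lintegral_const_mul _ hm2]
      refine lintegral_mono fun X => ?_
      -- The determinant is affine in the new row, with the cofactor vector `c` as gradient. The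
      -- entry `c k` is the previous determinant, because row `k` was still a unit vector, so `‖W c‖
      -- = ‖c‖` is at least its modulus.
      set c : Fin m → ℂ := fun j => (A s X).adjugate j k with hc
      have h1 : ∀ x : Fin n → ℂ, (A (insert k s) (Function.update X k x)).det =
          x ⬝ᵥ (W *ᵥ c) + B k ⬝ᵥ c := by
        intro x
        have : A (insert k s) (Function.update X k x) = (A s X).updateRow k (B k + x ᵥ* W) := by
          funext i
          by_cases hi : i = k
          · subst hi
            rw [updateRow_self]
            simp [A]
          · rw [updateRow_ne hi]
            simp [A, Finset.mem_insert, hi]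
        rw [this, det_updateRow_eq_dotProduct, add_dotProduct, dotProduct_mulVec, add_comm]
      have h2 : c k = (A s X).det := by
        have h3 : (A s X).updateRow k (Pi.single k 1) = A s X := by
          have : A s X k = Pi.single k 1 := by simp [A, hk]
          rw [← this]
          exact updateRow_eq_self _ _
        rw [hc]
        simp only [adjugate_apply]
        rw [h3]
      simp only [h1]
      by_cases h0 : (A s X).det = 0
      · rw [h0, enorm_zero, ENNReal.inv_zero, ENNReal.mul_top (by simp [hC])]
        exact le_top
      · refine (lintegral_inv_affine_gaussianVector_le_of_sq hv (W *ᵥ c) _ (r := ‖(A s X).det‖)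
          (norm_pos_iff.2 h0) ?_).trans ?_
        · rw [sum_norm_sq_mulVec_of_semiUnitary hW, ← h2]
          exact Finset.single_le_sum (f := fun j => ‖c j‖ ^ 2) (fun _ _ => by positivity)
            (Finset.mem_univ k)
        · rw [ofReal_norm]
          gcongr
          exact le_self_add
  have h := key Finset.univ
  have hA : ∀ X, A Finset.univ X = B + X * W := by
    intro X
    funext i
    simp only [A, Finset.mem_univ, if_true]
    rfl
  simpa [hA] using h

theorem lintegral_inv_det_transpose_gaussianMatrix_le {m n : ℕ} {v : ℝ≥0} (hv : v ≠ 0)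
    {W : Matrix (Fin n) (Fin m) ℂ} (hW : Wᴴ * W = 1) (B : Matrix (Fin m) (Fin m) ℂ) :
    ∫⁻ Z, ‖(B + Zᵀ * W).det‖ₑ⁻¹ ∂(gaussianMatrix n m v) ≤
      (ENNReal.ofReal (invMoment v * √n) + 1) ^ m := by
  have hc : Continuous fun X : Matrix (Fin m) (Fin n) ℂ => (B + X * W).det := by fun_prop
  exact ((measurePreserving_transpose n m v).lintegral_comp
    (f := fun X => ‖(B + X * W).det‖ₑ⁻¹) hc.measurable.enorm.inv).trans_le
    (lintegral_inv_det_gaussianMatrix_le hv hW B)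

theorem ae_ne_zero_of_lintegral_inv_lt_top {Ω : Type*} [MeasurableSpace Ω] {μ : Measure Ω}
    {f : Ω → ℂ} (hf : Measurable f) {p : ℝ} (hp : 0 < p) (h : ∫⁻ x, (‖f x‖ₑ ^ p)⁻¹ ∂μ ≠ ∞) :
    ∀ᵐ x ∂μ, f x ≠ 0 := by
  filter_upwards [ae_lt_top (by fun_prop) h] with x hx h0
  simp [h0, hp] at hx

theorem ae_det_transpose_gaussianMatrix_ne_zero {m n : ℕ} {v : ℝ≥0} (hv : v ≠ 0)
    {W : Matrix (Fin n) (Fin m) ℂ} (hW : Wᴴ * W = 1) (B : Matrix (Fin m) (Fin m) ℂ) :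
    ∀ᵐ Z ∂(gaussianMatrix n m v), (B + Zᵀ * W).det ≠ 0 := by
  have hc : Continuous fun Z : Matrix (Fin n) (Fin m) ℂ => (B + Zᵀ * W).det := by fun_prop
  refine ae_ne_zero_of_lintegral_inv_lt_top hc.measurable one_pos ?_
  simp only [ENNReal.rpow_one]
  exact ((lintegral_inv_det_transpose_gaussianMatrix_le hv hW B).trans_lt
    (ENNReal.pow_lt_top (ENNReal.add_lt_top.2 ⟨ENNReal.ofReal_lt_top, ENNReal.one_lt_top⟩))).ne

/-! ### Determinants of positive semidefinite matrices -/

section Determinants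

variable {n : Type*} [Fintype n] [DecidableEq n]

/-- A single list of eigenvalues serves for all `t`, so determinants at different powers can be
compared factor by factor. -/
theorem Matrix.PosSemidef.exists_eigenvalues {K : Matrix n n ℂ} (hK : K.PosSemidef) :
    ∃ e : n → ℝ, (∀ i, 0 ≤ e i) ∧ K.trace.re = ∑ i, e i ∧
      (∀ t : ℝ, (1 + (t : ℂ) • K).det = ((∏ i, (1 + t * e i) : ℝ) : ℂ)) ∧
      (K ≠ 0 → ∃ i, 0 < e i) := by
  have hH := hK.isHermitian
  refine ⟨hH.eigenvalues, hK.eigenvalues_nonneg, ?_, fun t => ?_, fun h0 => ?_⟩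
  · rw [hH.trace_eq_sum_eigenvalues]
    simp
  · have h1 : 1 + (t : ℂ) • K = Unitary.conjStarAlgAut ℂ _ hH.eigenvectorUnitary
        (1 + (t : ℂ) • diagonal (RCLike.ofReal ∘ hH.eigenvalues)) := by
      rw [map_add, map_one, map_smul, ← hH.spectral_theorem]
    have h2 : (1 + (t : ℂ) • diagonal (RCLike.ofReal ∘ hH.eigenvalues) : Matrix n n ℂ) =
        diagonal fun i => ((1 + t * hH.eigenvalues i : ℝ) : ℂ) := by
      rw [← diagonal_one, ← diagonal_smul, diagonal_add]
      congr 1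
      funext i
      simp
    rw [h1, Unitary.conjStarAlgAut_apply, h2, det_mul, mul_comm, det_mul, ← mul_assoc, ← det_mul,
      Unitary.coe_star_mul_self, det_one, one_mul, det_diagonal]
    push_cast
    rfl
  · by_contra hcon
    push Not at hcon
    exact h0 (hH.eigenvalues_eq_zero_iff.1
      (funext fun i => le_antisymm (hcon i) (hK.eigenvalues_nonneg i)))

theorem Matrix.PosSemidef.one_add_trace_le_det {K : Matrix n n ℂ} (hK : K.PosSemidef) :
    1 + K.trace.re ≤ (1 + K).det.re := by
  obtain ⟨e, he, htr, hdet, -⟩ := hK.exists_eigenvalues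
  have h := hdet 1
  simp only [Complex.ofReal_one, one_smul, one_mul] at h
  rw [h, Complex.ofReal_re, htr]
  have : ∀ s : Finset n, 1 + ∑ i ∈ s, e i ≤ ∏ i ∈ s, (1 + e i) := by
    intro s
    induction s using Finset.induction_on with
    | empty => simp
    | insert k s hk ih =>
      rw [Finset.sum_insert hk, Finset.prod_insert hk]
      have : 0 ≤ ∑ i ∈ s, e i := Finset.sum_nonneg fun i _ => he i
      nlinarith [he k, mul_nonneg (he k) this]
  exact this _

theorem Matrix.PosSemidef.trace_re_nonneg {K : Matrix n n ℂ} (hK : K.PosSemidef) :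
    0 ≤ K.trace.re := by
  obtain ⟨e, he, htr, -, -⟩ := hK.exists_eigenvalues
  rw [htr]
  exact Finset.sum_nonneg fun i _ => he i

theorem Matrix.PosSemidef.one_le_det_one_add {K : Matrix n n ℂ} (hK : K.PosSemidef) :
    1 ≤ (1 + K).det.re :=
  (le_add_of_nonneg_right hK.trace_re_nonneg).trans hK.one_add_trace_le_det

theorem Matrix.PosSemidef.det_one_add_le {K : Matrix n n ℂ} (hK : K.PosSemidef) :
    (1 + K).det.re ≤ (1 + K.trace.re) ^ Fintype.card n := by
  obtain ⟨e, he, htr, hdet, -⟩ := hK.exists_eigenvalues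
  have h := hdet 1
  simp only [Complex.ofReal_one, one_smul, one_mul] at h
  rw [h, Complex.ofReal_re, htr, ← Finset.card_univ]
  rw [← Finset.prod_const]
  refine Finset.prod_le_prod (fun i _ => by linarith [he i]) fun i _ => ?_
  gcongr
  exact Finset.single_le_sum (fun i _ => he i) (Finset.mem_univ i)

theorem Matrix.PosSemidef.det_one_add_smul_lt {K : Matrix n n ℂ} (hK : K.PosSemidef)
    (h0 : K ≠ 0) {a b : ℝ} (ha : 0 ≤ a) (hab : a < b) :
    (1 + (a : ℂ) • K).det.re < (1 + (b : ℂ) • K).det.re := by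
  obtain ⟨e, he, -, hdet, hpos⟩ := hK.exists_eigenvalues
  obtain ⟨i, hi⟩ := hpos h0
  rw [hdet, hdet, Complex.ofReal_re, Complex.ofReal_re]
  refine Finset.prod_lt_prod (fun j _ => ?_) (fun j _ => ?_) ⟨i, Finset.mem_univ i, ?_⟩
  · have := mul_nonneg ha (he j); linarith
  · have := mul_le_mul_of_nonneg_right hab.le (he j); linarith
  · have := mul_lt_mul_of_pos_right hab hi; linarith

/-- Factor `A = Cᴴ C`. If `C` is invertible, then `A + B = Cᴴ (1 + K) C` with `K` positive
semidefinite, and `det (1 + K) ≥ 1`. Otherwise `det A = 0`. -/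
theorem Matrix.PosSemidef.det_re_le_det_add {A B : Matrix n n ℂ} (hA : A.PosSemidef)
    (hB : B.PosSemidef) : A.det.re ≤ (A + B).det.re := by
  open scoped MatrixOrder in
  obtain ⟨C, rfl⟩ := CStarAlgebra.nonneg_iff_eq_star_mul_self.mp hA.nonneg
  rw [star_eq_conjTranspose] at *
  by_cases hC : IsUnit C.det
  · have hCu : C⁻¹ * C = 1 := nonsing_inv_mul _ hC
    have hK : (C⁻¹ᴴ * B * C⁻¹).PosSemidef := hB.conjTranspose_mul_mul_same C⁻¹
    have e : Cᴴ * C + B = Cᴴ * (1 + C⁻¹ᴴ * B * C⁻¹) * C := by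
      have h1 : Cᴴ * C⁻¹ᴴ = 1 := by rw [← conjTranspose_mul, hCu, conjTranspose_one]
      calc Cᴴ * C + B = Cᴴ * C + (Cᴴ * C⁻¹ᴴ) * B * (C⁻¹ * C) := by rw [h1, hCu]; simp
        _ = _ := by simp only [Matrix.mul_add, Matrix.add_mul, Matrix.mul_assoc, Matrix.mul_one]
    have h2 : ∀ D : Matrix n n ℂ, (Cᴴ * D * C).det.re = ‖C.det‖ ^ 2 * D.det.re := by
      intro D
      rw [det_mul, det_mul, det_conjTranspose]
      have : star C.det * D.det * C.det = ((‖C.det‖ ^ 2 : ℝ) : ℂ) * D.det := by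
        push_cast
        rw [← Complex.conj_mul']
        simp only [Complex.star_def]
        ring
      rw [this, Complex.re_ofReal_mul]
    have h3 := h2 1
    rw [Matrix.mul_one] at h3
    rw [e, h2, h3, det_one]
    exact mul_le_mul_of_nonneg_left hK.one_le_det_one_add (by positivity)
  · have : C.det = 0 := by simpa using hC
    rw [det_mul, this, mul_zero]
    simpa using (Complex.nonneg_iff.1 (hA.add hB).det_nonneg).1

end Determinants

/-! ### The Frobenius norm -/

section Frobenius

variable {m n p : Type*} [Fintype m] [Fintype n] [Fintype p]

/-- The squared Frobenius norm of a complex matrix. -/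
def frobSq (A : Matrix m n ℂ) : ℝ := ∑ i, ∑ j, ‖A i j‖ ^ 2

theorem frobSq_nonneg (A : Matrix m n ℂ) : 0 ≤ frobSq A :=
  Finset.sum_nonneg fun _ _ => Finset.sum_nonneg fun _ _ => by positivity

theorem trace_mul_conjTranspose_re (A : Matrix m n ℂ) : (A * Aᴴ).trace.re = frobSq A := by
  simp only [Matrix.trace, diag_apply, Matrix.mul_apply, conjTranspose_apply, frobSq,
    Complex.re_sum]
  refine Finset.sum_congr rfl fun i _ => Finset.sum_congr rfl fun j _ => ?_
  rw [Complex.star_def, Complex.mul_conj']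
  norm_cast

theorem frobSq_mul_le (A : Matrix m n ℂ) (B : Matrix n p ℂ) :
    frobSq (A * B) ≤ frobSq A * frobSq B := by
  have h : ∀ i j, ‖(A * B) i j‖ ^ 2 ≤ (∑ k, ‖A i k‖ ^ 2) * ∑ k, ‖B k j‖ ^ 2 := by
    intro i j
    refine le_trans ?_ (Finset.sum_mul_sq_le_sq_mul_sq _ _ _)
    rw [Matrix.mul_apply]
    gcongr
    exact (norm_sum_le _ _).trans (Finset.sum_le_sum fun k _ => (norm_mul _ _).le)
  calc frobSq (A * B) ≤ ∑ i, ∑ j, (∑ k, ‖A i k‖ ^ 2) * ∑ k, ‖B k j‖ ^ 2 :=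
        Finset.sum_le_sum fun i _ => Finset.sum_le_sum fun j _ => h i j
    _ = frobSq A * ∑ j, ∑ k, ‖B k j‖ ^ 2 := by
        rw [frobSq, Finset.sum_mul]
        simp only [Finset.mul_sum]
    _ = _ := by rw [Finset.sum_comm]; rfl

theorem frobSq_of_semiUnitary [DecidableEq n] {W : Matrix m n ℂ} (hW : Wᴴ * W = 1) :
    frobSq W = Fintype.card n := by
  rw [← trace_mul_conjTranspose_re, Matrix.trace_mul_comm, hW]
  simp

theorem norm_sq_le_frobSq (A : Matrix m n ℂ) (i : m) (j : n) : ‖A i j‖ ^ 2 ≤ frobSq A :=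
  (Finset.single_le_sum (f := fun j => ‖A i j‖ ^ 2) (fun _ _ => by positivity)
    (Finset.mem_univ j)).trans
    (Finset.single_le_sum (f := fun i => ∑ j, ‖A i j‖ ^ 2)
      (fun _ _ => Finset.sum_nonneg fun _ _ => by positivity) (Finset.mem_univ i))

end Frobenius

/-! ### Stacked channel matrices and zero-forcing projectors -/

theorem tendsto_matrix_inv {n α : Type*} [Fintype n] [DecidableEq n] {l : Filter α}
    {f : α → Matrix n n ℂ} {A : Matrix n n ℂ} (hf : Tendsto f l (𝓝 A)) (hA : A.det ≠ 0) :
    Tendsto (fun x => (f x)⁻¹) l (𝓝 A⁻¹) := by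
  simp only [Matrix.inv_def, Ring.inverse_eq_inv']
  have h1 : Tendsto (fun x => (f x).det) l (𝓝 A.det) :=
    ((continuous_id.matrix_det).tendsto A).comp hf
  have h2 : Tendsto (fun x => (f x).adjugate) l (𝓝 A.adjugate) :=
    ((continuous_id.matrix_adjugate).tendsto A).comp hf
  exact (h1.inv₀ hA).smul h2

theorem tendsto_matrix_mul {m n p α : Type*} [Fintype n] {l : Filter α}
    {f : α → Matrix m n ℂ} {g : α → Matrix n p ℂ} {A : Matrix m n ℂ} {B : Matrix n p ℂ}
    (hf : Tendsto f l (𝓝 A)) (hg : Tendsto g l (𝓝 B)) :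
    Tendsto (fun x => f x * g x) l (𝓝 (A * B)) := by
  refine tendsto_pi_nhds.2 fun i => tendsto_pi_nhds.2 fun j => ?_
  simp only [Matrix.mul_apply]
  refine tendsto_finsetSum _ fun k _ => Tendsto.mul ?_ ?_
  · exact tendsto_pi_nhds.1 (tendsto_pi_nhds.1 hf i) k
  · exact tendsto_pi_nhds.1 (tendsto_pi_nhds.1 hg k) j

section Stack

variable {ι : Type*} {d N : ℕ}

/-- The channels of all users, stacked into a square matrix. -/
def stack (e : ι × Fin d ≃ Fin N) (G : ι → Matrix (Fin d) (Fin N) ℂ) :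
    Matrix (Fin N) (Fin N) ℂ :=
  fun i j => G (e.symm i).1 (e.symm i).2 j

theorem continuous_stack (e : ι × Fin d ≃ Fin N) : Continuous (stack e) := by
  refine continuous_pi fun i => continuous_pi fun j => ?_
  unfold stack
  fun_prop

theorem stack_mul_apply (e : ι × Fin d ≃ Fin N) (G : ι → Matrix (Fin d) (Fin N) ℂ) {p : Type*}
    (X : Matrix (Fin N) p ℂ) (l : ι) (i : Fin d) (c : p) :
    (stack e G * X) (e (l, i)) c = (G l * X) i c := by
  simp [Matrix.mul_apply, stack]

/-- The block column of the inverse of the stacked channel matrix which belongs to user `k`. -/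
def nullBasis (e : ι × Fin d ≃ Fin N) (G : ι → Matrix (Fin d) (Fin N) ℂ) (k : ι) :
    Matrix (Fin N) (Fin d) ℂ :=
  fun j i => (stack e G)⁻¹ j (e (k, i))

/-- The orthogonal projector onto the joint null space of the channels of all users but `k`. -/
def nullProj (e : ι × Fin d ≃ Fin N) (G : ι → Matrix (Fin d) (Fin N) ℂ) (k : ι) :
    Matrix (Fin N) (Fin N) ℂ :=
  nullBasis e G k * ((nullBasis e G k)ᴴ * nullBasis e G k)⁻¹ * (nullBasis e G k)ᴴ

/-- The product of the stacked matrix with `X` vanishes outside block `k`. Multiplying back by the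
inverse uses only the block column of user `k`. -/
theorem eq_nullBasis_mul [Fintype ι] [DecidableEq ι] (e : ι × Fin d ≃ Fin N)
    {G : ι → Matrix (Fin d) (Fin N) ℂ} (hG : (stack e G).det ≠ 0) {p : Type*} {k : ι}
    {X : Matrix (Fin N) p ℂ} (hX : ∀ l, l ≠ k → G l * X = 0) :
    X = nullBasis e G k * (G k * X) := by
  have h1 : X = (stack e G)⁻¹ * (stack e G * X) := by
    rw [← Matrix.mul_assoc, nonsing_inv_mul _ (isUnit_iff_ne_zero.2 hG), Matrix.one_mul]
  conv_lhs => rw [h1]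
  ext j c
  rw [Matrix.mul_apply, Matrix.mul_apply, ← e.sum_comp, Fintype.sum_prod_type,
    Finset.sum_eq_single k]
  · simp only [stack_mul_apply, nullBasis]
  · intro l _ hl
    refine Finset.sum_eq_zero fun i _ => ?_
    rw [stack_mul_apply, hX l hl]
    simp
  · simp

section SemiUnitary

variable [Fintype ι] [DecidableEq ι] (e : ι × Fin d ≃ Fin N) {G : ι → Matrix (Fin d) (Fin N) ℂ}
  (hG : (stack e G).det ≠ 0) {k : ι} {W : Matrix (Fin N) (Fin d) ℂ} (hW : Wᴴ * W = 1)
  (hz : ∀ l, l ≠ k → G l * W = 0)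

include hG hW hz

theorem conjTranspose_mul_nullBasis_mul :
    (G k * W)ᴴ * ((nullBasis e G k)ᴴ * nullBasis e G k) * (G k * W) = 1 := by
  have h := eq_nullBasis_mul e hG hz
  rw [← hW]
  conv_rhs => rw [h]
  rw [conjTranspose_mul (nullBasis e G k)]
  simp only [Matrix.mul_assoc]

theorem det_mul_ne_zero_of_stack : (G k * W).det ≠ 0 := by
  intro h0
  have h := congrArg Matrix.det (conjTranspose_mul_nullBasis_mul e hG hW hz)
  rw [det_mul, h0, mul_zero, det_one] at h
  exact zero_ne_one h

theorem det_nullBasis_ne_zero : ((nullBasis e G k)ᴴ * nullBasis e G k).det ≠ 0 := by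
  intro h0
  have h := congrArg Matrix.det (conjTranspose_mul_nullBasis_mul e hG hW hz)
  rw [det_mul, det_mul, h0, mul_zero, zero_mul, det_one] at h
  exact zero_ne_one h

/-- A precoder rule may be discontinuous and may use the user's own estimate, but only `W Wᴴ` enters
the rates. For generic channels this is forced to be one projector, a continuous function of the
channels. -/
theorem mul_conjTranspose_eq_nullProj : W * Wᴴ = nullProj e G k := by
  have h := eq_nullBasis_mul e hG hz
  have hB := det_mul_ne_zero_of_stack e hG hW hz
  have h1 := conjTranspose_mul_nullBasis_mul e hG hW hz
  have hV : ((nullBasis e G k)ᴴ * nullBasis e G k)⁻¹ = (G k * W) * (G k * W)ᴴ := by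
    apply inv_eq_right_inv
    have h2 : (nullBasis e G k)ᴴ * nullBasis e G k * (G k * W) * (G k * W)ᴴ = 1 := by
      rw [mul_eq_one_comm, ← Matrix.mul_assoc]
      exact h1
    rw [← Matrix.mul_assoc]
    exact h2
  rw [nullProj, hV]
  conv_lhs => rw [h]
  rw [conjTranspose_mul (nullBasis e G k)]
  simp only [Matrix.mul_assoc]

/-- Zero-forcing projectors depend continuously on the channels where these are nondegenerate. -/
theorem tendsto_nullProj {α : Type*} {f : α → ι → Matrix (Fin d) (Fin N) ℂ} {l : Filter α}
    (hf : Tendsto f l (𝓝 G)) : Tendsto (fun x => nullProj e (f x) k) l (𝓝 (nullProj e G k)) := by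
  have h1 : Tendsto (fun x => (stack e (f x))⁻¹) l (𝓝 (stack e G)⁻¹) :=
    tendsto_matrix_inv (((continuous_stack e).tendsto G).comp hf) hG
  have hc : Continuous fun S : Matrix (Fin N) (Fin N) ℂ =>
      (fun j i => S j (e (k, i)) : Matrix (Fin N) (Fin d) ℂ) :=
    continuous_pi fun j => continuous_pi fun i => by fun_prop
  have h2 : Tendsto (fun x => nullBasis e (f x) k) l (𝓝 (nullBasis e G k)) :=
    (hc.tendsto _).comp h1
  have hct : Continuous fun A : Matrix (Fin N) (Fin d) ℂ => Aᴴ := by fun_prop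
  have h3 : Tendsto (fun x => (nullBasis e (f x) k)ᴴ) l (𝓝 (nullBasis e G k)ᴴ) :=
    (hct.tendsto _).comp h2
  have h4 := tendsto_matrix_inv (tendsto_matrix_mul h3 h2) (det_nullBasis_ne_zero e hG hW hz)
  exact tendsto_matrix_mul (tendsto_matrix_mul h2 h4) h3

/-- A kernel vector of the updated stack is annihilated by all users but `k`, hence lies in the
range of `W`. Invertibility of `Y W` then makes it zero. -/
theorem stack_update_det_ne_zero {Y : Matrix (Fin d) (Fin N) ℂ} (hY : (Y * W).det ≠ 0) :
    (stack e (Function.update G k Y)).det ≠ 0 := by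
  intro h0
  obtain ⟨x, hx0, hx⟩ := exists_mulVec_eq_zero_iff.2 h0
  set X : Matrix (Fin N) (Fin 1) ℂ := fun i _ => x i with hX
  have hS : stack e (Function.update G k Y) * X = 0 := by
    ext i j
    exact congrFun hx i
  have hrow : ∀ l, Function.update G k Y l * X = 0 := by
    intro l
    ext i c
    rw [← stack_mul_apply e, hS]
    simp
  have hX1 : ∀ l, l ≠ k → G l * X = 0 := fun l hl => by
    have := hrow l
    rwa [Function.update_of_ne hl] at this
  have hX2 : Y * X = 0 := by simpa using hrow k
  have hB := isUnit_iff_ne_zero.2 (det_mul_ne_zero_of_stack e hG hW hz)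
  have e1 := eq_nullBasis_mul e hG hz
  have e2 := eq_nullBasis_mul e hG hX1
  set B := G k * W with hBdef
  have e3 : X = W * (B⁻¹ * (G k * X)) := by
    conv_lhs => rw [e2]
    conv_rhs => rw [e1]
    rw [Matrix.mul_assoc, ← Matrix.mul_assoc B, mul_nonsing_inv _ hB, Matrix.one_mul]
  have e4 : Y * W * (B⁻¹ * (G k * X)) = 0 := by
    rw [Matrix.mul_assoc, ← e3, hX2]
  have e5 : B⁻¹ * (G k * X) = 0 := by
    have := congrArg ((Y * W)⁻¹ * ·) e4
    simpa [← Matrix.mul_assoc, nonsing_inv_mul _ (isUnit_iff_ne_zero.2 hY)] using this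
  rw [e5, Matrix.mul_zero] at e3
  exact hx0 (funext fun i => congrFun (congrFun e3 i) 0)

end SemiUnitary

/-- Channels with unit stacked matrix. -/
def unitChannels (e : ι × Fin d ≃ Fin N) (k : ι) : Matrix (Fin d) (Fin N) ℂ :=
  fun i j => if j = e (k, i) then 1 else 0

theorem stack_unitChannels (e : ι × Fin d ≃ Fin N) : stack e (unitChannels e) = 1 := by
  ext i j
  simp [stack, unitChannels, Matrix.one_apply, eq_comm]

variable [Fintype ι] [DecidableEq ι]

/-- The stacked matrix of independent generic channels is almost surely invertible. -/
theorem ae_stack_ite_det_ne_zero {Ω : Type*} [MeasurableSpace Ω] {ν : Measure Ω}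
    [IsProbabilityMeasure ν] (e : ι × Fin d ≃ Fin N)
    {W : (ι → Matrix (Fin d) (Fin N) ℂ) → ι → Matrix (Fin N) (Fin d) ℂ} (hW : IsBDPrecoder W)
    {y : ι → Ω → Matrix (Fin d) (Fin N) ℂ} (hy : ∀ k, Measurable (y k)) (s : Finset ι)
    (h : ∀ k ∈ s, ∀ V : Matrix (Fin N) (Fin d) ℂ, Vᴴ * V = 1 → ∀ᵐ x ∂ν, (y k x * V).det ≠ 0) :
    ∀ᵐ ω ∂(Measure.pi fun _ : ι => ν),
      (stack e fun k => if k ∈ s then y k (ω k) else unitChannels e k).det ≠ 0 := by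
  induction s using Finset.induction_on with
  | empty => simp [stack_unitChannels]
  | insert k s hk ih =>
    have ih := ih fun j hj => h j (Finset.mem_insert_of_mem hj)
    have hm : Measurable fun ω : ι → Ω =>
        (stack e fun j => if j ∈ insert k s then y j (ω j) else unitChannels e j).det := by
      have h1 : Measurable fun ω : ι → Ω =>
          fun j => if j ∈ insert k s then y j (ω j) else unitChannels e j := by
        rw [measurable_pi_iff]
        intro j
        by_cases hj : j ∈ insert k s
        · simp only [if_pos hj]; exact (hy j).comp (measurable_pi_apply j)
        · simp only [if_neg hj]; exact measurable_const
      exact (continuous_stack e).matrix_det.measurable.comp h1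
    refine (ae_pi_update (fun _ => ν) k (hm (measurableSet_singleton 0)).compl).2 ?_
    filter_upwards [ih] with ω hω
    -- `G` does not involve the coordinate `k`, since `k ∉ s`. The precoder rule evaluated at `G`
    -- supplies a fixed semi-unitary basis of the null space of the other users, against which the
    -- fresh channel of user `k` is generic.
    set G := fun j => if j ∈ s then y j (ω j) else unitChannels e j with hG
    filter_upwards [h k (Finset.mem_insert_self k s) (W G k) (hW.semiUnitary G k)] with x hx
    have := stack_update_det_ne_zero e hω (hW.semiUnitary G k) (fun l hl => hW.zeroForcing G k l hl)
      hx
    have hGk : (fun j => if j ∈ insert k s then y j (Function.update ω k x j)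
        else unitChannels e j) = Function.update G k (y k x) := by
      funext j
      by_cases hj : j = k
      · subst hj; simp
      · simp [Finset.mem_insert, hj, hG]
    simpa only [Set.mem_preimage, Set.mem_singleton_iff, hGk] using this


theorem ae_stack_det_ne_zero {Ω : Type*} [MeasurableSpace Ω] {ν : Measure Ω}
    [IsProbabilityMeasure ν] (e : ι × Fin d ≃ Fin N)
    {W : (ι → Matrix (Fin d) (Fin N) ℂ) → ι → Matrix (Fin N) (Fin d) ℂ} (hW : IsBDPrecoder W)
    {y : ι → Ω → Matrix (Fin d) (Fin N) ℂ} (hy : ∀ k, Measurable (y k))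
    (h : ∀ k, ∀ V : Matrix (Fin N) (Fin d) ℂ, Vᴴ * V = 1 → ∀ᵐ x ∂ν, (y k x * V).det ≠ 0) :
    ∀ᵐ ω ∂(Measure.pi fun _ : ι => ν), (stack e fun k => y k (ω k)).det ≠ 0 := by
  simpa using ae_stack_ite_det_ne_zero e hW hy Finset.univ fun k _ => h k

end Stack

/-! ### Deterministic bounds on the rates -/

section Rates

variable {ι : Type*} {d N : ℕ}

theorem bdCovariance_posSemidef {P : ℝ} (hP : 0 ≤ P) (H : Matrix (Fin d) (Fin N) ℂ)
    (W : ι → Matrix (Fin N) (Fin d) ℂ) (s : Finset ι) : (bdCovariance P H W s).PosSemidef := by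
  refine posSemidef_sum s fun l _ => PosSemidef.smul ?_ ?_
  · have := posSemidef_self_mul_conjTranspose (H * W l)
    rwa [conjTranspose_mul, ← Matrix.mul_assoc] at this
  · exact_mod_cast div_nonneg hP (Nat.cast_nonneg N)

theorem trace_bdCovariance_re (P : ℝ) (H : Matrix (Fin d) (Fin N) ℂ)
    (W : ι → Matrix (Fin N) (Fin d) ℂ) (s : Finset ι) :
    (bdCovariance P H W s).trace.re = P / N * ∑ l ∈ s, frobSq (H * W l) := by
  rw [bdCovariance, trace_sum, Complex.re_sum, Finset.mul_sum]
  refine Finset.sum_congr rfl fun l _ => ?_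
  rw [trace_smul, smul_eq_mul, Complex.re_ofReal_mul, ← trace_mul_conjTranspose_re,
    conjTranspose_mul, ← Matrix.mul_assoc]

/-- The received power determinant, signal plus interference plus noise. -/
def covDet (P : ℝ) (H : Matrix (Fin d) (Fin N) ℂ) (W : ι → Matrix (Fin N) (Fin d) ℂ)
    (s : Finset ι) : ℝ := (1 + bdCovariance P H W s).det.re

theorem one_le_covDet {P : ℝ} (hP : 0 ≤ P) (H : Matrix (Fin d) (Fin N) ℂ)
    (W : ι → Matrix (Fin N) (Fin d) ℂ) (s : Finset ι) : 1 ≤ covDet P H W s :=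
  (bdCovariance_posSemidef hP H W s).one_le_det_one_add

theorem log_covDet_nonneg {P : ℝ} (hP : 0 ≤ P) (H : Matrix (Fin d) (Fin N) ℂ)
    (W : ι → Matrix (Fin N) (Fin d) ℂ) (s : Finset ι) : 0 ≤ Real.log (covDet P H W s) :=
  Real.log_nonneg (one_le_covDet hP H W s)

/-- Linear in the received power, from `log (1 + x) ≤ x`. This is crude for large power, but it
gives integrability and bounds interference of bounded power. -/
theorem log_covDet_le {P : ℝ} (hP : 0 ≤ P) (H : Matrix (Fin d) (Fin N) ℂ)
    (W : ι → Matrix (Fin N) (Fin d) ℂ) (s : Finset ι) :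
    Real.log (covDet P H W s) ≤ d * (P / N * ∑ l ∈ s, frobSq (H * W l)) := by
  have hK := bdCovariance_posSemidef hP H W s
  have h1 := hK.det_one_add_le
  have h2 := hK.trace_re_nonneg
  rw [trace_bdCovariance_re, Fintype.card_fin] at h1
  rw [trace_bdCovariance_re] at h2
  calc Real.log (covDet P H W s) ≤ Real.log ((1 + P / N * ∑ l ∈ s, frobSq (H * W l)) ^ d) :=
        Real.log_le_log (zero_lt_one.trans_le (one_le_covDet hP H W s)) h1
    _ = d * Real.log (1 + P / N * ∑ l ∈ s, frobSq (H * W l)) := Real.log_pow _ _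
    _ ≤ _ := by
        gcongr
        have := Real.log_le_sub_one_of_pos (x := 1 + P / N * ∑ l ∈ s, frobSq (H * W l))
          (by linarith)
        linarith

/-- The trace of the covariance is at most `P ‖H‖²`, because the total number of streams cancels the
equal split `1 / N`. The leading term is thus exactly `d log P`. -/
theorem log_covDet_univ_le [Fintype ι] (hN : Fintype.card ι * d = N) (hN0 : 0 < N) {P : ℝ}
    (hP : 1 ≤ P) (H : Matrix (Fin d) (Fin N) ℂ) {W : ι → Matrix (Fin N) (Fin d) ℂ}
    (hW : ∀ k, (W k)ᴴ * W k = 1) :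
    Real.log (covDet P H W Finset.univ) ≤ d * Real.log P + d * frobSq H := by
  have hP0 : 0 ≤ P := zero_le_one.trans hP
  have hK := bdCovariance_posSemidef hP0 H W Finset.univ
  have h1 := hK.det_one_add_le
  rw [trace_bdCovariance_re, Fintype.card_fin] at h1
  have hF := frobSq_nonneg H
  have h2 : P / N * ∑ l, frobSq (H * W l) ≤ P * frobSq H := by
    have : ∑ l, frobSq (H * W l) ≤ N * frobSq H := by
      calc ∑ l, frobSq (H * W l) ≤ ∑ _l : ι, frobSq H * d := by
            refine Finset.sum_le_sum fun l _ => (frobSq_mul_le _ _).trans ?_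
            rw [frobSq_of_semiUnitary (hW l), Fintype.card_fin]
        _ = _ := by
            have hN' : (N : ℝ) = Fintype.card ι * d := by exact_mod_cast hN.symm
            rw [Finset.sum_const, Finset.card_univ, nsmul_eq_mul, hN']
            ring
    calc _ ≤ P / N * (N * frobSq H) := by gcongr
      _ = _ := by
        have : (N : ℝ) ≠ 0 := by positivity
        field_simp
  have h3 : 0 ≤ P / N * ∑ l, frobSq (H * W l) := by
    have := Finset.sum_nonneg fun l (_ : l ∈ Finset.univ) => frobSq_nonneg (H * W l)
    positivity
  calc Real.log (covDet P H W Finset.univ) ≤ Real.log ((P * (1 + frobSq H)) ^ d) := by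
        refine Real.log_le_log (zero_lt_one.trans_le (one_le_covDet hP0 H W _)) (h1.trans ?_)
        exact pow_le_pow_left₀ (by linarith) (by nlinarith) _
    _ = d * Real.log P + d * Real.log (1 + frobSq H) := by
        rw [Real.log_pow, Real.log_mul (by positivity) (by positivity), mul_add]
    _ ≤ _ := by
        gcongr
        have := Real.log_le_sub_one_of_pos (x := 1 + frobSq H) (by linarith)
        linarith

/-- Noise and interference only increase the determinant. Dropping them leaves `(P / N)ᵈ |det (H W
k)|²`. -/
theorem le_log_covDet_univ [Fintype ι] [DecidableEq ι] (hN0 : 0 < N) {P : ℝ} (hP : 0 < P)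
    (H : Matrix (Fin d) (Fin N) ℂ) (W : ι → Matrix (Fin N) (Fin d) ℂ) (k : ι)
    (h0 : (H * W k).det ≠ 0) :
    d * Real.log (P / N) + 2 * Real.log ‖(H * W k).det‖ ≤
      Real.log (covDet P H W Finset.univ) := by
  have hPN : 0 < P / N := by positivity
  have h1 : (((P / N : ℝ) : ℂ) • (H * W k * (W k)ᴴ * Hᴴ)).PosSemidef := by
    simpa [bdCovariance] using bdCovariance_posSemidef hP.le H W {k}
  have h2 : (1 + bdCovariance P H W (Finset.univ.erase k)).PosSemidef :=
    PosSemidef.one.add (bdCovariance_posSemidef hP.le H W _)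
  have h3 := h1.det_re_le_det_add h2
  have h4 : ((P / N : ℝ) : ℂ) • (H * W k * (W k)ᴴ * Hᴴ) +
      (1 + bdCovariance P H W (Finset.univ.erase k)) = 1 + bdCovariance P H W Finset.univ := by
    rw [bdCovariance, bdCovariance, ← Finset.add_sum_erase _ _ (Finset.mem_univ k)]
    abel
  have h5 : (((P / N : ℝ) : ℂ) • (H * W k * (W k)ᴴ * Hᴴ)).det.re =
      (P / N) ^ d * ‖(H * W k).det‖ ^ 2 := by
    rw [det_smul, Fintype.card_fin, Matrix.mul_assoc, ← conjTranspose_mul, det_mul,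
      det_conjTranspose, Complex.star_def, Complex.mul_conj']
    norm_cast
  rw [h4, h5] at h3
  have h6 : 0 < ‖(H * W k).det‖ := norm_pos_iff.2 h0
  calc _ = Real.log ((P / N) ^ d * ‖(H * W k).det‖ ^ 2) := by
        rw [Real.log_mul (by positivity) (by positivity), Real.log_pow, Real.log_pow]
        norm_num
    _ ≤ _ := Real.log_le_log (by positivity) h3

theorem log_one_add_le_log_covDet {P : ℝ} (hP : 0 ≤ P) (H : Matrix (Fin d) (Fin N) ℂ)
    (W : ι → Matrix (Fin N) (Fin d) ℂ) {s : Finset ι} {l : ι} (hl : l ∈ s) (i j : Fin d) :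
    Real.log (1 + P / N * ‖(H * W l) i j‖ ^ 2) ≤ Real.log (covDet P H W s) := by
  have hK := bdCovariance_posSemidef hP H W s
  have h1 := hK.one_add_trace_le_det
  rw [trace_bdCovariance_re] at h1
  have hPN : 0 ≤ P / N := div_nonneg hP (Nat.cast_nonneg N)
  refine Real.log_le_log (by positivity) (le_trans ?_ h1)
  gcongr
  exact (norm_sq_le_frobSq (H * W l) i j).trans
    (Finset.single_le_sum (f := fun l => frobSq (H * W l)) (fun _ _ => frobSq_nonneg _) hl)

theorem bdRate_mul_log [Fintype ι] [DecidableEq ι] {P : ℝ} (hP : 0 ≤ P)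
    (H : Matrix (Fin d) (Fin N) ℂ) (W : ι → Matrix (Fin N) (Fin d) ℂ) (k : ι) :
    bdRate P H W k = (Real.log (covDet P H W Finset.univ) -
      Real.log (covDet P H W (Finset.univ.erase k))) / Real.log 2 := by
  have h1 := one_le_covDet hP H W Finset.univ
  have h2 := one_le_covDet hP H W (Finset.univ.erase k)
  rw [← Real.log_div (by linarith) (by linarith)]
  rfl

end Rates

/-! ### Convergence of integrals under a one-sided exponential moment bound -/

/-- The error of truncating from below at `-L`, by `1 + y ≤ exp y` with `y = (-L - x) / 4`. A
bounded moment of `exp (-x / 4)` makes this error uniformly small as `L → ∞`. -/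
theorem sub_le_four_mul_exp (L x : ℝ) :
    max x (-L) - x ≤ 4 * Real.exp (-L / 4) * Real.exp (-x / 4) := by
  rw [mul_assoc, ← Real.exp_add]
  rcases le_total x (-L) with h | h
  · rw [max_eq_right h]
    have := Real.add_one_le_exp (-L / 4 + -x / 4)
    linarith
  · rw [max_eq_left h, sub_self]
    positivity

section ExpMoment

variable {Ω : Type*} [MeasurableSpace Ω] {μ : Measure Ω} [IsProbabilityMeasure μ]

theorem integrable_exp_of_lintegral_le {f : Ω → ℝ} (hf : AEStronglyMeasurable f μ) {C : ℝ≥0}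
    (hC : ∫⁻ ω, ENNReal.ofReal (Real.exp (-f ω / 4)) ∂μ ≤ C) :
    Integrable (fun ω => Real.exp (-f ω / 4)) μ ∧ ∫ ω, Real.exp (-f ω / 4) ∂μ ≤ C := by
  have hm : AEStronglyMeasurable (fun ω => Real.exp (-f ω / 4)) μ :=
    (Real.continuous_exp.comp (continuous_neg.div_const 4)).comp_aestronglyMeasurable hf
  constructor
  · refine ⟨hm, (hasFiniteIntegral_iff_ofReal (ae_of_all _ fun _ => by positivity)).2 ?_⟩
    exact hC.trans_lt ENNReal.coe_lt_top
  · rw [integral_eq_lintegral_of_nonneg_ae (ae_of_all _ fun _ => by positivity) hm]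
    exact ENNReal.toReal_le_coe_of_le_coe hC

theorem integrable_of_exp_moment {f U : Ω → ℝ} (hf : AEStronglyMeasurable f μ)
    (hU : Integrable U μ) (hfU : f ≤ᵐ[μ] U) {C : ℝ≥0}
    (hC : ∫⁻ ω, ENNReal.ofReal (Real.exp (-f ω / 4)) ∂μ ≤ C) : Integrable f μ := by
  have h1 := (integrable_exp_of_lintegral_le hf hC).1
  refine (hU.abs.add (h1.const_mul 4)).mono' hf ?_
  filter_upwards [hfU] with ω hω
  have h2 := sub_le_four_mul_exp 0 (f ω)
  simp only [neg_zero, zero_div, Real.exp_zero, mul_one] at h2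
  rw [Real.norm_eq_abs, Pi.add_apply, abs_le]
  have h3 := le_max_right (f ω) 0
  have h4 := le_abs_self (U ω)
  have h5 := abs_nonneg (U ω)
  have h6 := Real.exp_pos (-f ω / 4)
  constructor <;> linarith

theorem integral_max_sub_le {f U : Ω → ℝ} (hf : AEStronglyMeasurable f μ)
    (hU : Integrable U μ) (hfU : f ≤ᵐ[μ] U) {C : ℝ≥0}
    (hC : ∫⁻ ω, ENNReal.ofReal (Real.exp (-f ω / 4)) ∂μ ≤ C) (L : ℝ) :
    |∫ ω, max (f ω) (-L) ∂μ - ∫ ω, f ω ∂μ| ≤ 4 * Real.exp (-L / 4) * C := by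
  have hi := integrable_of_exp_moment hf hU hfU hC
  have h1 := integrable_exp_of_lintegral_le hf hC
  have him : Integrable (fun ω => max (f ω) (-L)) μ := hi.sup (integrable_const (-L))
  rw [← integral_sub him hi, abs_of_nonneg (integral_nonneg fun ω => sub_nonneg.2 (le_max_left _ _))]
  calc _ ≤ ∫ ω, 4 * Real.exp (-L / 4) * Real.exp (-f ω / 4) ∂μ :=
        integral_mono (him.sub hi) (h1.1.const_mul _) fun ω => sub_le_four_mul_exp L (f ω)
    _ = 4 * Real.exp (-L / 4) * ∫ ω, Real.exp (-f ω / 4) ∂μ := integral_const_mul _ _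
    _ ≤ _ := by gcongr; exact h1.2

/-- No integrable minorant is available for log-determinants, since the precoders vary with the
index. The truncations at `-L` converge by domination, the exponential moment makes the truncation
error uniform, and Fatou's lemma passes that moment to the limit function. -/
theorem tendsto_integral_nat_of_exp_moment {f : ℕ → Ω → ℝ} {g U : Ω → ℝ}
    (hf : ∀ n, AEStronglyMeasurable (f n) μ) (hU : Integrable U μ) (hfU : ∀ n, f n ≤ᵐ[μ] U)
    {C : ℝ≥0} (hC : ∀ n, ∫⁻ ω, ENNReal.ofReal (Real.exp (-f n ω / 4)) ∂μ ≤ C)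
    (hlim : ∀ᵐ ω ∂μ, Tendsto (fun n => f n ω) atTop (𝓝 (g ω))) :
    Tendsto (fun n => ∫ ω, f n ω ∂μ) atTop (𝓝 (∫ ω, g ω ∂μ)) := by
  have hg : AEStronglyMeasurable g μ := aestronglyMeasurable_of_tendsto_ae _ hf hlim
  have hgU : g ≤ᵐ[μ] U := by
    filter_upwards [hlim, ae_all_iff.2 hfU] with ω h1 h2
    exact le_of_tendsto' h1 h2
  have hgC : ∫⁻ ω, ENNReal.ofReal (Real.exp (-g ω / 4)) ∂μ ≤ C := by
    have e : ∀ᵐ ω ∂μ, ENNReal.ofReal (Real.exp (-g ω / 4)) =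
        liminf (fun n => ENNReal.ofReal (Real.exp (-f n ω / 4))) atTop := by
      filter_upwards [hlim] with ω hω
      refine (Tendsto.liminf_eq ?_).symm
      exact (ENNReal.continuous_ofReal.comp
        (Real.continuous_exp.comp (continuous_neg.div_const 4))).tendsto _ |>.comp hω
    rw [lintegral_congr_ae e]
    refine (lintegral_liminf_le' fun n => ?_).trans ?_
    · exact (((hf n).aemeasurable.neg.div_const 4).exp).ennreal_ofReal
    · exact (liminf_le_limsup).trans (limsup_le_of_le (by isBoundedDefault)
        (Eventually.of_forall hC))
  rw [Metric.tendsto_atTop]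
  intro ε hε
  obtain ⟨L, hL0, hL⟩ : ∃ L : ℝ, 0 ≤ L ∧ 4 * Real.exp (-L / 4) * C < ε / 3 := by
    have h1 : Tendsto (fun L : ℝ => 4 * Real.exp (-L / 4) * C) atTop (𝓝 (4 * 0 * C)) := by
      refine Tendsto.mul_const _ (Tendsto.const_mul _ (Real.tendsto_exp_atBot.comp ?_))
      exact (tendsto_neg_atTop_atBot).atBot_div_const (by norm_num)
    rw [mul_zero, zero_mul] at h1
    obtain ⟨L, h2, h3⟩ :=
      ((eventually_ge_atTop (0 : ℝ)).and (h1.eventually_lt_const (by positivity : 0 < ε / 3))).exists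
    exact ⟨L, h2, h3⟩
  have hT : Tendsto (fun n => ∫ ω, max (f n ω) (-L) ∂μ) atTop (𝓝 (∫ ω, max (g ω) (-L) ∂μ)) := by
    refine tendsto_integral_of_dominated_convergence (fun ω => |U ω| + L)
      (fun n => (hf n).sup aestronglyMeasurable_const) (hU.abs.add (integrable_const L))
      (fun n => ?_) ?_
    · filter_upwards [hfU n] with ω hω
      rw [Real.norm_eq_abs, abs_le]
      have h1 := le_max_right (f n ω) (-L)
      have h2 := abs_nonneg (U ω)
      have h3 := le_abs_self (U ω)
      constructor
      · linarith
      · exact max_le (by linarith) (by linarith)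
    · filter_upwards [hlim] with ω hω
      exact hω.max tendsto_const_nhds
  obtain ⟨n₀, hn₀⟩ := Metric.tendsto_atTop.1 hT (ε / 3) (by positivity)
  refine ⟨n₀, fun n hn => ?_⟩
  have h1 := integral_max_sub_le (hf n) hU (hfU n) (hC n) L
  have h2 := integral_max_sub_le hg hU hgU hgC L
  have h3 := hn₀ n hn
  rw [Real.dist_eq] at h3 ⊢
  rw [abs_le] at h1 h2
  rw [abs_lt] at h3 ⊢
  constructor <;> linarith [h1.1, h1.2, h2.1, h2.2, h3.1, h3.2]

theorem tendsto_integral_of_exp_moment {α : Type*} {l : Filter α} [l.IsCountablyGenerated]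
    {f : α → Ω → ℝ} {g U : Ω → ℝ}
    (hf : ∀ᶠ a in l, AEStronglyMeasurable (f a) μ) (hU : Integrable U μ)
    (hfU : ∀ᶠ a in l, f a ≤ᵐ[μ] U)
    {C : ℝ≥0} (hC : ∀ᶠ a in l, ∫⁻ ω, ENNReal.ofReal (Real.exp (-f a ω / 4)) ∂μ ≤ C)
    (hlim : ∀ᵐ ω ∂μ, Tendsto (fun a => f a ω) l (𝓝 (g ω))) :
    Tendsto (fun a => ∫ ω, f a ω ∂μ) l (𝓝 (∫ ω, g ω ∂μ)) := by
  refine tendsto_of_seq_tendsto fun x hx => ?_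
  obtain ⟨n₀, hn₀⟩ := eventually_atTop.1 (hx.eventually (hf.and (hfU.and hC)))
  rw [← tendsto_add_atTop_iff_nat n₀]
  refine tendsto_integral_nat_of_exp_moment (U := U) (C := C) (f := fun n => f (x (n + n₀)))
    (fun n => (hn₀ _ (by omega)).1) hU (fun n => (hn₀ _ (by omega)).2.1)
    (fun n => (hn₀ _ (by omega)).2.2) ?_
  filter_upwards [hlim] with ω hω
  exact (tendsto_add_atTop_iff_nat (f := fun n => f (x n) ω) n₀).2 (hω.comp hx)

end ExpMoment

/-! ### Ergodic rates over independent users -/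

section System

variable {ι : Type*} [Fintype ι] [DecidableEq ι] {d N : ℕ} {𝒳 : Type*} [MeasurableSpace 𝒳]

/-- A family of channels, indexed by the users, with finite power, and with a uniform bound on a
negative moment of the determinant after any semi-unitary precoder. -/
structure IsChannelFamily (ν : Measure 𝒳) (h : ι → 𝒳 → Matrix (Fin d) (Fin N) ℂ) : Prop where
  measurable : ∀ k, Measurable (h k)
  integrable : ∀ k, Integrable (fun x => frobSq (h k x)) ν
  negMoment : ∃ C : ℝ≥0, ∀ k, ∀ V : Matrix (Fin N) (Fin d) ℂ, Vᴴ * V = 1 →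
    ∫⁻ x, (‖(h k x * V).det‖ₑ ^ (1 / 2 : ℝ))⁻¹ ∂ν ≤ C

theorem Measurable.matrix_mul {Ω : Type*} [MeasurableSpace Ω] {m n p : ℕ}
    {A : Ω → Matrix (Fin m) (Fin n) ℂ} {B : Ω → Matrix (Fin n) (Fin p) ℂ} (hA : Measurable A)
    (hB : Measurable B) : Measurable fun ω => A ω * B ω := by
  refine measurable_pi_iff.2 fun i => measurable_pi_iff.2 fun j => ?_
  simp only [Matrix.mul_apply]
  refine Finset.measurable_sum _ fun k _ => Measurable.mul ?_ ?_
  · exact measurable_pi_iff.1 (measurable_pi_iff.1 hA i) k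
  · exact measurable_pi_iff.1 (measurable_pi_iff.1 hB k) j

theorem Measurable.matrix_transpose {Ω : Type*} [MeasurableSpace Ω] {m n : ℕ}
    {A : Ω → Matrix (Fin m) (Fin n) ℂ} (hA : Measurable A) : Measurable fun ω => (A ω)ᵀ :=
  (continuous_id.matrix_transpose (A := id)).measurable.comp hA

theorem Measurable.matrix_conjTranspose {Ω : Type*} [MeasurableSpace Ω] {m n : ℕ}
    {A : Ω → Matrix (Fin m) (Fin n) ℂ} (hA : Measurable A) : Measurable fun ω => (A ω)ᴴ :=
  (continuous_id.matrix_conjTranspose (A := id)).measurable.comp hA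

theorem Measurable.matrix_det {Ω : Type*} [MeasurableSpace Ω] {n : ℕ}
    {A : Ω → Matrix (Fin n) (Fin n) ℂ} (hA : Measurable A) : Measurable fun ω => (A ω).det :=
  (continuous_id.matrix_det (A := id)).measurable.comp hA

theorem measurable_covDet {Ω : Type*} [MeasurableSpace Ω] {H : Ω → Matrix (Fin d) (Fin N) ℂ}
    {V : Ω → ι → Matrix (Fin N) (Fin d) ℂ} (hH : Measurable H) (hV : Measurable V) (P : ℝ)
    (s : Finset ι) : Measurable fun ω => covDet P (H ω) (V ω) s := by
  have hVl : ∀ l, Measurable fun ω => V ω l := fun l => (measurable_pi_apply l).comp hV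
  have h2 : ∀ l, Measurable fun ω => ((P / N : ℝ) : ℂ) • (H ω * V ω l * (V ω l)ᴴ * (H ω)ᴴ) :=
    fun l => ((continuous_const_smul ((P / N : ℝ) : ℂ)).measurable).comp
      (((hH.matrix_mul (hVl l)).matrix_mul (hVl l).matrix_conjTranspose).matrix_mul
        hH.matrix_conjTranspose)
  have h1 : Measurable fun ω => 1 + bdCovariance P (H ω) (V ω) s :=
    (continuous_const_add (1 : Matrix (Fin d) (Fin d) ℂ)).measurable.comp
      (Finset.measurable_sum s fun l _ => h2 l)
  exact Complex.measurable_re.comp h1.matrix_det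

variable {Ω : Type*} [MeasurableSpace Ω] {μ : Measure Ω} [IsProbabilityMeasure μ]

theorem integrable_log_covDet {H : Ω → Matrix (Fin d) (Fin N) ℂ}
    {V : Ω → ι → Matrix (Fin N) (Fin d) ℂ} (hH : Measurable H)
    (hHi : Integrable (fun ω => frobSq (H ω)) μ) (hV : Measurable V)
    (hVu : ∀ ω k, (V ω k)ᴴ * V ω k = 1) {P : ℝ} (hP : 0 ≤ P) (s : Finset ι) :
    Integrable (fun ω => Real.log (covDet P (H ω) (V ω) s)) μ := by
  refine (hHi.const_mul (d * (P / N * (s.card * d)))).mono'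
    (measurable_covDet hH hV P s).log.aestronglyMeasurable (ae_of_all _ fun ω => ?_)
  rw [Real.norm_eq_abs, abs_of_nonneg (log_covDet_nonneg hP _ _ _)]
  refine (log_covDet_le hP (H ω) (V ω) s).trans ?_
  have hPN : 0 ≤ P / N := div_nonneg hP (Nat.cast_nonneg N)
  have : ∑ l ∈ s, frobSq (H ω * V ω l) ≤ s.card * d * frobSq (H ω) := by
    calc _ ≤ ∑ _l ∈ s, frobSq (H ω) * d := by
          refine Finset.sum_le_sum fun l _ => (frobSq_mul_le _ _).trans ?_
          rw [frobSq_of_semiUnitary (hVu ω l), Fintype.card_fin]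
      _ = _ := by rw [Finset.sum_const, nsmul_eq_mul]; ring
  calc _ ≤ d * (P / N * (s.card * d * frobSq (H ω))) := by gcongr
    _ = _ := by ring

/-- The ergodic sum rate splits into the ergodic log-determinants. -/
theorem integral_sum_bdRate {H : Ω → ι → Matrix (Fin d) (Fin N) ℂ}
    {V : Ω → ι → Matrix (Fin N) (Fin d) ℂ} (hH : ∀ k, Measurable fun ω => H ω k)
    (hHi : ∀ k, Integrable (fun ω => frobSq (H ω k)) μ) (hV : Measurable V)
    (hVu : ∀ ω k, (V ω k)ᴴ * V ω k = 1) {P : ℝ} (hP : 0 ≤ P) :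
    ∫ ω, ∑ k, bdRate P (H ω k) (V ω) k ∂μ =
      (∑ k, ∫ ω, Real.log (covDet P (H ω k) (V ω) Finset.univ) ∂μ -
        ∑ k, ∫ ω, Real.log (covDet P (H ω k) (V ω) (Finset.univ.erase k)) ∂μ) / Real.log 2 := by
  have hi := fun k s => integrable_log_covDet (hH k) (hHi k) hV hVu hP s
  simp_rw [bdRate_mul_log hP]
  rw [integral_finsetSum, ← Finset.sum_sub_distrib, Finset.sum_div]
  · refine Finset.sum_congr rfl fun k _ => ?_
    rw [integral_div, integral_sub (hi k _) (hi k _)]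
  · exact fun k _ => ((hi k _).sub (hi k _)).div_const _

theorem integral_log_covDet_univ_le (hN : Fintype.card ι * d = N) (hN0 : 0 < N)
    {H : Ω → Matrix (Fin d) (Fin N) ℂ} {V : Ω → ι → Matrix (Fin N) (Fin d) ℂ}
    (hH : Measurable H) (hHi : Integrable (fun ω => frobSq (H ω)) μ) (hV : Measurable V)
    (hVu : ∀ ω k, (V ω k)ᴴ * V ω k = 1) {P : ℝ} (hP : 1 ≤ P) :
    ∫ ω, Real.log (covDet P (H ω) (V ω) Finset.univ) ∂μ ≤
      d * Real.log P + d * ∫ ω, frobSq (H ω) ∂μ := by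
  calc _ ≤ ∫ ω, (d * Real.log P + d * frobSq (H ω)) ∂μ :=
        integral_mono (integrable_log_covDet hH hHi hV hVu (zero_le_one.trans hP) _)
          ((integrable_const _).add (hHi.const_mul _))
          fun ω => log_covDet_univ_le hN hN0 hP (H ω) (hVu ω)
    _ = _ := by
        rw [integral_add (integrable_const _) (hHi.const_mul _),
          integral_const_mul _ fun ω => frobSq (H ω)]
        simp

/-- Upper bound on the ergodic sum rate with one interference term. -/
theorem integral_sum_bdRate_le (hN : Fintype.card ι * d = N) (hN0 : 0 < N)
    {H : Ω → ι → Matrix (Fin d) (Fin N) ℂ}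
    {V : Ω → ι → Matrix (Fin N) (Fin d) ℂ} (hH : ∀ k, Measurable fun ω => H ω k)
    (hHi : ∀ k, Integrable (fun ω => frobSq (H ω k)) μ) (hV : Measurable V)
    (hVu : ∀ ω k, (V ω k)ᴴ * V ω k = 1) {P : ℝ} (hP : 1 ≤ P) (k : ι) :
    ∫ ω, ∑ k, bdRate P (H ω k) (V ω) k ∂μ ≤ N * Real.logb 2 P +
      (d * ∑ k, ∫ ω, frobSq (H ω k) ∂μ) / Real.log 2 -
      (∫ ω, Real.log (covDet P (H ω k) (V ω) (Finset.univ.erase k)) ∂μ) / Real.log 2 := by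
  have hP0 : 0 ≤ P := zero_le_one.trans hP
  have hl : 0 < Real.log 2 := Real.log_pos one_lt_two
  have hN' : (N : ℝ) = Fintype.card ι * d := by exact_mod_cast hN.symm
  rw [integral_sum_bdRate hH hHi hV hVu hP0]
  have h1 : ∑ k, ∫ ω, Real.log (covDet P (H ω k) (V ω) Finset.univ) ∂μ ≤
      N * Real.log P + d * ∑ k, ∫ ω, frobSq (H ω k) ∂μ := by
    calc _ ≤ ∑ k, (d * Real.log P + d * ∫ ω, frobSq (H ω k) ∂μ) :=
          Finset.sum_le_sum fun k _ =>
            integral_log_covDet_univ_le hN hN0 (hH k) (hHi k) hV hVu hP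
      _ = _ := by
          rw [Finset.sum_add_distrib, Finset.sum_const, Finset.card_univ, nsmul_eq_mul, hN',
            Finset.mul_sum]
          ring
  have h2 : ∫ ω, Real.log (covDet P (H ω k) (V ω) (Finset.univ.erase k)) ∂μ ≤
      ∑ k, ∫ ω, Real.log (covDet P (H ω k) (V ω) (Finset.univ.erase k)) ∂μ :=
    Finset.single_le_sum
      (f := fun k => ∫ ω, Real.log (covDet P (H ω k) (V ω) (Finset.univ.erase k)) ∂μ)
      (fun k _ => integral_nonneg fun ω => log_covDet_nonneg hP0 _ _ _) (Finset.mem_univ k)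
  rw [Real.logb, ← mul_div_assoc, ← add_div, ← sub_div]
  gcongr

end System

/-! ### Zero-forcing from noisy training observations -/

section Training

variable {ι : Type*} {d N : ℕ} {𝒳 : Type*}

/-- The joint law of the channel states and of the training noise of independent users. -/
def trainLaw (ι : Type*) [Fintype ι] [MeasurableSpace 𝒳] (ν : Measure 𝒳) (N d : ℕ) (s : ℝ≥0) :
    Measure (ι → 𝒳 × Matrix (Fin N) (Fin d) ℂ) :=
  Measure.pi fun _ => ν.prod (gaussianMatrix N d s)

/-- The (transposed) training observations. -/
def trainObs (h : ι → 𝒳 → Matrix (Fin d) (Fin N) ℂ) (T : ι → Matrix (Fin d) (Fin d) ℂ)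
    (ω : ι → 𝒳 × Matrix (Fin N) (Fin d) ℂ) (k : ι) : Matrix (Fin d) (Fin N) ℂ :=
  (T k)ᵀ * h k (ω k).1 + (ω k).2ᵀ

/-- The precoders for channel estimates which are linear in the training observations. -/
def trainPrecoder (W : (ι → Matrix (Fin d) (Fin N) ℂ) → ι → Matrix (Fin N) (Fin d) ℂ)
    (h : ι → 𝒳 → Matrix (Fin d) (Fin N) ℂ) (J T : ι → Matrix (Fin d) (Fin d) ℂ)
    (ω : ι → 𝒳 × Matrix (Fin N) (Fin d) ℂ) : ι → Matrix (Fin N) (Fin d) ℂ :=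
  W fun l => J l * trainObs h T ω l

/-- The ergodic sum rate with channel estimates which are linear in the training observations. -/
def trainSumRate [Fintype ι] [DecidableEq ι] [MeasurableSpace 𝒳]
    (W : (ι → Matrix (Fin d) (Fin N) ℂ) → ι → Matrix (Fin N) (Fin d) ℂ) (ν : Measure 𝒳)
    (h : ι → 𝒳 → Matrix (Fin d) (Fin N) ℂ) (J T : ι → Matrix (Fin d) (Fin d) ℂ) (s : ℝ≥0)
    (P : ℝ) : ℝ :=
  ∫ ω, ∑ k, bdRate P (h k (ω k).1) (trainPrecoder W h J T ω) k ∂(trainLaw ι ν N d s)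

variable {W : (ι → Matrix (Fin d) (Fin N) ℂ) → ι → Matrix (Fin N) (Fin d) ℂ}
  {h : ι → 𝒳 → Matrix (Fin d) (Fin N) ℂ} {J T : ι → Matrix (Fin d) (Fin d) ℂ}

section Deterministic

theorem mul_trainPrecoder_eq_zero [Fintype ι] (hW : IsBDPrecoder W) (hJ : ∀ k, (J k).det ≠ 0)
    (ω : ι → 𝒳 × Matrix (Fin N) (Fin d) ℂ) {k l : ι} (hl : l ≠ k) :
    trainObs h T ω l * trainPrecoder W h J T ω k = 0 := by
  have h1 := hW.zeroForcing (fun l => J l * trainObs h T ω l) k l hl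
  have h2 := congrArg ((J l)⁻¹ * ·) h1
  unfold trainPrecoder
  simpa [← Matrix.mul_assoc, nonsing_inv_mul _ (isUnit_iff_ne_zero.2 (hJ l))] using h2

theorem channel_add_noise_mul_trainPrecoder [Fintype ι] (hW : IsBDPrecoder W)
    (hJ : ∀ k, (J k).det ≠ 0) (hT : ∀ k, (T k).det ≠ 0)
    (ω : ι → 𝒳 × Matrix (Fin N) (Fin d) ℂ) {k l : ι} (hl : l ≠ k) :
    (h l (ω l).1 + (T l)ᵀ⁻¹ * (ω l).2ᵀ) * trainPrecoder W h J T ω k = 0 := by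
  have hTl : IsUnit (T l)ᵀ.det := by rw [det_transpose]; exact isUnit_iff_ne_zero.2 (hT l)
  have h1 : h l (ω l).1 + (T l)ᵀ⁻¹ * (ω l).2ᵀ = (T l)ᵀ⁻¹ * trainObs h T ω l := by
    rw [trainObs, Matrix.mul_add, ← Matrix.mul_assoc, nonsing_inv_mul _ hTl, Matrix.one_mul]
  rw [h1, Matrix.mul_assoc, mul_trainPrecoder_eq_zero hW hJ ω hl, Matrix.mul_zero]

theorem bdCovariance_congr {P : ℝ} {H H' : Matrix (Fin d) (Fin N) ℂ}
    {V : ι → Matrix (Fin N) (Fin d) ℂ} {s : Finset ι}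
    (hs : ∀ l ∈ s, H * V l * (H * V l)ᴴ = H' * V l * (H' * V l)ᴴ) :
    bdCovariance P H V s = bdCovariance P H' V s := by
  refine Finset.sum_congr rfl fun l hl => ?_
  have := hs l hl
  simp only [conjTranspose_mul, ← Matrix.mul_assoc] at this
  rw [this]

/-- Interference over the channel is caused by the training noise only. -/
theorem covDet_trainPrecoder [Fintype ι] [DecidableEq ι] (hW : IsBDPrecoder W)
    (hJ : ∀ k, (J k).det ≠ 0)
    (hT : ∀ k, (T k).det ≠ 0) (P : ℝ) (ω : ι → 𝒳 × Matrix (Fin N) (Fin d) ℂ) (k : ι) :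
    covDet P (h k (ω k).1) (trainPrecoder W h J T ω) (Finset.univ.erase k) =
      covDet P ((T k)ᵀ⁻¹ * (ω k).2ᵀ) (trainPrecoder W h J T ω) (Finset.univ.erase k) := by
  unfold covDet
  rw [bdCovariance_congr fun l hl => ?_]
  have h1 := channel_add_noise_mul_trainPrecoder (h := h) hW hJ hT ω
    (Finset.ne_of_mem_erase hl).symm
  rw [Matrix.add_mul, add_eq_zero_iff_eq_neg] at h1
  rw [h1, conjTranspose_neg, Matrix.neg_mul, Matrix.mul_neg, neg_neg]

theorem bdCovariance_smul (P c : ℝ) (H : Matrix (Fin d) (Fin N) ℂ)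
    (V : ι → Matrix (Fin N) (Fin d) ℂ) (s : Finset ι) :
    bdCovariance P ((c : ℂ) • H) V s = bdCovariance (P * c ^ 2) H V s := by
  refine Finset.sum_congr rfl fun l _ => ?_
  simp only [Matrix.smul_mul, conjTranspose_smul, Matrix.mul_smul, smul_smul]
  congr 1
  rw [Complex.star_def, Complex.conj_ofReal]
  push_cast
  ring

/-- Extracting the growth `Pᵈ` leaves a determinant that has a limit as `P → ∞`. -/
theorem covDet_eq_pow_mul {P : ℝ} (hP : 0 < P) (H : Matrix (Fin d) (Fin N) ℂ)
    (V : ι → Matrix (Fin N) (Fin d) ℂ) (s : Finset ι) :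
    covDet P H V s = P ^ d * (((P⁻¹ : ℝ) : ℂ) • 1 + bdCovariance 1 H V s).det.re := by
  have h1 : 1 + bdCovariance P H V s =
      (P : ℂ) • (((P⁻¹ : ℝ) : ℂ) • 1 + bdCovariance 1 H V s) := by
    rw [smul_add, smul_smul, ← Complex.ofReal_mul, mul_inv_cancel₀ hP.ne', Complex.ofReal_one,
      one_smul, bdCovariance, bdCovariance, Finset.smul_sum]
    congr 1
    refine Finset.sum_congr rfl fun l _ => ?_
    rw [smul_smul, ← Complex.ofReal_mul, mul_one_div]
  rw [covDet, h1, det_smul, Fintype.card_fin, ← Complex.ofReal_pow, Complex.re_ofReal_mul]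

/-- Convergence is required of `V Vᴴ` only; the precoders themselves need not converge. -/
theorem tendsto_bdCovariance {α : Type*} {l : Filter α} {p : α → ℝ} {a : ℝ}
    {H : α → Matrix (Fin d) (Fin N) ℂ} {H₀ : Matrix (Fin d) (Fin N) ℂ}
    {V : α → ι → Matrix (Fin N) (Fin d) ℂ} {V₀ : ι → Matrix (Fin N) (Fin d) ℂ}
    (hp : Tendsto p l (𝓝 a)) (hH : Tendsto H l (𝓝 H₀))
    (hV : ∀ k, Tendsto (fun x => V x k * (V x k)ᴴ) l (𝓝 (V₀ k * (V₀ k)ᴴ))) (s : Finset ι) :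
    Tendsto (fun x => bdCovariance (p x) (H x) (V x) s) l (𝓝 (bdCovariance a H₀ V₀ s)) := by
  refine tendsto_finsetSum s fun k _ => ?_
  have hct : Tendsto (fun x => (H x)ᴴ) l (𝓝 H₀ᴴ) :=
    ((continuous_id.matrix_conjTranspose (A := id)).tendsto H₀).comp hH
  have h1 := tendsto_matrix_mul (tendsto_matrix_mul hH (hV k)) hct
  have h2 : Tendsto (fun x => ((p x / N : ℝ) : ℂ)) l (𝓝 ((a / N : ℝ) : ℂ)) :=
    (Complex.continuous_ofReal.tendsto _).comp (hp.div_const _)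
  simp only [Matrix.mul_assoc] at h1 ⊢
  exact h2.smul h1

theorem frobSq_transpose {m n : Type*} [Fintype m] [Fintype n] (A : Matrix m n ℂ) :
    frobSq Aᵀ = frobSq A := Finset.sum_comm

theorem log_covDet_noise_le {P : ℝ} (hP : 0 ≤ P) (M : Matrix (Fin d) (Fin d) ℂ)
    (Z : Matrix (Fin N) (Fin d) ℂ) {V : ι → Matrix (Fin N) (Fin d) ℂ}
    (hV : ∀ k, (V k)ᴴ * V k = 1) (s : Finset ι) :
    Real.log (covDet P (M * Zᵀ) V s) ≤ P * frobSq M * (d * (s.card * d) / N) * frobSq Z := by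
  refine (log_covDet_le hP _ V s).trans ?_
  have hPN : 0 ≤ P / N := div_nonneg hP (Nat.cast_nonneg N)
  have : ∑ l ∈ s, frobSq (M * Zᵀ * V l) ≤ s.card * d * (frobSq M * frobSq Z) := by
    calc _ ≤ ∑ _l ∈ s, frobSq M * frobSq Z * d := by
          refine Finset.sum_le_sum fun l _ => (frobSq_mul_le _ _).trans ?_
          rw [frobSq_of_semiUnitary (hV l), Fintype.card_fin, ← frobSq_transpose Z]
          gcongr
          exact frobSq_mul_le _ _
      _ = _ := by rw [Finset.sum_const, nsmul_eq_mul]; ring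
  calc _ ≤ d * (P / N * (s.card * d * (frobSq M * frobSq Z))) := by gcongr
    _ = _ := by ring

end Deterministic

variable [Fintype ι] [DecidableEq ι] [MeasurableSpace 𝒳] {ν : Measure 𝒳} [IsProbabilityMeasure ν]
  {s : ℝ≥0}

instance : IsProbabilityMeasure (trainLaw ι ν N d s) := by
  unfold trainLaw
  infer_instance

theorem measurable_trainObs (hh : ∀ k, Measurable (h k)) (T : ι → Matrix (Fin d) (Fin d) ℂ)
    (k : ι) : Measurable fun ω => trainObs h T ω k := by
  have h1 : Measurable fun ω : ι → 𝒳 × Matrix (Fin N) (Fin d) ℂ => (T k)ᵀ * h k (ω k).1 :=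
    measurable_const.matrix_mul ((hh k).comp (measurable_fst.comp (measurable_pi_apply k)))
  have h2 : Measurable fun ω : ι → 𝒳 × Matrix (Fin N) (Fin d) ℂ => (ω k).2ᵀ :=
    (measurable_snd.comp (measurable_pi_apply k)).matrix_transpose
  exact h1.add h2

theorem measurable_trainPrecoder (hW : IsBDPrecoder W) (hh : ∀ k, Measurable (h k))
    (J T : ι → Matrix (Fin d) (Fin d) ℂ) : Measurable (trainPrecoder W h J T) :=
  hW.measurable.comp (measurable_pi_iff.2 fun k =>
    measurable_const.matrix_mul (measurable_trainObs hh T k))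

theorem measurePreserving_trainLaw_eval (k : ι) :
    MeasurePreserving (fun ω : ι → 𝒳 × Matrix (Fin N) (Fin d) ℂ => ω k) (trainLaw ι ν N d s)
      (ν.prod (gaussianMatrix N d s)) :=
  measurePreserving_eval _ k

theorem measurePreserving_trainLaw_channel (k : ι) :
    MeasurePreserving (fun ω : ι → 𝒳 × Matrix (Fin N) (Fin d) ℂ => (ω k).1) (trainLaw ι ν N d s)
      ν :=
  measurePreserving_fst.comp (measurePreserving_trainLaw_eval k)

theorem measurePreserving_trainLaw_noise (k : ι) :
    MeasurePreserving (fun ω : ι → 𝒳 × Matrix (Fin N) (Fin d) ℂ => (ω k).2) (trainLaw ι ν N d s)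
      (gaussianMatrix N d s) :=
  measurePreserving_snd.comp (measurePreserving_trainLaw_eval k)

theorem integrable_frobSq_gaussianMatrix (m n : ℕ) (v : ℝ≥0) :
    Integrable (fun X => frobSq X) (gaussianMatrix m n v) :=
  integrable_finsetSum _ fun i _ => integrable_finsetSum _ fun j _ =>
    integrable_entry_sq_gaussianMatrix m n v i j

theorem integrable_noise (k : ι) :
    Integrable (fun ω : ι → 𝒳 × Matrix (Fin N) (Fin d) ℂ => frobSq (ω k).2)
      (trainLaw ι ν N d s) :=
  (measurePreserving_trainLaw_noise k).integrable_comp_of_integrable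
    (integrable_frobSq_gaussianMatrix N d s)

theorem integrable_channel (hh : IsChannelFamily ν h) (k : ι) :
    Integrable (fun ω : ι → 𝒳 × Matrix (Fin N) (Fin d) ℂ => frobSq (h k (ω k).1))
      (trainLaw ι ν N d s) :=
  (measurePreserving_trainLaw_channel k).integrable_comp_of_integrable (hh.integrable k)

theorem measurable_channel (hh : IsChannelFamily ν h) (k : ι) :
    Measurable fun ω : ι → 𝒳 × Matrix (Fin N) (Fin d) ℂ => h k (ω k).1 :=
  (hh.measurable k).comp (measurable_fst.comp (measurable_pi_apply k))

theorem IsChannelFamily.ae_det_ne_zero (hh : IsChannelFamily ν h) (k : ι)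
    {V : Matrix (Fin N) (Fin d) ℂ} (hV : Vᴴ * V = 1) : ∀ᵐ x ∂ν, (h k x * V).det ≠ 0 := by
  obtain ⟨C, hC⟩ := hh.negMoment
  exact ae_ne_zero_of_lintegral_inv_lt_top
    ((hh.measurable k).matrix_mul measurable_const).matrix_det (by norm_num)
    ((hC k V hV).trans_lt ENNReal.coe_lt_top).ne

theorem ae_stack_channel_det_ne_zero (e : ι × Fin d ≃ Fin N) (hW : IsBDPrecoder W)
    (hh : IsChannelFamily ν h) :
    ∀ᵐ ω ∂(trainLaw ι ν N d s), (stack e fun k => h k (ω k).1).det ≠ 0 := by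
  refine ae_stack_det_ne_zero (ν := ν.prod (gaussianMatrix N d s)) e hW
    (y := fun k p => h k p.1) (fun k => (hh.measurable k).comp measurable_fst) fun k V hV => ?_
  exact measurePreserving_fst.quasiMeasurePreserving.ae (hh.ae_det_ne_zero k hV)

theorem ae_stack_trainObs_det_ne_zero (hs : s ≠ 0) (e : ι × Fin d ≃ Fin N) (hW : IsBDPrecoder W)
    (hh : IsChannelFamily ν h) (T : ι → Matrix (Fin d) (Fin d) ℂ) :
    ∀ᵐ ω ∂(trainLaw ι ν N d s), (stack e (trainObs h T ω)).det ≠ 0 := by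
  have hm : ∀ k, Measurable fun p : 𝒳 × Matrix (Fin N) (Fin d) ℂ => (T k)ᵀ * h k p.1 + p.2ᵀ := by
    intro k
    have h1 : Measurable fun p : 𝒳 × Matrix (Fin N) (Fin d) ℂ => (T k)ᵀ * h k p.1 :=
      measurable_const.matrix_mul ((hh.measurable k).comp measurable_fst)
    exact h1.add measurable_snd.matrix_transpose
  refine ae_stack_det_ne_zero (ν := ν.prod (gaussianMatrix N d s)) e hW
    (y := fun k p => (T k)ᵀ * h k p.1 + p.2ᵀ) hm fun k V hV => ?_
  refine (Measure.ae_prod_iff_ae_ae (((hm k).matrix_mul measurable_const).matrix_det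
    (measurableSet_singleton 0)).compl).2 (ae_of_all _ fun x => ?_)
  filter_upwards [ae_det_transpose_gaussianMatrix_ne_zero hs hV ((T k)ᵀ * h k x * V)] with Z hZ
  simpa only [Set.mem_compl_iff, Set.mem_preimage, Set.mem_singleton_iff, Matrix.add_mul] using hZ

/-- The square of the modulus is `det (H V Vᴴ Hᴴ)`, which sees only the projector. -/
theorem norm_det_mul_eq {H : Matrix (Fin d) (Fin N) ℂ} {V V' : Matrix (Fin N) (Fin d) ℂ}
    (hV : V * Vᴴ = V' * V'ᴴ) : ‖(H * V).det‖ = ‖(H * V').det‖ := by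
  have h1 : ∀ U : Matrix (Fin N) (Fin d) ℂ, ((‖(H * U).det‖ ^ 2 : ℝ) : ℂ) =
      (H * (U * Uᴴ) * Hᴴ).det := by
    intro U
    have : H * (U * Uᴴ) * Hᴴ = (H * U) * (H * U)ᴴ := by
      rw [conjTranspose_mul]
      simp only [Matrix.mul_assoc]
    rw [this, det_mul, det_conjTranspose, Complex.star_def, Complex.mul_conj']
    norm_cast
  have h2 := (h1 V).trans ((congrArg (fun Q => (H * Q * Hᴴ).det) hV).trans (h1 V').symm)
  exact (pow_left_inj₀ (norm_nonneg _) (norm_nonneg _) two_ne_zero).1 (Complex.ofReal_injective h2)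

/-- The desired signal of a zero-forced user has bounded negative moments. -/
theorem lintegral_inv_det_trainPrecoder_le (hs : s ≠ 0) (e : ι × Fin d ≃ Fin N)
    (hW : IsBDPrecoder W) (hh : IsChannelFamily ν h) {C : ℝ≥0}
    (hC : ∀ k, ∀ V : Matrix (Fin N) (Fin d) ℂ, Vᴴ * V = 1 →
      ∫⁻ x, (‖(h k x * V).det‖ₑ ^ (1 / 2 : ℝ))⁻¹ ∂ν ≤ C)
    (hJ : ∀ k, (J k).det ≠ 0) (k : ι) :
    ∫⁻ ω, (‖(h k (ω k).1 * trainPrecoder W h J T ω k).det‖ₑ ^ (1 / 2 : ℝ))⁻¹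
      ∂(trainLaw ι ν N d s) ≤ C := by
  -- The precoder of user `k` computed with that user's own estimate replaced by `0`. It almost
  -- surely spans the same null space but is independent of coordinate `k`, so the channel can be
  -- integrated out with the precoder fixed.
  let V' : (ι → 𝒳 × Matrix (Fin N) (Fin d) ℂ) → Matrix (Fin N) (Fin d) ℂ :=
    fun ω => W (Function.update (fun l => J l * trainObs h T ω l) k 0) k
  have hV'm : Measurable V' := by
    have h1 : Measurable fun ω : ι → 𝒳 × Matrix (Fin N) (Fin d) ℂ =>
        Function.update (fun l => J l * trainObs h T ω l) k 0 := by
      refine measurable_pi_iff.2 fun l => ?_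
      by_cases hl : l = k
      · subst hl
        simp only [Function.update_self]
        exact measurable_const
      · simp only [Function.update_of_ne hl]
        exact measurable_const.matrix_mul (measurable_trainObs hh.measurable T l)
    exact (measurable_pi_apply k).comp (hW.measurable.comp h1)
  have hae : ∀ᵐ ω ∂(trainLaw ι ν N d s),
      (‖(h k (ω k).1 * trainPrecoder W h J T ω k).det‖ₑ ^ (1 / 2 : ℝ))⁻¹ =
        (‖(h k (ω k).1 * V' ω).det‖ₑ ^ (1 / 2 : ℝ))⁻¹ := by
    filter_upwards [ae_stack_trainObs_det_ne_zero hs e hW hh T] with ω hω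
    have h1 : trainPrecoder W h J T ω k * (trainPrecoder W h J T ω k)ᴴ =
        nullProj e (trainObs h T ω) k :=
      mul_conjTranspose_eq_nullProj e hω (hW.semiUnitary _ k)
        fun l hl => mul_trainPrecoder_eq_zero hW hJ ω hl
    have h2 : V' ω * (V' ω)ᴴ = nullProj e (trainObs h T ω) k := by
      refine mul_conjTranspose_eq_nullProj e hω (hW.semiUnitary _ k) fun l hl => ?_
      have h3 := hW.zeroForcing (Function.update (fun l => J l * trainObs h T ω l) k 0) k l hl
      rw [Function.update_of_ne hl] at h3
      have h4 := congrArg ((J l)⁻¹ * ·) h3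
      simpa [← Matrix.mul_assoc, nonsing_inv_mul _ (isUnit_iff_ne_zero.2 (hJ l))] using h4
    rw [← ofReal_norm, ← ofReal_norm, norm_det_mul_eq (h1.trans h2.symm)]
  rw [lintegral_congr_ae hae]
  have hm : Measurable fun ω => (‖(h k (ω k).1 * V' ω).det‖ₑ ^ (1 / 2 : ℝ))⁻¹ :=
    ((((measurable_channel hh k).matrix_mul hV'm).matrix_det).enorm.pow_const _).inv
  refine (lintegral_pi_update (fun _ => ν.prod (gaussianMatrix N d s)) k hm).trans_le ?_
  calc _ ≤ ∫⁻ _ω : ι → 𝒳 × Matrix (Fin N) (Fin d) ℂ, (C : ℝ≥0∞) ∂(trainLaw ι ν N d s) := by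
        refine lintegral_mono fun ω => ?_
        have h1 : ∀ p, V' (Function.update ω k p) = V' ω := by
          intro p
          have h2 : Function.update (fun l => J l * trainObs h T (Function.update ω k p) l) k 0 =
              Function.update (fun l => J l * trainObs h T ω l) k 0 := by
            funext l
            by_cases hl : l = k
            · rw [hl, Function.update_self, Function.update_self]
            · rw [Function.update_of_ne hl, Function.update_of_ne hl, trainObs, trainObs,
                Function.update_of_ne hl]
          exact congrArg (fun G => W G k) h2
        simp only [h1, Function.update_self]
        have hm2 : Measurable fun x => (‖(h k x * V' ω).det‖ₑ ^ (1 / 2 : ℝ))⁻¹ :=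
          ((((hh.measurable k).matrix_mul measurable_const).matrix_det).enorm.pow_const _).inv
        exact (measurePreserving_fst.lintegral_comp (μ := ν.prod (gaussianMatrix N d s)) hm2).trans_le
          (hC k _ (hW.semiUnitary _ k))
    _ = C := by simp

/-- The log-determinant minus `d log P` is at least `2 log |det (h W)| - d log N`, so the factor `1
/ 4` in the exponent matches the moment of order `-1 / 2` in `IsChannelFamily`. The constant is
uniform in the power, the estimator and the training, which the limit theorems need. -/
theorem exists_exp_moment_le (hs : s ≠ 0) (e : ι × Fin d ≃ Fin N) (hN0 : 0 < N)
    (hW : IsBDPrecoder W) (hh : IsChannelFamily ν h) :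
    ∃ C : ℝ≥0, ∀ (J T : ι → Matrix (Fin d) (Fin d) ℂ), (∀ k, (J k).det ≠ 0) →
      ∀ (P : ℝ), 0 < P → ∀ k,
      ∫⁻ ω, ENNReal.ofReal (Real.exp (-(Real.log (covDet P (h k (ω k).1)
        (trainPrecoder W h J T ω) Finset.univ) - d * Real.log P) / 4)) ∂(trainLaw ι ν N d s)
        ≤ C := by
  obtain ⟨C, hC⟩ := hh.negMoment
  refine ⟨(Real.exp (d * Real.log N / 4)).toNNReal * C, fun J T hJ P hP k => ?_⟩
  have hb := lintegral_inv_det_trainPrecoder_le (T := T) hs e hW hh hC hJ k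
  have hmdet : Measurable fun ω => (h k (ω k).1 * trainPrecoder W h J T ω k).det :=
    ((measurable_channel hh k).matrix_mul ((measurable_pi_apply k).comp
      (measurable_trainPrecoder hW hh.measurable J T))).matrix_det
  have hae := ae_ne_zero_of_lintegral_inv_lt_top hmdet (by norm_num)
    (hb.trans_lt ENNReal.coe_lt_top).ne
  calc _ ≤ ∫⁻ ω, ENNReal.ofReal (Real.exp (d * Real.log N / 4)) *
        (‖(h k (ω k).1 * trainPrecoder W h J T ω k).det‖ₑ ^ (1 / 2 : ℝ))⁻¹
        ∂(trainLaw ι ν N d s) := by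
        refine lintegral_mono_ae ?_
        filter_upwards [hae] with ω hω
        have h1 := le_log_covDet_univ hN0 hP (h k (ω k).1) (trainPrecoder W h J T ω) k hω
        have h0 : 0 < ‖(h k (ω k).1 * trainPrecoder W h J T ω k).det‖ := norm_pos_iff.2 hω
        rw [← ENNReal.rpow_neg, ← ofReal_norm, ENNReal.ofReal_rpow_of_pos h0,
          ← ENNReal.ofReal_mul (by positivity)]
        refine ENNReal.ofReal_le_ofReal ?_
        rw [Real.rpow_def_of_pos h0, ← Real.exp_add, Real.exp_le_exp]
        rw [Real.log_div hP.ne' (by positivity)] at h1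
        linarith
    _ = ENNReal.ofReal (Real.exp (d * Real.log N / 4)) * ∫⁻ ω,
        (‖(h k (ω k).1 * trainPrecoder W h J T ω k).det‖ₑ ^ (1 / 2 : ℝ))⁻¹
        ∂(trainLaw ι ν N d s) := lintegral_const_mul _ (hmdet.enorm.pow_const _).inv
    _ ≤ _ := by
        rw [ENNReal.coe_mul]
        gcongr
        rfl

end Training

/-! ### Rates under accurate training -/

section MultiplexingGain

theorem hasMultiplexingGain_of_le {f : ℝ → ℝ} {m C D : ℝ}
    (hle : ∀ᶠ P in atTop, f P ≤ m * Real.logb 2 P + C)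
    (hge : ∀ᶠ P in atTop, m * Real.logb 2 P - D ≤ f P) : HasMultiplexingGain f m := by
  refine Asymptotics.IsBigO.of_bound (max C D) ?_
  filter_upwards [hle, hge] with P h1 h2
  rw [Real.norm_eq_abs, norm_one, mul_one, abs_le]
  constructor
  · linarith [le_max_right C D]
  · linarith [le_max_left C D]

theorem HasMultiplexingGain.exists_le {f : ℝ → ℝ} {m : ℝ} (h : HasMultiplexingGain f m) :
    ∃ C, 0 < C ∧ ∀ᶠ P in atTop, m * Real.logb 2 P - C ≤ f P := by
  obtain ⟨C, hC0, hC⟩ := h.exists_pos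
  refine ⟨C, hC0, ?_⟩
  filter_upwards [hC.bound] with P hP
  rw [Real.norm_eq_abs, norm_one, mul_one, abs_le] at hP
  linarith [hP.1]

theorem HasMultiplexingGainWithOffset.hasMultiplexingGain {f : ℝ → ℝ} {m : ℝ}
    (h : HasMultiplexingGainWithOffset f m) : HasMultiplexingGain f m := by
  obtain ⟨r, hr⟩ := h
  exact hr.isBigO_one ℝ

end MultiplexingGain

/-! ### Training matrices with power in every direction -/

section TrainingMatrix

theorem det_ne_zero_of_posSemidef_sub {d : ℕ} {T : Matrix (Fin d) (Fin d) ℂ} {c : ℝ} (hc : 0 < c)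
    (hT : (T * Tᴴ - (c : ℂ) • 1).PosSemidef) : T.det ≠ 0 := by
  intro h0
  have h1 : ((c : ℂ) • (1 : Matrix (Fin d) (Fin d) ℂ)).PosSemidef :=
    PosSemidef.one.smul (by exact_mod_cast hc.le)
  have h2 := h1.det_re_le_det_add hT
  rw [add_sub_cancel, det_mul, h0, zero_mul, det_smul, det_one, mul_one, ← Complex.ofReal_pow,
    Complex.ofReal_re, Complex.zero_re] at h2
  exact absurd h2 (not_le.2 (by positivity))

/-- Conjugating `T Tᴴ ≥ c` by `T⁻¹` gives `1 ≥ c T⁻¹ T⁻ᴴ`; then take traces. -/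
theorem mul_frobSq_inv_le {d : ℕ} {T : Matrix (Fin d) (Fin d) ℂ} {c : ℝ} (hc : 0 < c)
    (hT : (T * Tᴴ - (c : ℂ) • 1).PosSemidef) : c * frobSq Tᵀ⁻¹ ≤ d := by
  have hu : IsUnit T.det := isUnit_iff_ne_zero.2 (det_ne_zero_of_posSemidef_sub hc hT)
  have h1 := (hT.mul_mul_conjTranspose_same T⁻¹).trace_re_nonneg
  have h2 : T⁻¹ * (T * Tᴴ - (c : ℂ) • 1) * T⁻¹ᴴ = 1 - (c : ℂ) • (T⁻¹ * T⁻¹ᴴ) := by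
    rw [Matrix.mul_sub, ← Matrix.mul_assoc, nonsing_inv_mul _ hu, Matrix.one_mul, Matrix.sub_mul,
      ← conjTranspose_mul, nonsing_inv_mul _ hu, conjTranspose_one, Matrix.mul_smul,
      Matrix.mul_one, Matrix.smul_mul]
  rw [h2, trace_sub, trace_one, Fintype.card_fin, trace_smul, Complex.sub_re, Complex.natCast_re,
    smul_eq_mul, Complex.re_ofReal_mul, trace_mul_conjTranspose_re] at h1
  rw [← transpose_nonsing_inv, frobSq_transpose]
  linarith

end TrainingMatrix

section Training

variable {ι : Type*} {d N : ℕ} {𝒳 : Type*} [Fintype ι] [DecidableEq ι] [MeasurableSpace 𝒳]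
  {ν : Measure 𝒳} [IsProbabilityMeasure ν] {s : ℝ≥0}
  {W : (ι → Matrix (Fin d) (Fin N) ℂ) → ι → Matrix (Fin N) (Fin d) ℂ}
  {h : ι → 𝒳 → Matrix (Fin d) (Fin N) ℂ}

theorem trainSumRate_eq (hW : IsBDPrecoder W) (hh : IsChannelFamily ν h)
    (J T : ι → Matrix (Fin d) (Fin d) ℂ) {P : ℝ} (hP : 0 ≤ P) :
    trainSumRate W ν h J T s P =
      (∑ k, ∫ ω, Real.log (covDet P (h k (ω k).1) (trainPrecoder W h J T ω) Finset.univ)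
          ∂(trainLaw ι ν N d s) -
        ∑ k, ∫ ω, Real.log (covDet P (h k (ω k).1) (trainPrecoder W h J T ω)
          (Finset.univ.erase k)) ∂(trainLaw ι ν N d s)) / Real.log 2 :=
  integral_sum_bdRate (measurable_channel hh) (integrable_channel hh)
    (measurable_trainPrecoder hW hh.measurable J T) (fun _ k => hW.semiUnitary _ k) hP

theorem mul_logb_two_eq (hN : Fintype.card ι * d = N) (P : ℝ) :
    N * Real.logb 2 P = (∑ _k : ι, d * Real.log P) / Real.log 2 := by
  rw [Finset.sum_const, Finset.card_univ, nsmul_eq_mul, ← hN, Real.logb]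
  push_cast
  ring

/-- Treating interference as noise, the multiplexing gain is at most `N`. -/
theorem trainSumRate_le [Nonempty ι] (hN : Fintype.card ι * d = N) (hN0 : 0 < N)
    (hW : IsBDPrecoder W) (hh : IsChannelFamily ν h) (J T : ι → Matrix (Fin d) (Fin d) ℂ)
    {P : ℝ} (hP : 1 ≤ P) :
    trainSumRate W ν h J T s P ≤ N * Real.logb 2 P +
      (d * ∑ k, ∫ ω, frobSq (h k (ω k).1) ∂(trainLaw ι ν N d s)) / Real.log 2 := by
  obtain ⟨k⟩ := ‹Nonempty ι›
  refine (integral_sum_bdRate_le hN hN0 (measurable_channel hh) (integrable_channel hh)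
    (measurable_trainPrecoder hW hh.measurable J T) (fun _ k => hW.semiUnitary _ k) hP k).trans ?_
  refine sub_le_self _ (div_nonneg (integral_nonneg fun ω => ?_) (Real.log_nonneg one_le_two))
  exact log_covDet_nonneg (zero_le_one.trans hP) _ _ _

theorem integral_log_interference_le (hW : IsBDPrecoder W) (hh : IsChannelFamily ν h)
    {J T : ι → Matrix (Fin d) (Fin d) ℂ} (hJ : ∀ k, (J k).det ≠ 0) (hT : ∀ k, (T k).det ≠ 0)
    {P : ℝ} (hP : 0 ≤ P) (k : ι) :
    ∫ ω, Real.log (covDet P (h k (ω k).1) (trainPrecoder W h J T ω) (Finset.univ.erase k))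
      ∂(trainLaw ι ν N d s) ≤ P * frobSq (T k)ᵀ⁻¹ *
        (d * ((Finset.univ.erase k).card * d) / N) *
          ∫ ω, frobSq (ω k).2 ∂(trainLaw ι ν N d s) := by
  rw [← integral_const_mul]
  refine integral_mono (integrable_log_covDet (measurable_channel hh k) (integrable_channel hh k)
    (measurable_trainPrecoder hW hh.measurable J T) (fun _ k => hW.semiUnitary _ k) hP _)
    ((integrable_noise k).const_mul _) fun ω => ?_
  rw [covDet_trainPrecoder hW hJ hT]
  exact log_covDet_noise_le hP _ _ (fun k => hW.semiUnitary _ k) _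

/-- From `1 + y ≤ exp y` with `y` equal to minus a quarter of the centred log-determinant. -/
theorem le_integral_log_signal (hW : IsBDPrecoder W) (hh : IsChannelFamily ν h)
    {J T : ι → Matrix (Fin d) (Fin d) ℂ} {C : ℝ≥0} {P : ℝ} (hP : 1 ≤ P) (k : ι)
    (hC : ∫⁻ ω, ENNReal.ofReal (Real.exp (-(Real.log (covDet P (h k (ω k).1)
        (trainPrecoder W h J T ω) Finset.univ) - d * Real.log P) / 4)) ∂(trainLaw ι ν N d s)
        ≤ C) :
    d * Real.log P - 4 * C ≤ ∫ ω, Real.log (covDet P (h k (ω k).1) (trainPrecoder W h J T ω)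
      Finset.univ) ∂(trainLaw ι ν N d s) := by
  have hi := integrable_log_covDet (μ := trainLaw ι ν N d s) (measurable_channel hh k)
    (integrable_channel hh k) (measurable_trainPrecoder hW hh.measurable J T)
    (fun _ k => hW.semiUnitary _ k) (zero_le_one.trans hP) Finset.univ
  have hi' := hi.sub (integrable_const (d * Real.log P))
  obtain ⟨h1, h2⟩ := integrable_exp_of_lintegral_le hi'.aestronglyMeasurable hC
  have h3 : ∫ ω, -(4 * Real.exp (-(Real.log (covDet P (h k (ω k).1)
        (trainPrecoder W h J T ω) Finset.univ) - d * Real.log P) / 4)) ∂(trainLaw ι ν N d s) ≤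
      ∫ ω, (Real.log (covDet P (h k (ω k).1)
        (trainPrecoder W h J T ω) Finset.univ) - d * Real.log P) ∂(trainLaw ι ν N d s) := by
    refine integral_mono (h1.const_mul 4).neg hi' fun ω => ?_
    simp only
    have := Real.add_one_le_exp (-(Real.log (covDet P (h k (ω k).1)
        (trainPrecoder W h J T ω) Finset.univ) - d * Real.log P) / 4)
    linarith
  rw [integral_neg, integral_const_mul, integral_sub hi (integrable_const _), integral_const,
    probReal_univ, one_smul] at h3
  simp only [Pi.sub_apply] at h2
  linarith

/-- The signal term loses at most a constant. The interference term is bounded because `P ‖T⁻¹‖² ≤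
(P / Ψ) (d / κ)`. -/
theorem hasMultiplexingGain_trainSumRate [Nonempty ι] (hs : s ≠ 0) (e : ι × Fin d ≃ Fin N)
    (hN : Fintype.card ι * d = N) (hN0 : 0 < N) (hW : IsBDPrecoder W) (hh : IsChannelFamily ν h)
    {Ψ : ℝ → ℝ} (hΨ : ∀ P, 0 < P → 0 < Ψ P) {J T : ℝ → ι → Matrix (Fin d) (Fin d) ℂ}
    (hJ : ∀ᶠ P in atTop, ∀ k, (J P k).det ≠ 0) {κ : ℝ} (hκ : 0 < κ)
    (hT : ∀ᶠ P in atTop, ∀ k, (T P k * (T P k)ᴴ - ((κ * Ψ P : ℝ) : ℂ) • 1).PosSemidef)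
    (hPΨ : (fun P => P / Ψ P) =O[atTop] fun _ => (1 : ℝ)) :
    HasMultiplexingGain (fun P => trainSumRate W ν h (J P) (T P) s P) N := by
  obtain ⟨C, hC⟩ := exists_exp_moment_le (ν := ν) hs e hN0 hW hh
  obtain ⟨c, hc0, hc⟩ := hPΨ.exists_pos
  have hlog : 0 < Real.log 2 := Real.log_pos one_lt_two
  refine hasMultiplexingGain_of_le
    (C := (d * ∑ k, ∫ ω, frobSq (h k (ω k).1) ∂(trainLaw ι ν N d s)) / Real.log 2)
    (D := (∑ k, (4 * C + c * (d / κ) * (d * ((Finset.univ.erase k).card * d) / N) *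
          ∫ ω, frobSq (ω k).2 ∂(trainLaw ι ν N d s))) / Real.log 2) ?_ ?_
  · filter_upwards [eventually_ge_atTop 1] with P hP using trainSumRate_le hN hN0 hW hh _ _ hP
  · filter_upwards [eventually_ge_atTop 1, hJ, hT, hc.bound] with P hP hJP hTP hcP
    have hP0 : 0 < P := by linarith
    have hΨP := hΨ P hP0
    have hκΨ : 0 < κ * Ψ P := by positivity
    rw [Real.norm_eq_abs, norm_one, mul_one, abs_of_pos (by positivity)] at hcP
    rw [trainSumRate_eq hW hh _ _ hP0.le, mul_logb_two_eq hN, ← sub_div, ← Finset.sum_sub_distrib,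
      ← Finset.sum_sub_distrib]
    refine div_le_div_of_nonneg_right (Finset.sum_le_sum fun k _ => ?_) hlog.le
    have h1 := le_integral_log_signal hW hh hP k (hC (J P) (T P) hJP P hP0 k)
    have h2 := integral_log_interference_le (ν := ν) (s := s) hW hh hJP
      (fun k => det_ne_zero_of_posSemidef_sub hκΨ (hTP k)) hP0.le k
    have h3 : P * frobSq (T P k)ᵀ⁻¹ ≤ c * (d / κ) := by
      have h4 := mul_frobSq_inv_le hκΨ (hTP k)
      calc P * frobSq (T P k)ᵀ⁻¹ = P / Ψ P * (κ * Ψ P * frobSq (T P k)ᵀ⁻¹ / κ) := by field_simp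
        _ ≤ c * (d / κ) := by
          gcongr
          exact div_nonneg (mul_nonneg hκΨ.le (frobSq_nonneg _)) hκ.le
    have h5 : 0 ≤ ∫ ω, frobSq (ω k).2 ∂(trainLaw ι ν N d s) :=
      integral_nonneg fun ω => frobSq_nonneg _
    have h6 : P * frobSq (T P k)ᵀ⁻¹ * (d * ((Finset.univ.erase k).card * d) / N) *
          ∫ ω, frobSq (ω k).2 ∂(trainLaw ι ν N d s) ≤
        c * (d / κ) * (d * ((Finset.univ.erase k).card * d) / N) *
          ∫ ω, frobSq (ω k).2 ∂(trainLaw ι ν N d s) := by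
      gcongr
    linarith

end Training

/-! ### Limits of the rates -/

section Training

variable {ι : Type*} {d N : ℕ} {𝒳 : Type*} [Fintype ι] [DecidableEq ι] [MeasurableSpace 𝒳]
  {ν : Measure 𝒳} [IsProbabilityMeasure ν] {s : ℝ≥0}
  {W : (ι → Matrix (Fin d) (Fin N) ℂ) → ι → Matrix (Fin N) (Fin d) ℂ}
  {h : ι → 𝒳 → Matrix (Fin d) (Fin N) ℂ} {l : Filter ℝ}
  {J T : ℝ → ι → Matrix (Fin d) (Fin d) ℂ}

theorem tendsto_re {α : Type*} {l : Filter α} {f : α → ℂ} {z : ℂ} (hf : Tendsto f l (𝓝 z)) :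
    Tendsto (fun x => (f x).re) l (𝓝 z.re) :=
  (Complex.continuous_re.tendsto z).comp hf

theorem tendsto_det {α n : Type*} [Fintype n] [DecidableEq n] {l : Filter α}
    {f : α → Matrix n n ℂ} {A : Matrix n n ℂ} (hf : Tendsto f l (𝓝 A)) :
    Tendsto (fun x => (f x).det) l (𝓝 A.det) :=
  ((continuous_id.matrix_det (A := id)).tendsto A).comp hf

/-- The precoders computed from the estimates converge to those for perfect channel knowledge. -/
theorem tendsto_trainPrecoder (e : ι × Fin d ≃ Fin N) (hW : IsBDPrecoder W)
    (hJ : ∀ᶠ P in l, ∀ k, (J P k).det ≠ 0) (hT : ∀ᶠ P in l, ∀ k, (T P k).det ≠ 0)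
    (hT0 : ∀ k, Tendsto (fun P => (T P k)ᵀ⁻¹) l (𝓝 0))
    {ω : ι → 𝒳 × Matrix (Fin N) (Fin d) ℂ} (hω : (stack e fun k => h k (ω k).1).det ≠ 0) (k : ι) :
    Tendsto (fun P => trainPrecoder W h (J P) (T P) ω k * (trainPrecoder W h (J P) (T P) ω k)ᴴ) l
      (𝓝 (W (fun k => h k (ω k).1) k * (W (fun k => h k (ω k).1) k)ᴴ)) := by
  have hG : Tendsto (fun P l => h l (ω l).1 + (T P l)ᵀ⁻¹ * (ω l).2ᵀ) l
      (𝓝 fun l => h l (ω l).1) := by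
    refine tendsto_pi_nhds.2 fun j => ?_
    have h1 := (tendsto_matrix_mul (hT0 j) (tendsto_const_nhds (x := (ω j).2ᵀ))).const_add
      (h j (ω j).1)
    rwa [Matrix.zero_mul, add_zero] at h1
  have hdet : ∀ᶠ P in l, (stack e fun l => h l (ω l).1 + (T P l)ᵀ⁻¹ * (ω l).2ᵀ).det ≠ 0 :=
    (tendsto_det (((continuous_stack e).tendsto _).comp hG)).eventually_ne hω
  have hsu := hW.semiUnitary (fun k => h k (ω k).1) k
  have hzf := hW.zeroForcing (fun k => h k (ω k).1) k
  rw [mul_conjTranspose_eq_nullProj e hω hsu hzf]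
  refine (tendsto_nullProj e hω hsu hzf hG).congr' ?_
  filter_upwards [hdet, hJ, hT] with P h1 h2 h3
  exact (mul_conjTranspose_eq_nullProj e h1 (hW.semiUnitary _ k) fun l hl =>
    channel_add_noise_mul_trainPrecoder hW h2 h3 ω hl).symm

theorem det_bdCovariance_univ_pos (hN0 : 0 < N) {H : Matrix (Fin d) (Fin N) ℂ}
    {V : ι → Matrix (Fin N) (Fin d) ℂ} {k : ι} (hk : (H * V k).det ≠ 0) :
    0 < (bdCovariance 1 H V Finset.univ).det.re := by
  have h1 : bdCovariance 1 H V Finset.univ =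
      bdCovariance 1 H V {k} + bdCovariance 1 H V (Finset.univ.erase k) := by
    rw [bdCovariance, bdCovariance, bdCovariance, Finset.sum_singleton]
    exact (Finset.add_sum_erase Finset.univ
      (fun l => ((1 / N : ℝ) : ℂ) • (H * V l * (V l)ᴴ * Hᴴ)) (Finset.mem_univ k)).symm
  have h2 := (bdCovariance_posSemidef zero_le_one H V {k}).det_re_le_det_add
    (bdCovariance_posSemidef zero_le_one H V (Finset.univ.erase k))
  rw [← h1] at h2
  refine lt_of_lt_of_le ?_ h2
  have h3 : bdCovariance 1 H V {k} = ((1 / N : ℝ) : ℂ) • ((H * V k) * (H * V k)ᴴ) := by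
    rw [bdCovariance, Finset.sum_singleton, conjTranspose_mul]
    simp only [Matrix.mul_assoc]
  rw [h3, det_smul, det_mul, det_conjTranspose, Complex.star_def, Complex.mul_conj',
    Fintype.card_fin, ← Complex.ofReal_pow, ← Complex.ofReal_pow, ← Complex.ofReal_mul,
    Complex.ofReal_re]
  have : 0 < ‖(H * V k).det‖ := norm_pos_iff.2 hk
  positivity

/-- The noise enhancement caused by training noise of relative power `a`, shaped by `m`. -/
def noiseLoss (W : (ι → Matrix (Fin d) (Fin N) ℂ) → ι → Matrix (Fin N) (Fin d) ℂ) (ν : Measure 𝒳)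
    (h : ι → 𝒳 → Matrix (Fin d) (Fin N) ℂ) (m : ι → Matrix (Fin d) (Fin d) ℂ) (s : ℝ≥0) (a : ℝ) :
    ℝ :=
  ∑ k, ∫ ω, Real.log (covDet a (m k * (ω k).2ᵀ) (W fun j => h j (ω j).1) (Finset.univ.erase k))
    ∂(trainLaw ι ν N d s)

/-- The rate offset of the received signal for perfect channel knowledge. -/
def signalOffset (W : (ι → Matrix (Fin d) (Fin N) ℂ) → ι → Matrix (Fin N) (Fin d) ℂ)
    (ν : Measure 𝒳) (h : ι → 𝒳 → Matrix (Fin d) (Fin N) ℂ) (s : ℝ≥0) : ℝ :=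
  ∑ k, ∫ ω, Real.log (bdCovariance 1 (h k (ω k).1) (W fun j => h j (ω j).1) Finset.univ).det.re
    ∂(trainLaw ι ν N d s)

theorem log_covDet_sub_eq {P : ℝ} (hP : 0 < P) (H : Matrix (Fin d) (Fin N) ℂ)
    (V : ι → Matrix (Fin N) (Fin d) ℂ) (t : Finset ι) :
    Real.log (covDet P H V t) - d * Real.log P =
      Real.log (((P⁻¹ : ℝ) : ℂ) • 1 + bdCovariance 1 H V t).det.re := by
  have h1 := one_le_covDet hP.le H V t
  rw [covDet_eq_pow_mul hP] at h1 ⊢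
  have h2 : (((P⁻¹ : ℝ) : ℂ) • 1 + bdCovariance 1 H V t).det.re ≠ 0 := by
    intro h0
    rw [h0, mul_zero] at h1
    linarith
  rw [Real.log_mul (by positivity) h2, Real.log_pow]
  ring

/-- The precoders converge almost surely to those of perfect knowledge, under which the limiting
covariance has positive determinant. The upper bound `d ‖H‖²` and the uniform exponential moment
carry the limit through the integral. -/
theorem tendsto_integral_log_signal [l.IsCountablyGenerated] (hl : l ≤ atTop) (hs : s ≠ 0)
    (e : ι × Fin d ≃ Fin N) (hN : Fintype.card ι * d = N) (hN0 : 0 < N) (hW : IsBDPrecoder W)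
    (hh : IsChannelFamily ν h)
    (hJ : ∀ᶠ P in l, ∀ k, (J P k).det ≠ 0) (hT : ∀ᶠ P in l, ∀ k, (T P k).det ≠ 0)
    (hT0 : ∀ k, Tendsto (fun P => (T P k)ᵀ⁻¹) l (𝓝 0)) (k : ι) :
    Tendsto (fun P => ∫ ω, (Real.log (covDet P (h k (ω k).1) (trainPrecoder W h (J P) (T P) ω)
        Finset.univ) - d * Real.log P) ∂(trainLaw ι ν N d s)) l
      (𝓝 (∫ ω, Real.log (bdCovariance 1 (h k (ω k).1) (W fun j => h j (ω j).1)
        Finset.univ).det.re ∂(trainLaw ι ν N d s))) := by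
  obtain ⟨C, hC⟩ := exists_exp_moment_le (ν := ν) hs e hN0 hW hh
  have hP1 : ∀ᶠ P in l, (1 : ℝ) ≤ P := hl (eventually_ge_atTop 1)
  refine tendsto_integral_of_exp_moment (U := fun ω => d * frobSq (h k (ω k).1)) (C := C) ?_
    ((integrable_channel hh k).const_mul _) ?_ ?_ ?_
  · filter_upwards with P
    exact (((measurable_covDet (measurable_channel hh k)
      (measurable_trainPrecoder hW hh.measurable _ _) P _).log).sub_const _).aestronglyMeasurable
  · filter_upwards [hP1] with P hP
    refine ae_of_all _ fun ω => ?_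
    have := log_covDet_univ_le hN hN0 hP (h k (ω k).1)
      (W := trainPrecoder W h (J P) (T P) ω) fun k => hW.semiUnitary _ k
    simp only
    linarith
  · filter_upwards [hP1, hJ] with P hP hJP using hC _ _ hJP P (by linarith) k
  · filter_upwards [ae_stack_channel_det_ne_zero e hW hh] with ω hω
    have hV := tendsto_trainPrecoder (W := W) (h := h) e hW hJ hT hT0 hω
    have hk : (h k (ω k).1 * W (fun j => h j (ω j).1) k).det ≠ 0 :=
      det_mul_ne_zero_of_stack e hω (hW.semiUnitary _ k) (hW.zeroForcing _ k)
    have hinv : Tendsto (fun P : ℝ => ((P⁻¹ : ℝ) : ℂ) • (1 : Matrix (Fin d) (Fin d) ℂ)) l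
        (𝓝 0) := by
      have h1 : Tendsto (fun P : ℝ => ((P⁻¹ : ℝ) : ℂ)) l (𝓝 ((0 : ℝ) : ℂ)) :=
        (Complex.continuous_ofReal.tendsto _).comp (tendsto_inv_atTop_zero.mono_left hl)
      simpa using h1.smul_const (1 : Matrix (Fin d) (Fin d) ℂ)
    have h2 := hinv.add (tendsto_bdCovariance (tendsto_const_nhds (x := (1 : ℝ)))
      (tendsto_const_nhds (x := h k (ω k).1)) hV Finset.univ)
    rw [zero_add] at h2
    have h3 := (tendsto_re (tendsto_det h2)).log (det_bdCovariance_univ_pos hN0 hk).ne'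
    refine h3.congr' ?_
    filter_upwards [hP1] with P hP
    exact (log_covDet_sub_eq (by linarith) _ _ _).symm

theorem covDet_rescale {ψ : ℝ} (hψ : 0 < ψ) (P : ℝ) (A : Matrix (Fin d) (Fin d) ℂ)
    (Z : Matrix (Fin N) (Fin d) ℂ) (V : ι → Matrix (Fin N) (Fin d) ℂ) (t : Finset ι) :
    covDet P (A * Zᵀ) V t = covDet (P / ψ) (((√ψ : ℝ) : ℂ) • A * Zᵀ) V t := by
  rw [covDet, covDet, Matrix.smul_mul, bdCovariance_smul, Real.sq_sqrt hψ.le,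
    div_mul_cancel₀ _ hψ.ne']

/-- Moving `√Ψ` from the power to the noise expresses the interference through `P / Ψ` and `√Ψ T⁻ᵀ`,
which both converge. The linear bound on the logarithm is then an integrable majorant. -/
theorem tendsto_integral_log_interference [l.IsCountablyGenerated] (hl : l ≤ atTop)
    (e : ι × Fin d ≃ Fin N) (hW : IsBDPrecoder W)
    (hh : IsChannelFamily ν h) {Ψ : ℝ → ℝ} (hΨ : ∀ P, 0 < P → 0 < Ψ P)
    (hJ : ∀ᶠ P in l, ∀ k, (J P k).det ≠ 0) (hT : ∀ᶠ P in l, ∀ k, (T P k).det ≠ 0)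
    (hT0 : ∀ k, Tendsto (fun P => (T P k)ᵀ⁻¹) l (𝓝 0)) {m : ι → Matrix (Fin d) (Fin d) ℂ}
    (hm : ∀ k, Tendsto (fun P => ((√(Ψ P) : ℝ) : ℂ) • (T P k)ᵀ⁻¹) l (𝓝 (m k))) {a : ℝ}
    (ha0 : 0 ≤ a) (ha : Tendsto (fun P => P / Ψ P) l (𝓝 a)) (k : ι) :
    Tendsto (fun P => ∫ ω, Real.log (covDet P (h k (ω k).1) (trainPrecoder W h (J P) (T P) ω)
        (Finset.univ.erase k)) ∂(trainLaw ι ν N d s)) l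
      (𝓝 (∫ ω, Real.log (covDet a (m k * (ω k).2ᵀ) (W fun j => h j (ω j).1)
        (Finset.univ.erase k)) ∂(trainLaw ι ν N d s))) := by
  have hP1 : ∀ᶠ P in l, (1 : ℝ) ≤ P := hl (eventually_ge_atTop 1)
  have hfrob : ∀ᶠ P in l, frobSq (((√(Ψ P) : ℝ) : ℂ) • (T P k)ᵀ⁻¹) ≤ frobSq (m k) + 1 := by
    have h1 : Tendsto (fun P => frobSq (((√(Ψ P) : ℝ) : ℂ) • (T P k)ᵀ⁻¹)) l
        (𝓝 (frobSq (m k))) := by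
      refine tendsto_finsetSum _ fun i _ => tendsto_finsetSum _ fun j _ => ?_
      exact ((tendsto_pi_nhds.1 (tendsto_pi_nhds.1 (hm k) i) j).norm).pow 2
    exact h1.eventually_le_const (lt_add_one _)
  have haP : ∀ᶠ P in l, P / Ψ P ≤ a + 1 := ha.eventually_le_const (lt_add_one _)
  refine tendsto_integral_filter_of_dominated_convergence
    (fun ω => (a + 1) * (frobSq (m k) + 1) * (d * ((Finset.univ.erase k).card * d) / N) *
      frobSq (ω k).2) ?_ ?_ ((integrable_noise k).const_mul _) ?_
  · filter_upwards with P
    exact (measurable_covDet (measurable_channel hh k)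
      (measurable_trainPrecoder hW hh.measurable _ _) P _).log.aestronglyMeasurable
  · filter_upwards [hP1, hJ, hT, hfrob, haP] with P hP hJP hTP h1 h2
    refine ae_of_all _ fun ω => ?_
    have hP0 : 0 < P := by linarith
    have hPΨ : 0 ≤ P / Ψ P := (div_pos hP0 (hΨ P hP0)).le
    rw [Real.norm_eq_abs, abs_of_nonneg (log_covDet_nonneg hP0.le _ _ _),
      covDet_trainPrecoder hW hJP hTP, covDet_rescale (hΨ P hP0)]
    refine (log_covDet_noise_le hPΨ _ _ (fun k => hW.semiUnitary _ k) _).trans ?_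
    have := frobSq_nonneg (ω k).2
    have := frobSq_nonneg (((√(Ψ P) : ℝ) : ℂ) • (T P k)ᵀ⁻¹)
    gcongr
  · filter_upwards [ae_stack_channel_det_ne_zero e hW hh] with ω hω
    have hV := tendsto_trainPrecoder (W := W) (h := h) e hW hJ hT hT0 hω
    have h2 := (tendsto_bdCovariance ha (tendsto_matrix_mul (hm k)
      (tendsto_const_nhds (x := (ω k).2ᵀ))) hV (Finset.univ.erase k)).const_add 1
    have h3 := (tendsto_re (tendsto_det h2)).log
      (zero_lt_one.trans_le (one_le_covDet ha0 _ _ _)).ne'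
    refine h3.congr' ?_
    filter_upwards [hP1, hJ, hT] with P hP hJP hTP
    have hP0 : 0 < P := by linarith
    rw [covDet_trainPrecoder hW hJP hTP, covDet_rescale (hΨ P hP0)]
    rfl

/-- If the ratio of the transmit power and of the training power converges along a filter, then so
does the gap to full multiplexing gain. -/
theorem tendsto_trainSumRate_sub [l.IsCountablyGenerated] (hl : l ≤ atTop) (hs : s ≠ 0)
    (e : ι × Fin d ≃ Fin N) (hN : Fintype.card ι * d = N) (hN0 : 0 < N) (hW : IsBDPrecoder W)
    (hh : IsChannelFamily ν h) {Ψ : ℝ → ℝ} (hΨ : ∀ P, 0 < P → 0 < Ψ P)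
    (hJ : ∀ᶠ P in l, ∀ k, (J P k).det ≠ 0) (hT : ∀ᶠ P in l, ∀ k, (T P k).det ≠ 0)
    {m : ι → Matrix (Fin d) (Fin d) ℂ}
    (hm : ∀ k, Tendsto (fun P => ((√(Ψ P) : ℝ) : ℂ) • (T P k)ᵀ⁻¹) l (𝓝 (m k))) {a : ℝ}
    (ha0 : 0 ≤ a) (ha : Tendsto (fun P => P / Ψ P) l (𝓝 a)) :
    Tendsto (fun P => trainSumRate W ν h (J P) (T P) s P - N * Real.logb 2 P) l
      (𝓝 ((signalOffset W ν h s - noiseLoss W ν h m s a) / Real.log 2)) := by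
  have hP1 : ∀ᶠ P in l, (1 : ℝ) ≤ P := hl (eventually_ge_atTop 1)
  -- A finite limit of `P / Ψ` forces `Ψ → ∞`, as `1 / Ψ = (P / Ψ) (1 / P)`. Hence `T⁻ᵀ → 0` and the
  -- estimates become exact up to invertible factors.
  have hΨinv : Tendsto (fun P => (√(Ψ P))⁻¹) l (𝓝 0) := by
    have h1 : Tendsto (fun P => √(P / Ψ P * P⁻¹)) l (𝓝 √(a * 0)) :=
      (Real.continuous_sqrt.tendsto _).comp (ha.mul (tendsto_inv_atTop_zero.mono_left hl))
    rw [mul_zero, Real.sqrt_zero] at h1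
    refine h1.congr' ?_
    filter_upwards [hP1] with P hP
    have hP0 : 0 < P := by linarith
    rw [← Real.sqrt_inv]
    congr 1
    field_simp
  have hT0 : ∀ k, Tendsto (fun P => (T P k)ᵀ⁻¹) l (𝓝 0) := by
    intro k
    have h1 := ((Complex.continuous_ofReal.tendsto _).comp hΨinv).smul (hm k)
    rw [Complex.ofReal_zero, zero_smul] at h1
    refine h1.congr' ?_
    filter_upwards [hP1] with P hP
    have : √(Ψ P) ≠ 0 := (Real.sqrt_pos.2 (hΨ P (by linarith))).ne'
    rw [Function.comp_apply, smul_smul, ← Complex.ofReal_mul, inv_mul_cancel₀ this,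
      Complex.ofReal_one, one_smul]
  have h1 := tendsto_finsetSum Finset.univ fun k _ =>
    tendsto_integral_log_signal (ν := ν) hl hs e hN hN0 hW hh hJ hT hT0 k
  have h2 := tendsto_finsetSum Finset.univ fun k _ =>
    tendsto_integral_log_interference (ν := ν) (s := s) hl e hW hh hΨ hJ hT hT0 hm ha0 ha k
  refine ((h1.sub h2).div_const (Real.log 2)).congr' ?_
  filter_upwards [hP1] with P hP
  rw [trainSumRate_eq hW hh _ _ (by linarith), mul_logb_two_eq hN, ← sub_div]
  congr 1
  have h3 : ∀ k, ∫ ω, (Real.log (covDet P (h k (ω k).1) (trainPrecoder W h (J P) (T P) ω)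
        Finset.univ) - d * Real.log P) ∂(trainLaw ι ν N d s) =
      ∫ ω, Real.log (covDet P (h k (ω k).1) (trainPrecoder W h (J P) (T P) ω)
        Finset.univ) ∂(trainLaw ι ν N d s) - d * Real.log P := by
    intro k
    rw [integral_sub (integrable_log_covDet (measurable_channel hh k) (integrable_channel hh k)
      (measurable_trainPrecoder hW hh.measurable _ _) (fun _ k => hW.semiUnitary _ k)
      (by linarith) Finset.univ) (integrable_const _), integral_const, probReal_univ, one_smul]
  simp only [h3, Finset.sum_sub_distrib]
  ring

end Training

/-! ### Convergence of the rate offset -/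

-- The square root of the functional calculus, continuous for the operator norm. The existential
-- form keeps that norm and the matrix order out of later statements.
open scoped MatrixOrder Matrix.Norms.L2Operator in
theorem exists_continuousOn_posSemidef_sqrt (d : ℕ) :
    ∃ r : Matrix (Fin d) (Fin d) ℂ → Matrix (Fin d) (Fin d) ℂ,
      (∀ A, A.PosSemidef → r A * (r A)ᴴ = A) ∧ ContinuousOn r {A | A.PosSemidef} := by
  refine ⟨CFC.sqrt, fun A hA => ?_, ?_⟩
  · have h1 : (CFC.sqrt A)ᴴ = CFC.sqrt A :=
      (nonneg_iff_posSemidef.1 (CFC.sqrt_nonneg A)).isHermitian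
    rw [h1]
    exact CFC.sqrt_mul_sqrt_self A (nonneg_iff_posSemidef.2 hA)
  · have h1 : {A : Matrix (Fin d) (Fin d) ℂ | A.PosSemidef} = {A | 0 ≤ A} := by
      ext A
      exact nonneg_iff_posSemidef.symm
    rw [h1]
    exact CFC.continuousOn_sqrt

section Training

variable {ι : Type*} {d N : ℕ} {𝒳 : Type*} [Fintype ι] [DecidableEq ι] [MeasurableSpace 𝒳]
  {ν : Measure 𝒳} [IsProbabilityMeasure ν] {s : ℝ≥0}
  {W : (ι → Matrix (Fin d) (Fin N) ℂ) → ι → Matrix (Fin N) (Fin d) ℂ}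
  {h : ι → 𝒳 → Matrix (Fin d) (Fin N) ℂ}

theorem measurable_bdRate {Ω : Type*} [MeasurableSpace Ω] {H : Ω → Matrix (Fin d) (Fin N) ℂ}
    {V : Ω → ι → Matrix (Fin N) (Fin d) ℂ} (hH : Measurable H) (hV : Measurable V) (P : ℝ)
    (k : ι) : Measurable fun ω => bdRate P (H ω) (V ω) k :=
  ((measurable_covDet hH hV P Finset.univ).div
    (measurable_covDet hH hV P (Finset.univ.erase k))).log.div_const _

/-- The training noise is isotropic: unitary factors of the training matrices are irrelevant. -/
theorem trainSumRate_mul_unitary (hW : IsBDPrecoder W) (hh : IsChannelFamily ν h)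
    (J T U : ι → Matrix (Fin d) (Fin d) ℂ) (hU : ∀ k, U k * (U k)ᴴ = 1) (P : ℝ) :
    trainSumRate W ν h J (fun k => T k * U k) s P =
      trainSumRate W ν h (fun k => J k * (U k)ᵀ) T s P := by
  have hU' : ∀ k, (U k)ᴴ * U k = 1 := fun k => mul_eq_one_comm.1 (hU k)
  let φ : (ι → 𝒳 × Matrix (Fin N) (Fin d) ℂ) → ι → 𝒳 × Matrix (Fin N) (Fin d) ℂ :=
    fun ω k => ((ω k).1, (ω k).2 * (U k)ᴴ)
  have hφ : MeasurePreserving φ (trainLaw ι ν N d s) (trainLaw ι ν N d s) := by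
    refine measurePreserving_pi (fun _ => ν.prod (gaussianMatrix N d s))
      (fun _ => ν.prod (gaussianMatrix N d s))
      (f := fun k p => (p.1, p.2 * (U k)ᴴ)) fun k => ?_
    exact (MeasurePreserving.id ν).prod (measurePreserving_mul_unitary s (U k)ᴴ (by
      rw [conjTranspose_conjTranspose, hU']))
  have hobs : ∀ ω, trainPrecoder W h J (fun k => T k * U k) ω =
      trainPrecoder W h (fun k => J k * (U k)ᵀ) T (φ ω) := by
    intro ω
    refine congrArg W (funext fun k => ?_)
    have h1 : (U k)ᵀ * (U k)ᴴᵀ = 1 := by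
      rw [← transpose_mul, hU', transpose_one]
    simp only [trainObs, φ, transpose_mul, Matrix.mul_assoc, Matrix.mul_add]
    rw [← Matrix.mul_assoc (U k)ᵀ (U k)ᴴᵀ, h1, Matrix.one_mul]
  have hm : Measurable fun ω => ∑ k, bdRate P (h k (ω k).1)
      (trainPrecoder W h (fun k => J k * (U k)ᵀ) T ω) k :=
    Finset.measurable_sum _ fun k _ => measurable_bdRate (measurable_channel hh k)
      (measurable_trainPrecoder hW hh.measurable _ _) P k
  unfold trainSumRate
  rw [← hφ.map_eq, integral_map hφ.measurable.aemeasurable hm.aestronglyMeasurable, hφ.map_eq]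
  simp only [hobs, φ]

theorem integral_lt_integral_of_ae_lt {Ω : Type*} [MeasurableSpace Ω] {μ : Measure Ω} [NeZero μ]
    {f g : Ω → ℝ} (hf : Integrable f μ) (hg : Integrable g μ) (hfg : ∀ᵐ ω ∂μ, f ω < g ω) :
    ∫ ω, f ω ∂μ < ∫ ω, g ω ∂μ := by
  rw [← sub_pos, ← integral_sub hg hf]
  refine (integral_pos_iff_support_of_nonneg_ae
    (by filter_upwards [hfg] with ω hω using sub_nonneg.2 hω.le) (hg.sub hf)).2 ?_
  have h1 : (Function.support fun ω => g ω - f ω) =ᵐ[μ] Set.univ := by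
    filter_upwards [hfg] with ω hω
    exact eq_true (sub_pos.2 hω).ne'
  refine (measure_congr h1).symm ▸ ?_
  exact (NeZero.ne' (μ Set.univ)).symm.bot_lt

theorem integrable_log_noise (hW : IsBDPrecoder W) (hh : IsChannelFamily ν h)
    (m : Matrix (Fin d) (Fin d) ℂ) {a : ℝ} (ha : 0 ≤ a) (k : ι) :
    Integrable (fun ω : ι → 𝒳 × Matrix (Fin N) (Fin d) ℂ => Real.log (covDet a (m * (ω k).2ᵀ)
      (W fun j => h j (ω j).1) (Finset.univ.erase k))) (trainLaw ι ν N d s) := by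
  have hZ : Measurable fun ω : ι → 𝒳 × Matrix (Fin N) (Fin d) ℂ => m * (ω k).2ᵀ :=
    measurable_const.matrix_mul
      (measurable_snd.comp (measurable_pi_apply k)).matrix_transpose
  refine integrable_log_covDet hZ ?_ (hW.measurable.comp
    (measurable_pi_iff.2 fun j => measurable_channel hh j)) (fun _ k => hW.semiUnitary _ k) ha _
  refine ((integrable_noise (s := s) (ν := ν) k).const_mul (frobSq m)).mono' ?_
    (ae_of_all _ fun ω => ?_)
  · refine (Finset.measurable_sum _ fun i _ => Finset.measurable_sum _ fun j _ => ?_).aestronglyMeasurable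
    exact (((measurable_pi_apply j).comp ((measurable_pi_apply i).comp hZ)).norm).pow_const 2
  · rw [Real.norm_eq_abs, abs_of_nonneg (frobSq_nonneg _), ← frobSq_transpose (ω k).2]
    exact frobSq_mul_le _ _

/-- Under perfect knowledge the precoders depend on the channels alone, so the noise of user `k` can
be resampled against a fixed semi-unitary matrix. -/
theorem ae_det_noise_mul_ne_zero (hs : s ≠ 0) (hW : IsBDPrecoder W) (hh : IsChannelFamily ν h)
    (k l : ι) : ∀ᵐ ω ∂(trainLaw ι ν N d s),
      ((ω k).2ᵀ * W (fun j => h j (ω j).1) l).det ≠ 0 := by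
  have hWm : Measurable fun ω : ι → 𝒳 × Matrix (Fin N) (Fin d) ℂ => W (fun j => h j (ω j).1) l :=
    (measurable_pi_apply l).comp (hW.measurable.comp
      (measurable_pi_iff.2 fun j => measurable_channel hh j))
  have hm : Measurable fun ω : ι → 𝒳 × Matrix (Fin N) (Fin d) ℂ =>
      ((ω k).2ᵀ * W (fun j => h j (ω j).1) l).det :=
    ((measurable_snd.comp (measurable_pi_apply k)).matrix_transpose.matrix_mul hWm).matrix_det
  refine (ae_pi_update (fun _ => ν.prod (gaussianMatrix N d s)) k
    (hm (measurableSet_singleton 0).compl)).2 (ae_of_all _ fun ω => ?_)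
  have hm2 : Measurable fun p : 𝒳 × Matrix (Fin N) (Fin d) ℂ =>
      ((Function.update ω k p k).2ᵀ *
        W (fun j => h j (Function.update ω k p j).1) l).det := hm.comp (measurable_update ω)
  refine (Measure.ae_prod_iff_ae_ae (hm2 (measurableSet_singleton 0).compl)).2
    (ae_of_all _ fun x => ?_)
  have hV : ∀ Z : Matrix (Fin N) (Fin d) ℂ,
      (fun j => h j (Function.update ω k (x, Z) j).1) =
        fun j => h j (Function.update ω k (x, 0) j).1 := by
    intro Z
    funext j
    by_cases hj : j = k
    · subst hj
      rw [Function.update_self, Function.update_self]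
    · rw [Function.update_of_ne hj, Function.update_of_ne hj]
  filter_upwards [ae_det_transpose_gaussianMatrix_ne_zero hs
    (hW.semiUnitary (fun j => h j (Function.update ω k (x, 0) j).1) l) 0] with Z hZ
  rw [zero_add] at hZ
  simpa only [Set.mem_compl_iff, Set.mem_preimage, Set.mem_singleton_iff, hV,
    Function.update_self] using hZ

theorem covDet_lt_covDet [NeZero d] (hN0 : 0 < N) {a b : ℝ} (ha : 0 ≤ a) (hab : a < b)
    {H : Matrix (Fin d) (Fin N) ℂ} {V : ι → Matrix (Fin N) (Fin d) ℂ} {t : Finset ι} {l : ι}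
    (hl : l ∈ t) (h0 : (H * V l).det ≠ 0) : covDet a H V t < covDet b H V t := by
  have h1 : ∀ c : ℝ, bdCovariance c H V t = (c : ℂ) • bdCovariance 1 H V t := by
    intro c
    rw [bdCovariance, bdCovariance, Finset.smul_sum]
    refine Finset.sum_congr rfl fun l _ => ?_
    rw [smul_smul, ← Complex.ofReal_mul, mul_one_div]
  have h2 : bdCovariance 1 H V t ≠ 0 := by
    intro h3
    have h4 := trace_bdCovariance_re 1 H V t
    rw [h3, trace_zero, Complex.zero_re] at h4
    have h5 : 0 < ∑ l ∈ t, frobSq (H * V l) := by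
      refine Finset.sum_pos' (fun l _ => frobSq_nonneg _) ⟨l, hl, ?_⟩
      by_contra hle
      refine h0 ?_
      have h6 : H * V l = 0 := by
        ext i j
        have h7 := (norm_sq_le_frobSq (H * V l) i j).trans (not_lt.1 hle)
        simpa using le_antisymm h7 (sq_nonneg _)
      rw [h6, det_zero]
    have : 0 < (N : ℝ) := by exact_mod_cast hN0
    exact absurd h4 (by positivity)
  rw [covDet, covDet, h1 a, h1 b]
  exact (bdCovariance_posSemidef zero_le_one H V t).det_one_add_smul_lt h2 ha hab

/-- A second user exists, so there is interference, and it is almost surely nonzero. Each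
log-determinant then grows strictly with `a`. Strictness is what allows `a` to be recovered from the
limit of the gap. -/
theorem strictMonoOn_noiseLoss [Nontrivial ι] [NeZero d] (hs : s ≠ 0) (hN0 : 0 < N)
    (hW : IsBDPrecoder W) (hh : IsChannelFamily ν h) {m : ι → Matrix (Fin d) (Fin d) ℂ}
    (hm : ∀ k, (m k).det ≠ 0) : StrictMonoOn (noiseLoss W ν h m s) (Set.Ici 0) := by
  intro a ha b hb hab
  refine Finset.sum_lt_sum_of_nonempty Finset.univ_nonempty fun k _ => ?_
  obtain ⟨l, hl⟩ := exists_ne k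
  refine integral_lt_integral_of_ae_lt (integrable_log_noise hW hh _ ha k)
    (integrable_log_noise hW hh _ hb k) ?_
  filter_upwards [ae_det_noise_mul_ne_zero hs hW hh k l] with ω hω
  refine Real.log_lt_log (zero_lt_one.trans_le (one_le_covDet ha _ _ _)) ?_
  refine covDet_lt_covDet hN0 ha hab (Finset.mem_erase.2 ⟨hl, Finset.mem_univ l⟩) ?_
  rw [Matrix.mul_assoc, det_mul]
  exact mul_ne_zero (hm k) hω

theorem hasMultiplexingGainWithOffset_trainSumRate_iff [Nontrivial ι] [NeZero d] (hs : s ≠ 0)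
    (e : ι × Fin d ≃ Fin N) (hN : Fintype.card ι * d = N) (hN0 : 0 < N) (hW : IsBDPrecoder W)
    (hh : IsChannelFamily ν h) {Ψ : ℝ → ℝ} (hΨ : ∀ P, 0 < P → 0 < Ψ P)
    {J T : ℝ → ι → Matrix (Fin d) (Fin d) ℂ}
    (hJ : ∀ᶠ P in atTop, ∀ k, (T P k).det ≠ 0 → (J P k).det ≠ 0)
    {Q : ι → Matrix (Fin d) (Fin d) ℂ} (hQ : ∀ k, (Q k).PosDef)
    (hTQ : ∀ k, Tendsto (fun P => ((Ψ P : ℝ) : ℂ)⁻¹ • (T P k * (T P k)ᴴ)) atTop (𝓝 (Q k)))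
    (hnec : HasMultiplexingGain (fun P => trainSumRate W ν h (J P) (T P) s P) N →
      (fun P => P / Ψ P) =O[atTop] fun _ => (1 : ℝ)) :
    HasMultiplexingGainWithOffset (fun P => trainSumRate W ν h (J P) (T P) s P) N ↔
      ∃ a : ℝ, Tendsto (fun P => P / Ψ P) atTop (𝓝 a) := by
  -- Only `T Tᴴ / Ψ` is assumed to converge, so `T` may carry an arbitrary unitary factor. Write `T
  -- = T' U` with `T' = √Ψ r (T Tᴴ / Ψ)`. Then `T' / √Ψ` converges, and `U` moves into the estimator
  -- because the noise is isotropic.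
  obtain ⟨r, hr, hrc⟩ := exists_continuousOn_posSemidef_sqrt d
  let S : ℝ → ι → Matrix (Fin d) (Fin d) ℂ :=
    fun P k => r (((Ψ P : ℝ) : ℂ)⁻¹ • (T P k * (T P k)ᴴ))
  have hPSD : ∀ P, 0 < P → ∀ k, (((Ψ P : ℝ) : ℂ)⁻¹ • (T P k * (T P k)ᴴ)).PosSemidef := by
    intro P hP k
    refine (posSemidef_self_mul_conjTranspose _).smul ?_
    rw [← Complex.ofReal_inv]
    exact_mod_cast (inv_pos.2 (hΨ P hP)).le
  have hSS : ∀ P, 0 < P → ∀ k, S P k * (S P k)ᴴ = ((Ψ P : ℝ) : ℂ)⁻¹ • (T P k * (T P k)ᴴ) :=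
    fun P hP k => hr _ (hPSD P hP k)
  have hrQ : ∀ k, (r (Q k)).det ≠ 0 := by
    intro k h0
    have h1 := congrArg det (hr _ (hQ k).posSemidef)
    rw [det_mul, h0, zero_mul] at h1
    exact (hQ k).det_pos.ne h1
  have hSlim : ∀ k, Tendsto (fun P => S P k) atTop (𝓝 (r (Q k))) := by
    intro k
    refine (hrc (Q k) (hQ k).posSemidef).tendsto.comp (tendsto_nhdsWithin_iff.2 ⟨hTQ k, ?_⟩)
    filter_upwards [eventually_gt_atTop 0] with P hP using hPSD P hP k
  have hSdet : ∀ᶠ P in atTop, ∀ k, (S P k).det ≠ 0 :=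
    eventually_all.2 fun k => (tendsto_det (hSlim k)).eventually_ne (hrQ k)
  let T' : ℝ → ι → Matrix (Fin d) (Fin d) ℂ := fun P k => ((√(Ψ P) : ℝ) : ℂ) • S P k
  let U : ℝ → ι → Matrix (Fin d) (Fin d) ℂ := fun P k => (T' P k)⁻¹ * T P k
  have hsq : ∀ P, 0 < P → ((√(Ψ P) : ℝ) : ℂ) ≠ 0 := fun P hP =>
    Complex.ofReal_ne_zero.2 (Real.sqrt_pos.2 (hΨ P hP)).ne'
  have hT'T' : ∀ P, 0 < P → ∀ k, T' P k * (T' P k)ᴴ = T P k * (T P k)ᴴ := by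
    intro P hP k
    simp only [T', conjTranspose_smul, Matrix.smul_mul, Matrix.mul_smul, smul_smul, hSS P hP,
      Complex.star_def, Complex.conj_ofReal]
    rw [← mul_assoc, ← Complex.ofReal_mul, Real.mul_self_sqrt (hΨ P hP).le, mul_inv_cancel₀
      (Complex.ofReal_ne_zero.2 (hΨ P hP).ne'), one_smul]
  have hT'det : ∀ᶠ P in atTop, ∀ k, (T' P k).det ≠ 0 := by
    filter_upwards [hSdet, eventually_gt_atTop 0] with P h1 hP k
    simp only [T', det_smul]
    exact mul_ne_zero (pow_ne_zero _ (hsq P hP)) (h1 k)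
  have hTdet : ∀ᶠ P in atTop, ∀ k, (T P k).det ≠ 0 := by
    filter_upwards [hT'det, eventually_gt_atTop 0] with P h1 hP k h0
    have h2 := congrArg det (hT'T' P hP k)
    rw [det_mul, det_mul, h0, zero_mul, det_conjTranspose] at h2
    exact (mul_ne_zero (h1 k) (star_ne_zero.2 (h1 k))) h2
  have hU : ∀ᶠ P in atTop, ∀ k, U P k * (U P k)ᴴ = 1 ∧ T' P k * U P k = T P k := by
    filter_upwards [hT'det, eventually_gt_atTop 0] with P h1 hP k
    have hu : IsUnit (T' P k).det := isUnit_iff_ne_zero.2 (h1 k)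
    constructor
    · simp only [U, conjTranspose_mul]
      rw [Matrix.mul_assoc, ← Matrix.mul_assoc (T P k), ← hT'T' P hP, ← Matrix.mul_assoc,
        ← Matrix.mul_assoc, nonsing_inv_mul _ hu, Matrix.one_mul, ← conjTranspose_mul,
        nonsing_inv_mul _ hu, conjTranspose_one]
    · simp only [U]
      rw [← Matrix.mul_assoc, mul_nonsing_inv _ hu, Matrix.one_mul]
  let J' : ℝ → ι → Matrix (Fin d) (Fin d) ℂ := fun P k => J P k * (U P k)ᵀ
  have hJ'det : ∀ᶠ P in atTop, ∀ k, (J' P k).det ≠ 0 := by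
    filter_upwards [hJ, hTdet, hU] with P h1 h2 h3 k
    simp only [J', det_mul, det_transpose]
    refine mul_ne_zero (h1 k (h2 k)) fun h0 => ?_
    have h4 := congrArg det (h3 k).1
    rw [det_mul, h0, zero_mul, det_one] at h4
    exact zero_ne_one h4
  have hrate : ∀ᶠ P in atTop, trainSumRate W ν h (J P) (T P) s P =
      trainSumRate W ν h (J' P) (T' P) s P := by
    filter_upwards [hU] with P h1
    have h2 := trainSumRate_mul_unitary (s := s) hW hh (J P) (T' P) (U P) (fun k => (h1 k).1) P
    rwa [show (fun k => T' P k * U P k) = T P from funext fun k => (h1 k).2] at h2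
  have hm : ∀ k, Tendsto (fun P => ((√(Ψ P) : ℝ) : ℂ) • (T' P k)ᵀ⁻¹) atTop
      (𝓝 (r (Q k))ᵀ⁻¹) := by
    intro k
    have h1 : Tendsto (fun P => (S P k)ᵀ) atTop (𝓝 (r (Q k))ᵀ) :=
      ((continuous_id.matrix_transpose (A := id)).tendsto _).comp (hSlim k)
    refine (tendsto_matrix_inv h1 (by rw [det_transpose]; exact hrQ k)).congr' ?_
    filter_upwards [hSdet, eventually_gt_atTop 0] with P h2 hP
    have hu : IsUnit (S P k)ᵀ.det := by
      rw [det_transpose]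
      exact isUnit_iff_ne_zero.2 (h2 k)
    simp only [T', transpose_smul]
    refine (inv_eq_right_inv ?_)
    rw [inv_eq_right_inv (A := ((√(Ψ P) : ℝ) : ℂ) • (S P k)ᵀ)
      (B := ((√(Ψ P) : ℝ) : ℂ)⁻¹ • (S P k)ᵀ⁻¹), smul_smul, mul_inv_cancel₀ (hsq P hP), one_smul,
      mul_nonsing_inv _ hu]
    rw [Matrix.smul_mul, Matrix.mul_smul, smul_smul, mul_inv_cancel₀ (hsq P hP), one_smul,
      mul_nonsing_inv _ hu]
  have hlim : ∀ l : Filter ℝ, l.IsCountablyGenerated → l ≤ atTop → ∀ a : ℝ, 0 ≤ a →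
      Tendsto (fun P => P / Ψ P) l (𝓝 a) →
      Tendsto (fun P => trainSumRate W ν h (J P) (T P) s P - N * Real.logb 2 P) l
        (𝓝 ((signalOffset W ν h s - noiseLoss W ν h (fun k => (r (Q k))ᵀ⁻¹) s a) /
          Real.log 2)) := by
    intro l _ hl a ha0 ha
    refine (tendsto_trainSumRate_sub hl hs e hN hN0 hW hh hΨ (hl hJ'det) (hl hT'det)
      (fun k => (hm k).mono_left hl) ha0 ha).congr' ?_
    filter_upwards [hl hrate] with P hP
    rw [hP]
  have hmono := strictMonoOn_noiseLoss (ν := ν) (h := h) hs hN0 hW hh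
    (m := fun k => (r (Q k))ᵀ⁻¹) fun k => by
      rw [← transpose_nonsing_inv, det_transpose]
      exact (isUnit_nonsing_inv_det _ (isUnit_iff_ne_zero.2 (hrQ k))).ne_zero
  constructor
  · rintro hoff
    obtain ⟨C, hC0, hC⟩ := (hnec hoff.hasMultiplexingGain).exists_pos
    obtain ⟨ρ, hρ⟩ := hoff
    have hmem : ∀ᶠ P in atTop, P / Ψ P ∈ Set.Icc 0 C := by
      filter_upwards [hC.bound, eventually_gt_atTop 0] with P h1 hP
      have h2 : 0 < P / Ψ P := div_pos hP (hΨ P hP)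
      rw [Real.norm_eq_abs, norm_one, mul_one, abs_of_pos h2] at h1
      exact ⟨h2.le, h1⟩
    -- The ratio stays in a compact interval. At each of its cluster points the loss must equal the
    -- value dictated by the offset `ρ`, and injectivity of the loss leaves only one cluster point.
    obtain ⟨a, ha, hac⟩ := isCompact_Icc.exists_mapClusterPt_of_frequently hmem.frequently
    have hcl : ∀ x ∈ Set.Icc 0 C, MapClusterPt x atTop (fun P => P / Ψ P) →
        ρ = (signalOffset W ν h s - noiseLoss W ν h (fun k => (r (Q k))ᵀ⁻¹) s x) /
          Real.log 2 := by
      intro x hx hxc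
      -- On this restricted filter, which is still countably generated, the ratio tends to `x`, so
      -- the limit theorem applies without passing to sequences.
      have hne : (atTop ⊓ comap (fun P => P / Ψ P) (𝓝 x)).NeBot := by
        have h1 : ((𝓝 x) ⊓ map (fun P => P / Ψ P) atTop).NeBot := hxc
        rw [inf_comm, ← Filter.push_pull] at h1
        exact h1.of_map
      exact tendsto_nhds_unique (hρ.mono_left inf_le_left)
        (hlim (atTop ⊓ comap (fun P => P / Ψ P) (𝓝 x)) inferInstance inf_le_left x hx.1
          (tendsto_comap.mono_left inf_le_right))
    refine ⟨a, isCompact_Icc.tendsto_nhds_of_unique_mapClusterPt hmem fun x hx hxc => ?_⟩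
    refine hmono.injOn hx.1 ha.1 ?_
    have h1 := (hcl x hx hxc).symm.trans (hcl a ha hac)
    have h2 := (div_left_inj' (Real.log_pos one_lt_two).ne').1 h1
    linarith
  · rintro ⟨a, ha⟩
    refine ⟨_, hlim atTop inferInstance le_rfl a (ge_of_tendsto ha ?_) ha⟩
    filter_upwards [eventually_gt_atTop 0] with P hP using (div_pos hP (hΨ P hP)).le

end Training

/-! ### Block-diagonalization -/

section Interference

variable {Ω : Type*} [MeasurableSpace Ω] {μ : Measure Ω} [IsProbabilityMeasure μ]

/-- An interference amplitude of order `r` causes a rate loss of order `log (p r ^ 2)`. -/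
theorem log_sub_le_integral_of_lintegral_inv_le {f : Ω → ℂ} (hf : Measurable f) {g : Ω → ℝ}
    (hg : Integrable g μ) {K r p : ℝ} (hK : 0 ≤ K) (hr : 0 < r) (hp : 0 < p)
    (hfg : ∀ᵐ ω ∂μ, Real.log (1 + p * ‖f ω‖ ^ 2) ≤ g ω)
    (hfi : ∫⁻ ω, ‖f ω‖ₑ⁻¹ ∂μ ≤ ENNReal.ofReal K * (ENNReal.ofReal r)⁻¹) :
    Real.log (p * r ^ 2) - 2 * K ≤ ∫ ω, g ω ∂μ := by
  have htop : ENNReal.ofReal K * (ENNReal.ofReal r)⁻¹ ≠ ∞ :=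
    ENNReal.mul_ne_top ENNReal.ofReal_ne_top (ENNReal.inv_ne_top.2 (by simpa using hr))
  have h0 : ∀ᵐ ω ∂μ, f ω ≠ 0 := by
    refine ae_ne_zero_of_lintegral_inv_lt_top hf zero_lt_one ?_
    simpa only [ENNReal.rpow_one] using (hfi.trans_lt htop.lt_top).ne
  have h1 : ∫⁻ ω, ENNReal.ofReal ‖f ω‖⁻¹ ∂μ ≤ ENNReal.ofReal K * (ENNReal.ofReal r)⁻¹ := by
    refine (lintegral_mono_ae ?_).trans hfi
    filter_upwards [h0] with ω hω
    rw [ENNReal.ofReal_inv_of_pos (norm_pos_iff.2 hω), ofReal_norm]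
  have hm : Measurable fun ω => ‖f ω‖⁻¹ := hf.norm.inv
  have hi : Integrable (fun ω => ‖f ω‖⁻¹) μ :=
    ⟨hm.aestronglyMeasurable, (hasFiniteIntegral_iff_ofReal (ae_of_all _ fun ω => by positivity)).2
      (h1.trans_lt htop.lt_top)⟩
  have h2 : ∫ ω, ‖f ω‖⁻¹ ∂μ ≤ K * r⁻¹ := by
    rw [integral_eq_lintegral_of_nonneg_ae (ae_of_all _ fun ω => by positivity)
      hm.aestronglyMeasurable]
    refine (ENNReal.toReal_mono htop h1).trans_eq ?_
    rw [ENNReal.toReal_mul, ENNReal.toReal_inv, ENNReal.toReal_ofReal hK, ENNReal.toReal_ofReal hr.le]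
  have h3 : ∫ ω, (Real.log (p * r ^ 2) - 2 * (r * ‖f ω‖⁻¹)) ∂μ ≤ ∫ ω, g ω ∂μ := by
    refine integral_mono_ae ((integrable_const _).sub ((hi.const_mul r).const_mul 2)) hg ?_
    filter_upwards [h0, hfg] with ω hω hgω
    refine le_trans ?_ hgω
    have hpos : 0 < ‖f ω‖ := norm_pos_iff.2 hω
    have h4 : Real.log (p * ‖f ω‖ ^ 2) ≤ Real.log (1 + p * ‖f ω‖ ^ 2) :=
      Real.log_le_log (by positivity) (by linarith)
    -- The inverse moment controls the logarithm through `log (r / |f|) ≤ r / |f|`; the factor `2`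
    -- in the loss comes from the squared amplitude.
    have h5 := Real.log_le_sub_one_of_pos (show 0 < r * ‖f ω‖⁻¹ by positivity)
    rw [Real.log_mul hr.ne' (by positivity), Real.log_inv] at h5
    rw [Real.log_mul hp.ne' (by positivity), Real.log_pow] at h4
    rw [Real.log_mul hp.ne' (by positivity), Real.log_pow]
    push_cast at *
    linarith
  rw [integral_sub (integrable_const _) ((hi.const_mul r).const_mul 2), integral_const,
    probReal_univ, one_smul, integral_const_mul 2, integral_const_mul r] at h3
  have h6 : r * ∫ ω, ‖f ω‖⁻¹ ∂μ ≤ K := by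
    calc _ ≤ r * (K * r⁻¹) := by gcongr
      _ = K := by field_simp
  linarith

end Interference

section Training

variable {ι : Type*} {d N : ℕ} {𝒳 : Type*} [Fintype ι] [DecidableEq ι] [MeasurableSpace 𝒳]
  {ν : Measure 𝒳} [IsProbabilityMeasure ν] {s : ℝ≥0}
  {W : (ι → Matrix (Fin d) (Fin N) ℂ) → ι → Matrix (Fin N) (Fin d) ℂ}
  {h : ι → 𝒳 → Matrix (Fin d) (Fin N) ℂ} {J T : ℝ → ι → Matrix (Fin d) (Fin d) ℂ}

/-- Full multiplexing gain requires bounded interference. -/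
theorem exists_integral_log_interference_le (hN : Fintype.card ι * d = N) (hN0 : 0 < N)
    (hW : IsBDPrecoder W) (hh : IsChannelFamily ν h)
    (hgain : HasMultiplexingGain (fun P => trainSumRate W ν h (J P) (T P) s P) N) :
    ∃ C : ℝ, 0 ≤ C ∧ ∀ᶠ P in atTop, ∀ k, ∫ ω, Real.log (covDet P (h k (ω k).1)
      (trainPrecoder W h (J P) (T P) ω) (Finset.univ.erase k)) ∂(trainLaw ι ν N d s) ≤ C := by
  obtain ⟨C, hC0, hC⟩ := hgain.exists_le
  have hlog : 0 < Real.log 2 := Real.log_pos one_lt_two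
  set D := (d * ∑ k, ∫ ω, frobSq (h k (ω k).1) ∂(trainLaw ι ν N d s)) with hD
  have hD0 : 0 ≤ D := mul_nonneg (Nat.cast_nonneg d) (Finset.sum_nonneg fun k _ =>
    integral_nonneg fun ω => frobSq_nonneg _)
  refine ⟨C * Real.log 2 + D, by positivity, ?_⟩
  filter_upwards [hC, eventually_ge_atTop 1] with P h1 hP k
  have h2 := integral_sum_bdRate_le (μ := trainLaw ι ν N d s) hN hN0 (measurable_channel hh)
    (integrable_channel hh) (measurable_trainPrecoder hW hh.measurable (J P) (T P))
    (fun _ k => hW.semiUnitary _ k) hP k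
  have h3 := h1.trans h2
  rw [← hD, add_sub_assoc, ← sub_div] at h3
  have h4 : -C ≤ (D - ∫ ω, Real.log (covDet P (h k (ω k).1)
      (trainPrecoder W h (J P) (T P) ω) (Finset.univ.erase k)) ∂(trainLaw ι ν N d s)) /
      Real.log 2 := by linarith
  rw [le_div_iff₀ hlog] at h4
  linarith

end Training

theorem sum_norm_sq_col_of_semiUnitary {m n : ℕ} {V : Matrix (Fin n) (Fin m) ℂ} (hV : Vᴴ * V = 1)
    (c : Fin m) : ∑ j, ‖V j c‖ ^ 2 = 1 := by
  have h1 := congrFun (congrFun hV c) c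
  rw [Matrix.mul_apply, one_apply_eq] at h1
  have h2 := congrArg Complex.re h1
  rw [Complex.re_sum, Complex.one_re] at h2
  rw [← h2]
  refine Finset.sum_congr rfl fun j _ => ?_
  rw [conjTranspose_apply, Complex.star_def, mul_comm, Complex.mul_conj']
  norm_cast

section BlockDiagonal

variable {ι : Type*} [Fintype ι] [DecidableEq ι] {M N : ℕ} {s : ℝ≥0}
  {W : (ι → Matrix (Fin M) (Fin N) ℂ) → ι → Matrix (Fin N) (Fin M) ℂ}
  {R A : ι → Matrix (Fin M) (Fin M) ℂ}

theorem measurable_mul_left (A : Matrix (Fin M) (Fin M) ℂ) :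
    Measurable fun X : Matrix (Fin M) (Fin N) ℂ => A * X :=
  measurable_const.matrix_mul measurable_id

theorem isChannelFamily_mul_gaussianMatrix (hA : ∀ k, (A k).det ≠ 0) :
    IsChannelFamily (gaussianMatrix M N 1) fun k X => A k * X where
  measurable k := measurable_mul_left (A k)
  integrable k := by
    refine ((integrable_frobSq_gaussianMatrix M N 1).const_mul (frobSq (A k))).mono' ?_
      (ae_of_all _ fun X => ?_)
    · refine (Finset.measurable_sum _ fun i _ =>
        Finset.measurable_sum _ fun j _ => ?_).aestronglyMeasurable
      exact (((measurable_pi_apply j).comp ((measurable_pi_apply i).comp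
        (measurable_mul_left (A k)))).norm).pow_const 2
    · rw [Real.norm_eq_abs, abs_of_nonneg (frobSq_nonneg _)]
      exact frobSq_mul_le _ _
  negMoment := by
    let C : ι → ℝ≥0∞ := fun k =>
      1 + ‖(A k).det‖ₑ⁻¹ * (ENNReal.ofReal (invMoment 1 * √N) + 1) ^ M
    have hC : ∑ k, C k ≠ ∞ := by
      refine ENNReal.sum_ne_top.2 fun k _ => ENNReal.add_ne_top.2 ⟨ENNReal.one_ne_top, ?_⟩
      refine ENNReal.mul_ne_top (ENNReal.inv_ne_top.2 (by simpa using hA k)) ?_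
      exact ENNReal.pow_ne_top (ENNReal.add_ne_top.2 ⟨ENNReal.ofReal_ne_top, ENNReal.one_ne_top⟩)
    refine ⟨(∑ k, C k).toNNReal, fun k V hV => ?_⟩
    rw [ENNReal.coe_toNNReal hC]
    refine le_trans ?_ (Finset.single_le_sum (f := C) (fun _ _ => zero_le) (Finset.mem_univ k))
    have hm : Measurable fun X : Matrix (Fin M) (Fin N) ℂ => ‖(X * V).det‖ₑ⁻¹ :=
      ((measurable_id.matrix_mul measurable_const).matrix_det).enorm.inv
    calc ∫⁻ X, (‖(A k * X * V).det‖ₑ ^ (1 / 2 : ℝ))⁻¹ ∂(gaussianMatrix M N 1)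
        ≤ ∫⁻ X, (1 + ‖(A k).det‖ₑ⁻¹ * ‖(X * V).det‖ₑ⁻¹) ∂(gaussianMatrix M N 1) := by
          refine lintegral_mono fun X => ?_
          rw [Matrix.mul_assoc, det_mul, enorm_mul,
            ← ENNReal.mul_inv (Or.inr enorm_ne_top) (Or.inl enorm_ne_top)]
          set t := ‖(A k).det‖ₑ * ‖(X * V).det‖ₑ
          rw [← ENNReal.inv_rpow]
          -- Gaussian channels have an inverse moment of order `1`. The order `1 / 2` required of a
          -- channel family follows from `t^(-1/2) ≤ 1 + t⁻¹`.
          rcases le_total t⁻¹ 1 with ht | ht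
          · exact (ENNReal.rpow_le_one ht (by norm_num)).trans le_self_add
          · calc t⁻¹ ^ (1 / 2 : ℝ) ≤ t⁻¹ ^ (1 : ℝ) :=
                ENNReal.rpow_le_rpow_of_exponent_le ht (by norm_num)
              _ = t⁻¹ := ENNReal.rpow_one _
              _ ≤ _ := le_add_self
      _ = 1 + ‖(A k).det‖ₑ⁻¹ * ∫⁻ X, ‖(X * V).det‖ₑ⁻¹ ∂(gaussianMatrix M N 1) := by
          rw [lintegral_add_left measurable_const, lintegral_const, measure_univ, mul_one,
            lintegral_const_mul _ hm]
      _ ≤ C k := by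
          have := lintegral_inv_det_gaussianMatrix_le one_ne_zero hV 0
          simp only [zero_add] at this
          simp only [C]
          gcongr

/-- However the training matrices are chosen, the residual interference is at least of the order of
the training error. -/
theorem lintegral_inv_interference_le (hs : s ≠ 0) (hW : IsBDPrecoder W)
    (J T : ι → Matrix (Fin M) (Fin M) ℂ) (k l : ι) (i j c : Fin M)
    (hA : A k i j ≠ 0) :
    ∫⁻ ω, ‖(A k * (ω k).1 * trainPrecoder W (fun k X => A k * X) J T ω l) i c‖ₑ⁻¹
        ∂(trainLaw ι (gaussianMatrix M N 1) N M s) ≤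
      ENNReal.ofReal (invMoment 1 * √N) * (ENNReal.ofReal
        ((√(1 + (∑ i, ‖((T k)ᵀ * A k) i j‖ ^ 2) / s))⁻¹ * ‖A k i j‖))⁻¹ := by
  set q := ∑ i, ‖((T k)ᵀ * A k) i j‖ ^ 2 with hq
  have hq0 : 0 ≤ q := Finset.sum_nonneg fun _ _ => by positivity
  set ρ : ℝ := (√(1 + q / s))⁻¹ with hρ
  have h1q : 0 < 1 + q / s := by positivity
  have hρ0 : 0 < ρ := by positivity
  -- The direction has `z = -Tᵀ A x`, so the change of the channel is cancelled by that of the noise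
  -- in `Tᵀ A X + Zᵀ`. The factor `ρ` normalizes it for the covariance, with the noise part weighted
  -- by `1 / s`.
  let x : Fin M → ℂ := Pi.single j (ρ : ℂ)
  let z : Fin M → ℂ := -(((T k)ᵀ * A k) *ᵥ x)
  have hz : ∀ i, z i = -(((T k)ᵀ * A k) i j * ρ) := by
    intro i
    simp [z, x, mulVec_single, mul_comm]
  have hnorm : ∑ i, ‖x i‖ ^ 2 + (∑ i, ‖z i‖ ^ 2) / s = 1 := by
    have h1 : ∑ i, ‖x i‖ ^ 2 = ρ ^ 2 := by
      rw [Finset.sum_eq_single j]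
      · simp [x]
      · intro i _ hi
        simp [x, Pi.single_eq_of_ne hi]
      · simp
    have h2 : ∑ i, ‖z i‖ ^ 2 = q * ρ ^ 2 := by
      rw [hq, Finset.sum_mul]
      refine Finset.sum_congr rfl fun i _ => ?_
      rw [hz, norm_neg, norm_mul, Complex.norm_real, Real.norm_eq_abs, mul_pow, sq_abs]
    rw [h1, h2, hρ, inv_pow, Real.sq_sqrt h1q.le]
    field_simp
  have hmV := measurable_trainPrecoder hW (fun k => measurable_mul_left (N := N) (A k)) J T
  have hF : Measurable fun ω : ι → Matrix (Fin M) (Fin N) ℂ × Matrix (Fin N) (Fin M) ℂ =>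
      ‖(A k * (ω k).1 * trainPrecoder W (fun k X => A k * X) J T ω l) i c‖ₑ⁻¹ := by
    have h1 : Measurable fun ω : ι → Matrix (Fin M) (Fin N) ℂ × Matrix (Fin N) (Fin M) ℂ =>
        A k * (ω k).1 * trainPrecoder W (fun k X => A k * X) J T ω l :=
      ((measurable_mul_left (A k)).comp (measurable_fst.comp (measurable_pi_apply k))).matrix_mul
        ((measurable_pi_apply l).comp hmV)
    exact (((measurable_pi_apply c).comp ((measurable_pi_apply i).comp h1)).enorm).inv
  refine (lintegral_pi_update
    (fun _ => (gaussianMatrix M N 1).prod (gaussianMatrix N M s)) k hF).trans_le ?_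
  refine (lintegral_mono (g := fun _ => ENNReal.ofReal (invMoment 1 * √N) *
    (ENNReal.ofReal (ρ * ‖A k i j‖))⁻¹) fun ω => ?_).trans ?_
  · have hΦ := measurePreserving_rotation (n := N) hs x z hnorm
    refine (hΦ.lintegral_comp (hF.comp (measurable_update ω (a := k)))).symm.trans_le ?_
    refine (lintegral_prod _
      ((hF.comp (measurable_update ω)).comp hΦ.measurable).aemeasurable).trans_le ?_
    refine (lintegral_mono (g := fun _ => ENNReal.ofReal (invMoment 1 * √N) *
      (ENNReal.ofReal (ρ * ‖A k i j‖))⁻¹) fun p => ?_).trans (by simp)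
    set V := trainPrecoder W (fun k X => A k * X) J T (Function.update ω k p) with hV
    -- The observations, hence all precoders, are constant along the direction. Neither `J` nor `T`
    -- has to be invertible.
    have hVeq : ∀ v : Fin N → ℂ, trainPrecoder W (fun k X => A k * X) J T
        (Function.update ω k (p.1 + vecMulVec x v, p.2 + vecMulVec v z)) = V := by
      intro v
      have hzv : vecMulVec z v = -((T k)ᵀ * (A k * vecMulVec x v)) := by
        rw [mul_vecMulVec, mul_vecMulVec, mulVec_mulVec, ← neg_vecMulVec]
      refine congrArg W (funext fun l => ?_)
      by_cases hlk : l = k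
      · rw [hlk, trainObs, trainObs, Function.update_self, Function.update_self, transpose_add,
          transpose_vecMulVec, hzv]
        simp only [Matrix.mul_add, Matrix.mul_neg]
        abel
      · simp only [trainObs, Function.update_of_ne hlk]
    have hentry : ∀ g : Fin N → ℂ,
        (A k * (p.1 + vecMulVec x (g - rotationCoeff s x z p.1 p.2)) * V l) i c =
          g ⬝ᵥ (fun n => (A k i j * ρ) * V l n c) + ((A k * p.1 * V l) i c -
            (A k i j * ρ) * (rotationCoeff s x z p.1 p.2 ⬝ᵥ fun n => V l n c)) := by
      intro g
      have h1 : (A k *ᵥ x) i = A k i j * ρ := by simp [x, mulVec_single]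
      have h2 : (g ⬝ᵥ fun n => (A k i j * ρ) * V l n c) =
          (A k i j * ρ) * (g ⬝ᵥ fun n => V l n c) := by
        simp only [dotProduct, Finset.mul_sum]
        exact Finset.sum_congr rfl fun n _ => by ring
      rw [Matrix.mul_add, Matrix.add_mul, Matrix.add_apply, mul_vecMulVec, vecMulVec_mul,
        vecMulVec_apply, h1, sub_vecMul, Pi.sub_apply, h2]
      simp only [vecMul]
      ring
    have hr : 0 < ρ * ‖A k i j‖ := mul_pos hρ0 (norm_pos_iff.2 hA)
    have hsq : (ρ * ‖A k i j‖) ^ 2 ≤ ∑ n, ‖(A k i j * ρ) * V l n c‖ ^ 2 := by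
      simp only [norm_mul, mul_pow, ← Finset.mul_sum, Complex.norm_real, Real.norm_eq_abs, sq_abs]
      have h1 : ∑ n, ‖V l n c‖ ^ 2 = 1 :=
        sum_norm_sq_col_of_semiUnitary (hW.semiUnitary _ l) c
      rw [h1]
      exact le_of_eq (by ring)
    have hfin := lintegral_inv_affine_gaussianVector_le_of_sq (v := 1) one_ne_zero
      (fun n => (A k i j * ρ) * V l n c) ((A k * p.1 * V l) i c -
            (A k i j * ρ) * (rotationCoeff s x z p.1 p.2 ⬝ᵥ fun n => V l n c)) hr hsq
    refine le_trans (le_of_eq ?_) hfin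
    refine lintegral_congr fun g => ?_
    simp only [Function.comp_apply, hVeq, Function.update_self]
    rw [← hentry]
  · simp

/-- One interference entry suffices: its amplitude is of order at least `(1 + q / s)^(-1/2)`, where
`q ≤ ‖A‖² Ψ` by the power constraint alone. Bounded mean log-interference then gives `P ≤ D (1 + b
Ψ)`. -/
theorem isBigO_of_hasMultiplexingGain_bd (hs : s ≠ 0) [Nontrivial ι] [NeZero M]
    (hN : Fintype.card ι * M = N)
    (hN0 : 0 < N) (hW : IsBDPrecoder W) (hA : ∀ k, (A k).det ≠ 0)
    {Ψ : ℝ → ℝ} (hΨ : ∀ P, 0 < P → 0 < Ψ P) {J T : ℝ → ι → Matrix (Fin M) (Fin M) ℂ}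
    (hT : ∀ P, 0 < P → ∀ k, ((T P k)ᴴ * T P k).trace = ((Ψ P : ℝ) : ℂ))
    (hgain : HasMultiplexingGain (fun P => trainSumRate W (gaussianMatrix M N 1)
      (fun k X => A k * X) (J P) (T P) s P) N) :
    (fun P => P / Ψ P) =O[atTop] fun _ => (1 : ℝ) := by
  have hh := isChannelFamily_mul_gaussianMatrix (M := M) (N := N) hA
  obtain ⟨C, hC0, hC⟩ := exists_integral_log_interference_le hN hN0 hW hh hgain
  obtain ⟨k, l, hkl⟩ := exists_pair_ne ι
  obtain ⟨i, j, hij⟩ : ∃ i j, A k i j ≠ 0 := by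
    by_contra! h0
    refine hA k ?_
    rw [show A k = 0 from Matrix.ext h0, det_zero]
  set K : ℝ := invMoment 1 * √N with hK
  have hK0 : 0 ≤ K := by positivity
  set b : ℝ := frobSq (A k) / s with hb
  have hb0 : 0 ≤ b := div_nonneg (frobSq_nonneg _) s.2
  have hs0 : (0 : ℝ) < s := by
    have := pos_iff_ne_zero.2 hs
    exact_mod_cast this
  have hNr : (0 : ℝ) < N := by exact_mod_cast hN0
  have hAij : 0 < ‖A k i j‖ := norm_pos_iff.2 hij
  set D := Real.exp (C + 2 * K) * N / ‖A k i j‖ ^ 2 with hD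
  have hD0 : 0 < D := by positivity
  refine Asymptotics.IsBigO.of_bound (2 * D * b) ?_
  -- Once `P ≥ 2 D`, the constant term of `P ≤ D + D b Ψ` is absorbed by half of `P`.
  filter_upwards [hC, eventually_ge_atTop 1, eventually_ge_atTop (2 * D)] with P h1 hP1 hPD
  have hP0 : 0 < P := by linarith
  have hΨP := hΨ P hP0
  set q := ∑ i, ‖((T P k)ᵀ * A k) i j‖ ^ 2 with hq
  have hq0 : 0 ≤ q := Finset.sum_nonneg fun _ _ => by positivity
  have hqle : q / s ≤ b * Ψ P := by
    have h2 : q ≤ frobSq ((T P k)ᵀ * A k) := Finset.sum_le_sum fun i _ =>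
      Finset.single_le_sum (f := fun j => ‖((T P k)ᵀ * A k) i j‖ ^ 2)
        (fun _ _ => by positivity) (Finset.mem_univ j)
    have h3 : frobSq (T P k) = Ψ P := by
      rw [← trace_mul_conjTranspose_re, Matrix.trace_mul_comm, hT P hP0 k, Complex.ofReal_re]
    have h4 := h2.trans (frobSq_mul_le _ _)
    rw [frobSq_transpose, h3] at h4
    rw [hb, div_mul_eq_mul_div, mul_comm (frobSq (A k))]
    gcongr
  have hint := lintegral_inv_interference_le (A := A) hs hW (J P) (T P) k l i j 0 hij
  rw [← hq] at hint
  have hr : 0 < (√(1 + q / s))⁻¹ * ‖A k i j‖ := by positivity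
  have hmf : Measurable fun ω : ι → Matrix (Fin M) (Fin N) ℂ × Matrix (Fin N) (Fin M) ℂ =>
      (A k * (ω k).1 * trainPrecoder W (fun k X => A k * X) (J P) (T P) ω l) i 0 :=
    (measurable_pi_apply 0).comp ((measurable_pi_apply i).comp
      ((measurable_channel hh k).matrix_mul ((measurable_pi_apply l).comp
        (measurable_trainPrecoder hW hh.measurable (J P) (T P)))))
  have h5 := log_sub_le_integral_of_lintegral_inv_le
    (μ := trainLaw ι (gaussianMatrix M N 1) N M s) hmf
    (integrable_log_covDet (measurable_channel hh k) (integrable_channel hh k)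
      (measurable_trainPrecoder hW hh.measurable (J P) (T P)) (fun _ k => hW.semiUnitary _ k)
      hP0.le (Finset.univ.erase k)) hK0 hr (div_pos hP0 hNr)
    (ae_of_all _ fun ω => log_one_add_le_log_covDet hP0.le _ _
      (Finset.mem_erase.2 ⟨hkl.symm, Finset.mem_univ l⟩) i 0) hint
  have h6 := h5.trans (h1 k)
  rw [sub_le_iff_le_add, Real.log_le_iff_le_exp (by positivity), mul_pow, inv_pow,
    Real.sq_sqrt (by positivity)] at h6
  have h7 : P ≤ D * (1 + q / s) := by
    have h1q : 0 < 1 + q / s := by positivity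
    calc P = P / N * ((1 + q / s)⁻¹ * ‖A k i j‖ ^ 2) * (N * (1 + q / s) / ‖A k i j‖ ^ 2) := by
          field_simp
      _ ≤ Real.exp (C + 2 * K) * (N * (1 + q / s) / ‖A k i j‖ ^ 2) := by gcongr
      _ = D * (1 + q / s) := by rw [hD]; ring
  rw [Real.norm_eq_abs, norm_one, mul_one, abs_of_pos (div_pos hP0 hΨP), div_le_iff₀ hΨP]
  have h8 : D * (q / s) ≤ D * (b * Ψ P) := by gcongr
  linarith

theorem bdSumRate_eq_trainSumRate (T : ι → Matrix (Fin M) (Fin M) ℂ) (P : ℝ) :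
    bdSumRate W R A T s P = trainSumRate W (gaussianMatrix M N 1) (fun k X => A k * X)
      (fun k => ((s : ℂ)⁻¹) • (((R k)⁻¹ + ((s : ℂ)⁻¹) • ((T k)ᵀᴴ * (T k)ᵀ))⁻¹ * (T k)ᵀᴴ)) T s P := by
  unfold bdSumRate trainSumRate
  have h1 : ∀ ω : ι → Matrix (Fin M) (Fin N) ℂ × Matrix (Fin N) (Fin M) ℂ, bdEstimate R A T s ω = fun k => (((s : ℂ)⁻¹) • (((R k)⁻¹ +
      ((s : ℂ)⁻¹) • ((T k)ᵀᴴ * (T k)ᵀ))⁻¹ * (T k)ᵀᴴ)) * trainObs (fun k X => A k * X) T ω k := by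
    intro ω
    funext k
    rw [bdEstimate, mmseEstimate, trainObs, transpose_add, transpose_mul, transpose_transpose,
      Matrix.smul_mul]
  simp only [h1]
  rfl

/-- For invertible training the MMSE filter is invertible, so zero-forcing the estimates amounts to
zero-forcing the raw observations. -/
theorem det_estimator_ne_zero (hs : s ≠ 0) {R T : Matrix (Fin M) (Fin M) ℂ} (hR : R.PosDef)
    (hT : T.det ≠ 0) :
    (((s : ℂ)⁻¹) • ((R⁻¹ + ((s : ℂ)⁻¹) • (Tᵀᴴ * Tᵀ))⁻¹ * Tᵀᴴ)).det ≠ 0 := by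
  have hs0 : ((s : ℝ≥0) : ℂ) ≠ 0 := by exact_mod_cast hs
  have h1 : (R⁻¹ + ((s : ℂ)⁻¹) • (Tᵀᴴ * Tᵀ)).PosDef := by
    refine hR.inv.add_posSemidef ((posSemidef_conjTranspose_mul_self _).smul ?_)
    have : (0 : ℝ) ≤ (s : ℝ)⁻¹ := by positivity
    have h2 : ((s : ℂ))⁻¹ = (((s : ℝ)⁻¹ : ℝ) : ℂ) := by push_cast; rfl
    rw [h2]
    exact_mod_cast this
  rw [det_smul, det_mul, det_conjTranspose, det_transpose]
  refine mul_ne_zero (pow_ne_zero _ (inv_ne_zero hs0)) (mul_ne_zero ?_ (star_ne_zero.2 hT))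
  exact (isUnit_nonsing_inv_det _ (isUnit_iff_ne_zero.2 h1.det_pos.ne')).ne_zero

end BlockDiagonal

/-! ### Zero-forcing with maximum ratio combining -/

section Isotropy

theorem frobSq_row {n : ℕ} (r : Matrix (Fin 1) (Fin n) ℂ) : frobSq r = ∑ j, ‖r 0 j‖ ^ 2 := by
  simp [frobSq]

theorem exists_unitary_col {N : ℕ} {v : Matrix (Fin N) (Fin 1) ℂ} (hv : vᴴ * v = 1) (i₀ : Fin N) :
    ∃ U : Matrix (Fin N) (Fin N) ℂ, U * Uᴴ = 1 ∧ ∀ i, U i i₀ = v i 0 := by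
  let x : Fin N → EuclideanSpace ℂ (Fin N) := fun _ => WithLp.toLp 2 fun i => v i 0
  have hx : ‖x i₀‖ = 1 := by
    rw [EuclideanSpace.norm_eq, Real.sqrt_eq_one]
    exact sum_norm_sq_col_of_semiUnitary hv 0
  have ho : Orthonormal ℂ (({i₀} : Set (Fin N)).domRestrict x) := by
    refine ⟨fun i => hx, fun i j hij => absurd (Subsingleton.elim i j) hij⟩
  obtain ⟨b, hb⟩ := ho.exists_orthonormalBasis_extension_of_card_eq (by simp)
  refine ⟨(EuclideanSpace.basisFun (Fin N) ℂ).toBasis.toMatrix b, ?_, fun i => ?_⟩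
  · exact (Matrix.mem_unitaryGroup_iff).1
      ((EuclideanSpace.basisFun (Fin N) ℂ).toMatrix_orthonormalBasis_mem_unitary b)
  · rw [Module.Basis.toMatrix_apply, hb i₀ rfl]
    simp [x]

theorem exists_unitary_mul_eq {N : ℕ} (hN : 0 < N) {v w : Matrix (Fin N) (Fin 1) ℂ}
    (hv : vᴴ * v = 1) (hw : wᴴ * w = 1) :
    ∃ U : Matrix (Fin N) (Fin N) ℂ, U * Uᴴ = 1 ∧ U * v = w := by
  obtain ⟨B, hB, hBv⟩ := exists_unitary_col hv ⟨0, hN⟩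
  obtain ⟨C, hC, hCw⟩ := exists_unitary_col hw ⟨0, hN⟩
  have hB' : Bᴴ * B = 1 := mul_eq_one_comm.1 hB
  let e : Matrix (Fin N) (Fin 1) ℂ := fun i _ => if i = ⟨0, hN⟩ then 1 else 0
  have hcol : ∀ D : Matrix (Fin N) (Fin N) ℂ, ∀ i j, (D * e) i j = D i ⟨0, hN⟩ := by
    intro D i j
    rw [Matrix.mul_apply]
    simp only [e, mul_ite, mul_one, mul_zero, Finset.sum_ite_eq', Finset.mem_univ, if_true]
  have h1 : B * e = v := by
    ext i j
    rw [hcol, hBv, Subsingleton.elim j 0]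
  have h2 : C * e = w := by
    ext i j
    rw [hcol, hCw, Subsingleton.elim j 0]
  refine ⟨C * Bᴴ, ?_, ?_⟩
  · rw [conjTranspose_mul, conjTranspose_conjTranspose, Matrix.mul_assoc, ← Matrix.mul_assoc Bᴴ,
      hB', Matrix.one_mul, hC]
  · rw [← h1, Matrix.mul_assoc, ← Matrix.mul_assoc Bᴴ, hB', Matrix.one_mul, h2]

/-- `√(a / b) ≤ a + 1 / b`. The exponent `1 / 2` in `IsChannelFamily` is chosen for this step: it
separates the norm of a random direction from the inverse of its projection. -/
theorem inv_rpow_half_div_le {a b : ℝ≥0∞} (ha0 : a ≠ 0) (ha : a ≠ ∞) :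
    ((a⁻¹ * b) ^ (1 / 2 : ℝ))⁻¹ ≤ a + b⁻¹ := by
  rw [← ENNReal.inv_rpow, ENNReal.mul_inv (Or.inl (ENNReal.inv_ne_zero.2 ha))
    (Or.inl (ENNReal.inv_ne_top.2 ha0)), inv_inv]
  calc (a * b⁻¹) ^ (1 / 2 : ℝ) ≤ ((a + b⁻¹) ^ (2 : ℝ)) ^ (1 / 2 : ℝ) := by
        refine ENNReal.rpow_le_rpow ?_ (by norm_num)
        rw [ENNReal.rpow_two, sq]
        exact mul_le_mul' le_self_add le_add_self
    _ = a + b⁻¹ := by rw [← ENNReal.rpow_mul]; norm_num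

/-- An isotropic random vector with a finite inverse moment has no small coordinates. -/
theorem lintegral_inv_det_le_of_isotropic {𝒳 : Type*} [MeasurableSpace 𝒳] {ν : Measure 𝒳}
    [IsProbabilityMeasure ν] {N : ℕ} {h : 𝒳 → Matrix (Fin 1) (Fin N) ℂ} (hh : Measurable h)
    (hiso : ∀ V V' : Matrix (Fin N) (Fin 1) ℂ, Vᴴ * V = 1 → V'ᴴ * V' = 1 →
      ∫⁻ x, (‖(h x * V).det‖ₑ ^ (1 / 2 : ℝ))⁻¹ ∂ν = ∫⁻ x, (‖(h x * V').det‖ₑ ^ (1 / 2 : ℝ))⁻¹ ∂ν)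
    {ρ : 𝒳 → ℂ} (hρ : Measurable ρ) (hρh : ∀ x, ‖ρ x‖ ^ 2 ≤ frobSq (h x)) {C : ℝ≥0}
    (hC : ∫⁻ x, ‖ρ x‖ₑ⁻¹ ∂ν ≤ C) {V : Matrix (Fin N) (Fin 1) ℂ} (hV : Vᴴ * V = 1) :
    ∫⁻ x, (‖(h x * V).det‖ₑ ^ (1 / 2 : ℝ))⁻¹ ∂ν ≤
      ENNReal.ofReal (1 + ∑ j, ∫ g, ‖g j‖ ^ 2 ∂(gaussianVector N 1)) +
        ENNReal.ofReal (invMoment 1 * √N) * C := by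
  have hm : Measurable fun p : (Fin N → ℂ) × 𝒳 => ‖p.1 ⬝ᵥ h p.2 0‖ₑ⁻¹ := by
    have h1 : ∀ j, Measurable fun p : (Fin N → ℂ) × 𝒳 => p.1 j * h p.2 0 j := fun j =>
      ((measurable_pi_apply j).comp measurable_fst).mul
        ((measurable_pi_apply j).comp ((measurable_pi_apply 0).comp (hh.comp measurable_snd)))
    have h2 : Measurable fun p : (Fin N → ℂ) × 𝒳 => p.1 ⬝ᵥ h p.2 0 :=
      Finset.measurable_sum _ fun j _ => h1 j
    exact h2.enorm.inv
  have hρ0 : ∀ᵐ x ∂ν, ρ x ≠ 0 := by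
    refine ae_ne_zero_of_lintegral_inv_lt_top hρ zero_lt_one ?_
    simpa only [ENNReal.rpow_one] using (hC.trans_lt ENNReal.coe_lt_top).ne
  -- By isotropy `V` may be replaced by `g / ‖g‖`. Averaging over Gaussian `g` then leaves the
  -- inverse moment of `g ⬝ᵥ h`, which for fixed `h` is of order `1 / ‖h‖`.
  have hg : ∀ g : Fin N → ℂ, ∫⁻ x, (‖(h x * V).det‖ₑ ^ (1 / 2 : ℝ))⁻¹ ∂ν ≤
      ENNReal.ofReal (1 + ∑ j, ‖g j‖ ^ 2) + ∫⁻ x, ‖g ⬝ᵥ h x 0‖ₑ⁻¹ ∂ν := by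
    intro g
    by_cases hg0 : g = 0
    · simp [hg0]
    set q := ∑ j, ‖g j‖ ^ 2 with hq
    have hq0 : 0 < q := by
      obtain ⟨j, hj⟩ := Function.ne_iff.1 hg0
      refine Finset.sum_pos' (fun _ _ => by positivity) ⟨j, Finset.mem_univ j, ?_⟩
      have : 0 < ‖g j‖ := norm_pos_iff.2 hj
      positivity
    have hsq : 0 < √q := Real.sqrt_pos.2 hq0
    let V' : Matrix (Fin N) (Fin 1) ℂ := fun j _ => ((√q : ℝ) : ℂ)⁻¹ * g j
    have hV' : V'ᴴ * V' = 1 := by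
      ext i j
      rw [Subsingleton.elim i 0, Subsingleton.elim j 0, one_apply_eq, Matrix.mul_apply]
      have h1 : ∀ n, V'ᴴ 0 n * V' n 0 = ((q⁻¹ * ‖g n‖ ^ 2 : ℝ) : ℂ) := by
        intro n
        rw [conjTranspose_apply, Complex.star_def, mul_comm, Complex.mul_conj']
        simp only [V']
        rw [← Complex.ofReal_pow, norm_mul, mul_pow, norm_inv, Complex.norm_real, Real.norm_eq_abs, inv_pow, sq_abs,
          Real.sq_sqrt hq0.le]
      simp only [h1]
      rw [← Complex.ofReal_sum, ← Finset.mul_sum, ← hq, inv_mul_cancel₀ hq0.ne', Complex.ofReal_one]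
    rw [hiso V V' hV hV']
    have h2 : ∀ x, (h x * V').det = ((√q : ℝ) : ℂ)⁻¹ * (g ⬝ᵥ h x 0) := by
      intro x
      rw [det_fin_one, Matrix.mul_apply, dotProduct, Finset.mul_sum]
      exact Finset.sum_congr rfl fun n _ => by simp only [V']; ring

    calc ∫⁻ x, (‖(h x * V').det‖ₑ ^ (1 / 2 : ℝ))⁻¹ ∂ν
        ≤ ∫⁻ x, (ENNReal.ofReal (1 + q) + ‖g ⬝ᵥ h x 0‖ₑ⁻¹) ∂ν := by
          refine lintegral_mono fun x => ?_
          have h3 : ‖((√q : ℝ) : ℂ)⁻¹‖ₑ = (ENNReal.ofReal √q)⁻¹ := by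
            rw [← ofReal_norm, norm_inv, Complex.norm_real, Real.norm_eq_abs, abs_of_pos hsq,
              ENNReal.ofReal_inv_of_pos hsq]
          rw [h2, enorm_mul, h3]
          refine (inv_rpow_half_div_le (ENNReal.ofReal_pos.2 hsq).ne' ENNReal.ofReal_ne_top).trans ?_
          gcongr
          nlinarith [Real.sq_sqrt hq0.le, sq_nonneg (√q - 1)]
      _ = _ := by
          rw [lintegral_add_left measurable_const, lintegral_const, measure_univ, mul_one]
  have hint : Integrable (fun g : Fin N → ℂ => 1 + ∑ j, ‖g j‖ ^ 2) (gaussianVector N 1) :=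
    (integrable_const _).add (integrable_finsetSum _ fun j _ =>
      integrable_entry_sq_gaussianVector N 1 j)
  calc ∫⁻ x, (‖(h x * V).det‖ₑ ^ (1 / 2 : ℝ))⁻¹ ∂ν
      = ∫⁻ _g, ∫⁻ x, (‖(h x * V).det‖ₑ ^ (1 / 2 : ℝ))⁻¹ ∂ν ∂(gaussianVector N 1) := by
        rw [lintegral_const, measure_univ, mul_one]
    _ ≤ ∫⁻ g, (ENNReal.ofReal (1 + ∑ j, ‖g j‖ ^ 2) + ∫⁻ x, ‖g ⬝ᵥ h x 0‖ₑ⁻¹ ∂ν)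
          ∂(gaussianVector N 1) := lintegral_mono hg
    _ = ENNReal.ofReal (1 + ∑ j, ∫ g, ‖g j‖ ^ 2 ∂(gaussianVector N 1)) +
          ∫⁻ g, ∫⁻ x, ‖g ⬝ᵥ h x 0‖ₑ⁻¹ ∂ν ∂(gaussianVector N 1) := by
        rw [lintegral_add_right _ hm.lintegral_prod_right', ← ofReal_integral_eq_lintegral_ofReal
          hint (ae_of_all _ fun g => by positivity), integral_add (integrable_const _)
          (integrable_finsetSum _ fun j _ => integrable_entry_sq_gaussianVector N 1 j),
          integral_finsetSum _ fun j _ => integrable_entry_sq_gaussianVector N 1 j,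
          integral_const, probReal_univ, one_smul]
    _ ≤ _ := by
        gcongr
        rw [lintegral_lintegral_swap hm.aemeasurable]
        calc ∫⁻ x, ∫⁻ g, ‖g ⬝ᵥ h x 0‖ₑ⁻¹ ∂(gaussianVector N 1) ∂ν
            ≤ ∫⁻ x, ENNReal.ofReal (invMoment 1 * √N) * ‖ρ x‖ₑ⁻¹ ∂ν := by
              refine lintegral_mono_ae ?_
              filter_upwards [hρ0] with x hx
              have h1 := lintegral_inv_affine_gaussianVector_le_of_sq (v := 1) one_ne_zero (h x 0)
                0 (norm_pos_iff.2 hx) ((hρh x).trans_eq (frobSq_row _))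
              simpa only [add_zero, ofReal_norm] using h1
          _ = ENNReal.ofReal (invMoment 1 * √N) * ∫⁻ x, ‖ρ x‖ₑ⁻¹ ∂ν :=
              lintegral_const_mul _ hρ.enorm.inv
          _ ≤ _ := by gcongr

end Isotropy

/-! ### Isotropy and energy of the combined channel -/

section Combining

variable {M N : ℕ} {c : Matrix (Fin M) (Fin M) ℂ → Fin M → ℂ}

theorem measurable_effectiveChannel (hc : Measurable c) :
    Measurable fun H : Matrix (Fin M) (Fin N) ℂ => effectiveChannel c H := by
  refine measurable_pi_iff.2 fun j => ?_
  have h1 : Measurable fun H : Matrix (Fin M) (Fin N) ℂ => c (H * Hᴴ) :=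
    hc.comp (measurable_id.matrix_mul measurable_id.matrix_conjTranspose)
  have h3 : ∀ i, Measurable fun H : Matrix (Fin M) (Fin N) ℂ => star (c (H * Hᴴ) i) * H i j := by
    intro i
    have h2 : Measurable fun H : Matrix (Fin M) (Fin N) ℂ => star (c (H * Hᴴ) i) :=
      Complex.continuous_conj.measurable.comp ((measurable_pi_apply i).comp h1)
    exact h2.mul ((measurable_pi_apply j).comp (measurable_pi_apply i))
  exact Finset.measurable_sum Finset.univ fun i _ => h3 i

/-- The combiner is a function of `H Hᴴ`, which a right unitary factor does not change. The
effective channel therefore inherits the isotropy of the Gaussian matrix. -/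
theorem effectiveChannel_mul_unitary (H : Matrix (Fin M) (Fin N) ℂ)
    {U : Matrix (Fin N) (Fin N) ℂ} (hU : U * Uᴴ = 1) :
    effectiveChannel c (H * U) = effectiveChannel c H ᵥ* U := by
  have h1 : H * U * (H * U)ᴴ = H * Hᴴ := by
    rw [conjTranspose_mul, Matrix.mul_assoc, ← Matrix.mul_assoc U, hU, Matrix.one_mul]
  rw [effectiveChannel, effectiveChannel, h1, vecMul_vecMul]

theorem re_dotProduct_gram_mulVec (H : Matrix (Fin M) (Fin N) ℂ) (u : Fin M → ℂ) :
    (star u ⬝ᵥ ((H * Hᴴ) *ᵥ u)).re = ∑ j, ‖(star u ᵥ* H) j‖ ^ 2 := by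
  have h1 : Hᴴ *ᵥ u = star (star u ᵥ* H) := by
    rw [star_vecMul, star_star]
  rw [← mulVec_mulVec, dotProduct_mulVec, h1, dotProduct, Complex.re_sum]
  refine Finset.sum_congr rfl fun j _ => ?_
  rw [Pi.star_apply, Complex.star_def, Complex.mul_conj']
  norm_cast

theorem sum_norm_sq_effectiveChannel (H : Matrix (Fin M) (Fin N) ℂ) :
    ∑ j, ‖effectiveChannel c H j‖ ^ 2 =
      (star (c (H * Hᴴ)) ⬝ᵥ ((H * Hᴴ) *ᵥ c (H * Hᴴ))).re :=
  (re_dotProduct_gram_mulVec H _).symm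

/-- Combining collects at least the energy of every single antenna. -/
theorem sum_norm_sq_row_le_effectiveChannel (hc : IsMRC c) (H : Matrix (Fin M) (Fin N) ℂ)
    (i : Fin M) : ∑ j, ‖H i j‖ ^ 2 ≤ ∑ j, ‖effectiveChannel c H j‖ ^ 2 := by
  have h1 := hc.dominating (H * Hᴴ) (posSemidef_self_mul_conjTranspose H)
    (Pi.single i (1 : ℂ) : Fin M → ℂ) (by simp [dotProduct, Pi.single_apply])
  rw [re_dotProduct_gram_mulVec, ← sum_norm_sq_effectiveChannel] at h1
  refine le_trans (le_of_eq (Finset.sum_congr rfl fun j _ => ?_)) h1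
  congr 2
  have : star (Pi.single i (1 : ℂ) : Fin M → ℂ) = Pi.single i 1 := by
    ext k
    by_cases hk : k = i
    · subst hk; simp
    · simp [hk]
  rw [this, single_one_vecMul]
  rfl

theorem sum_norm_sq_effectiveChannel_le (hc : IsMRC c) (H : Matrix (Fin M) (Fin N) ℂ) :
    ∑ j, ‖effectiveChannel c H j‖ ^ 2 ≤ frobSq H := by
  let r : Matrix (Fin 1) (Fin M) ℂ := fun _ => star (c (H * Hᴴ))
  have h1 : frobSq r = 1 := by
    have h2 := congrArg Complex.re (hc.unit (H * Hᴴ))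
    rw [dotProduct, Complex.re_sum, Complex.one_re] at h2
    rw [frobSq_row, ← h2]
    refine Finset.sum_congr rfl fun j _ => ?_
    simp only [r, Pi.star_apply]
    rw [norm_star, Complex.star_def, mul_comm, Complex.mul_conj']
    norm_cast
  have h3 := frobSq_mul_le r H
  rw [h1, one_mul] at h3
  rwa [frobSq_row] at h3

/-- The effective channel as a matrix with one row. -/
def effectiveRow (c : Matrix (Fin M) (Fin M) ℂ → Fin M → ℂ) (H : Matrix (Fin M) (Fin N) ℂ) :
    Matrix (Fin 1) (Fin N) ℂ := fun _ => effectiveChannel c H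

theorem frobSq_effectiveRow (H : Matrix (Fin M) (Fin N) ℂ) :
    frobSq (effectiveRow c H) = ∑ j, ‖effectiveChannel c H j‖ ^ 2 :=
  frobSq_row _

theorem measurable_effectiveRow (hc : Measurable c) (A : Matrix (Fin M) (Fin M) ℂ) :
    Measurable fun X : Matrix (Fin M) (Fin N) ℂ => effectiveRow c (A * X) :=
  measurable_pi_iff.2 fun _ => (measurable_effectiveChannel hc).comp (measurable_mul_left A)

/-- The effective channel is isotropic, and its norm dominates every entry of `A X`. One such entry
is a nondegenerate Gaussian form, which provides the inverse moment of the norm. -/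
theorem exists_lintegral_inv_det_effectiveRow_le [NeZero M] (hN : 0 < N) (hc : IsMRC c)
    {A : Matrix (Fin M) (Fin M) ℂ} (hA : A.det ≠ 0) :
    ∃ C : ℝ≥0, ∀ V : Matrix (Fin N) (Fin 1) ℂ, Vᴴ * V = 1 →
      ∫⁻ X, (‖(effectiveRow c (A * X) * V).det‖ₑ ^ (1 / 2 : ℝ))⁻¹ ∂(gaussianMatrix M N 1) ≤ C := by
  obtain ⟨i, hi⟩ : ∃ i, A 0 i ≠ 0 := by
    by_contra! h0
    exact hA (det_eq_zero_of_row_eq_zero 0 h0)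
  have hm : Measurable fun X : Matrix (Fin M) (Fin N) ℂ => (A * X) 0 ⟨0, hN⟩ :=
    (measurable_pi_apply _).comp ((measurable_pi_apply _).comp (measurable_mul_left A))
  have hinv : ∫⁻ X, ‖(A * X) 0 ⟨0, hN⟩‖ₑ⁻¹ ∂(gaussianMatrix M N 1) ≤
      ((invMoment 1 * ‖A 0 i‖₊⁻¹ : ℝ≥0) : ℝ≥0∞) := by
    have h1 : MeasurePreserving (fun X : Matrix (Fin M) (Fin N) ℂ => Xᵀ ⟨0, hN⟩)
        (gaussianMatrix M N 1) (gaussianVector M 1) :=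
      (measurePreserving_eval (fun _ : Fin N => gaussianVector M 1) ⟨0, hN⟩).comp
        (measurePreserving_transpose M N 1)
    have h2 : Measurable fun x : Fin M → ℂ => ‖x ⬝ᵥ A 0 + 0‖ₑ⁻¹ := by
      have : Measurable fun x : Fin M → ℂ => x ⬝ᵥ A 0 :=
        Finset.measurable_sum _ fun j _ => (measurable_pi_apply j).mul_const _
      exact (this.add_const 0).enorm.inv
    have h3 := h1.lintegral_comp h2
    have h4 := lintegral_inv_affine_gaussianVector_le one_ne_zero (A 0) 0 i (v := 1)
    refine (le_of_eq ?_).trans (h3.trans_le (h4.trans_eq ?_))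
    · refine lintegral_congr fun X => ?_
      rw [add_zero, dotProduct_comm]
      rfl
    · rw [ENNReal.coe_mul, ENNReal.coe_inv (by simpa using hi), enorm_eq_nnnorm]
  refine ⟨(1 + ∑ j, ∫ g, ‖g j‖ ^ 2 ∂(gaussianVector N 1)).toNNReal +
    (invMoment 1 * √N).toNNReal * (invMoment 1 * ‖A 0 i‖₊⁻¹), fun V hV => ?_⟩
  rw [ENNReal.coe_add, ENNReal.coe_mul]
  refine lintegral_inv_det_le_of_isotropic (measurable_effectiveRow hc.measurable A) ?_ hm ?_ hinv hV
  · intro V V' hV hV'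
    obtain ⟨U, hU, hUV⟩ := exists_unitary_mul_eq hN hV hV'
    have hmV : Measurable fun X : Matrix (Fin M) (Fin N) ℂ =>
        (‖(effectiveRow c (A * X) * V).det‖ₑ ^ (1 / 2 : ℝ))⁻¹ :=
      ((((measurable_effectiveRow hc.measurable A).matrix_mul
        measurable_const).matrix_det).enorm.pow_const _).inv
    refine ((measurePreserving_mul_unitary 1 U hU).lintegral_comp hmV).symm.trans ?_
    refine lintegral_congr fun X => ?_
    have h1 : effectiveRow c (A * (X * U)) * V = effectiveRow c (A * X) * V' := by
      rw [← hUV, ← Matrix.mul_assoc, ← Matrix.mul_assoc]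
      congr 1
      ext i j
      exact congrFun (effectiveChannel_mul_unitary (A * X) hU) j
    rw [h1]
  · intro X
    rw [frobSq_effectiveRow]
    refine le_trans ?_ (sum_norm_sq_row_le_effectiveChannel hc (A * X) 0)
    exact Finset.single_le_sum (f := fun j => ‖(A * X) 0 j‖ ^ 2) (fun _ _ => by positivity)
      (Finset.mem_univ _)

theorem isChannelFamily_effectiveRow {ι : Type*} [Fintype ι] [NeZero M] (hN : 0 < N)
    (hc : IsMRC c) {A : ι → Matrix (Fin M) (Fin M) ℂ} (hA : ∀ k, (A k).det ≠ 0) :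
    IsChannelFamily (gaussianMatrix M N 1) fun k X => effectiveRow c (A k * X) where
  measurable k := measurable_effectiveRow hc.measurable (A k)
  integrable k := by
    have hm := measurable_effectiveRow (N := N) hc.measurable (A k)
    refine ((integrable_frobSq_gaussianMatrix M N 1).const_mul (frobSq (A k))).mono' ?_
      (ae_of_all _ fun X => ?_)
    · refine (Finset.measurable_sum _ fun i _ =>
        Finset.measurable_sum _ fun j _ => ?_).aestronglyMeasurable
      exact (((measurable_pi_apply j).comp ((measurable_pi_apply i).comp hm)).norm).pow_const 2
    · rw [Real.norm_eq_abs, abs_of_nonneg (frobSq_nonneg _), frobSq_effectiveRow]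
      exact (sum_norm_sq_effectiveChannel_le hc _).trans (frobSq_mul_le _ _)
  negMoment := by
    choose C hC using fun k => exists_lintegral_inv_det_effectiveRow_le hN hc (hA k)
    refine ⟨∑ k, C k, fun k V hV => (hC k V hV).trans ?_⟩
    exact_mod_cast Finset.single_le_sum (f := C) (fun _ _ => zero_le) (Finset.mem_univ k)

end Combining

/-! ### Necessity of accurate training for scalar training symbols -/

section ScalarTraining

variable {ι : Type*} [Fintype ι] [DecidableEq ι] {d N : ℕ} {𝒳 : Type*}
  {W : (ι → Matrix (Fin d) (Fin N) ℂ) → ι → Matrix (Fin N) (Fin d) ℂ}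
  {h : ι → 𝒳 → Matrix (Fin d) (Fin N) ℂ}

/-- The channel and the noise of user `k` (the latter in place of user `l`), together with the
weighted observations of the other users. -/
def mixedChannels (h : ι → 𝒳 → Matrix (Fin d) (Fin N) ℂ) (k l : ι) (a : ι → ℂ) (b : ℂ)
    (ω : ι → 𝒳 × Matrix (Fin N) (Fin d) ℂ) (j : ι) : Matrix (Fin d) (Fin N) ℂ :=
  if j = k then h k (ω k).1 else if j = l then (ω k).2ᵀ else a j • h j (ω j).1 + b • (ω j).2ᵀ

omit [DecidableEq ι] in
theorem frobSq_stack_mul (e : ι × Fin d ≃ Fin N) (G : ι → Matrix (Fin d) (Fin N) ℂ)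
    (V : Matrix (Fin N) (Fin d) ℂ) : frobSq (stack e G * V) = ∑ l, frobSq (G l * V) := by
  simp only [frobSq]
  rw [← e.sum_comp, Fintype.sum_prod_type]
  simp only [stack_mul_apply]

/-- The precoder of user `l` annihilates the observations of all others, so only two blocks of `D V`
survive: `h k V` and the noise block, which equals `-t k • h k V`. If the interference were too
small, so would be `D V`, whereas `V` has squared norm `d`. -/
theorem card_le_frobSq_inv_mul (e : ι × Fin d ≃ Fin N) (hW : IsBDPrecoder W)
    {J : ι → Matrix (Fin d) (Fin d) ℂ} (hJ : ∀ k, (J k).det ≠ 0) (t : ι → ℂ) {k l : ι}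
    (hl : l ≠ k) (b : ℂ) (ω : ι → 𝒳 × Matrix (Fin N) (Fin d) ℂ)
    (hD : (stack e (mixedChannels h k l (fun j => b * t j) b ω)).det ≠ 0) :
    (d : ℝ) ≤ frobSq (stack e (mixedChannels h k l (fun j => b * t j) b ω))⁻¹ *
      ((1 + ‖t k‖ ^ 2) * frobSq (h k (ω k).1 *
        trainPrecoder W h J (fun k => t k • 1) ω l)) := by
  set D := stack e (mixedChannels h k l (fun j => b * t j) b ω) with hDdef
  set V := trainPrecoder W h J (fun k => t k • 1) ω l with hV
  have hobs : ∀ j, j ≠ l → (t j • h j (ω j).1 + (ω j).2ᵀ) * V = 0 := by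
    intro j hj
    have h1 := mul_trainPrecoder_eq_zero (h := h) (T := fun k => t k • 1) hW hJ ω hj
    rwa [trainObs, transpose_smul, transpose_one, Matrix.smul_mul, Matrix.one_mul] at h1
  have hk := hobs k hl.symm
  rw [Matrix.add_mul, Matrix.smul_mul, add_eq_zero_iff_eq_neg'] at hk
  have hfr : ∀ (c : ℂ) (B : Matrix (Fin d) (Fin d) ℂ), frobSq (c • B) = ‖c‖ ^ 2 * frobSq B := by
    intro c B
    simp only [frobSq, Matrix.smul_apply, smul_eq_mul, norm_mul, mul_pow, Finset.mul_sum]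
  have hsum : frobSq (D * V) = (1 + ‖t k‖ ^ 2) * frobSq (h k (ω k).1 * V) := by
    rw [hDdef, frobSq_stack_mul, Fintype.sum_eq_add k l hl.symm]
    · rw [mixedChannels, mixedChannels, if_pos rfl, if_neg hl, if_pos rfl, hk, ← neg_smul, hfr,
        norm_neg]
      ring
    · intro j hj
      rw [mixedChannels, if_neg hj.1, if_neg hj.2, mul_smul, ← smul_add, Matrix.smul_mul,
        hobs j hj.2, smul_zero]
      simp [frobSq]
  have h1 : V = D⁻¹ * (D * V) := by
    rw [← Matrix.mul_assoc, nonsing_inv_mul _ (isUnit_iff_ne_zero.2 hD), Matrix.one_mul]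
  have hVu : Vᴴ * V = 1 := hW.semiUnitary _ l
  have h2 : frobSq V = d := by
    rw [frobSq_of_semiUnitary hVu, Fintype.card_fin]
  rw [← h2, ← hsum]
  conv_lhs => rw [h1]
  exact frobSq_mul_le _ _

variable [MeasurableSpace 𝒳] {ν : Measure 𝒳} [IsProbabilityMeasure ν] {s : ℝ≥0}

theorem measurable_det_stack (e : ι × Fin d ≃ Fin N) :
    Measurable fun G : ι → Matrix (Fin d) (Fin N) ℂ => (stack e G).det := by
  have h1 : Measurable (stack e) := by
    refine measurable_pi_iff.2 fun i => measurable_pi_iff.2 fun j => ?_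
    exact (measurable_pi_apply j).comp ((measurable_pi_apply (e.symm i).2).comp
      (measurable_pi_apply (e.symm i).1))
  exact h1.matrix_det

theorem measurable_mixedChannels (hh : IsChannelFamily ν h) (k l : ι) (a : ι → ℂ) (b : ℂ) :
    Measurable fun ω : ι → 𝒳 × Matrix (Fin N) (Fin d) ℂ => mixedChannels h k l a b ω := by
  refine measurable_pi_iff.2 fun j => ?_
  have hZ : ∀ j, Measurable fun ω : ι → 𝒳 × Matrix (Fin N) (Fin d) ℂ => (ω j).2ᵀ := fun j =>
    (measurable_snd.comp (measurable_pi_apply j)).matrix_transpose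
  unfold mixedChannels
  split_ifs
  · exact measurable_channel hh k
  · exact hZ k
  · have h1 : Measurable fun ω : ι → 𝒳 × Matrix (Fin N) (Fin d) ℂ => a j • h j (ω j).1 :=
      (continuous_const_smul (a j)).measurable.comp (measurable_channel hh j)
    have h2 : Measurable fun ω : ι → 𝒳 × Matrix (Fin N) (Fin d) ℂ => b • (ω j).2ᵀ :=
      (continuous_const_smul b).measurable.comp (hZ j)
    exact h1.add h2

theorem ae_det_mixedChannels_ne_zero (hs : s ≠ 0) (e : ι × Fin d ≃ Fin N) (hW : IsBDPrecoder W)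
    (hh : IsChannelFamily ν h) {k l : ι} (hl : l ≠ k) {a : ι → ℂ} {b : ℂ}
    (hab : ∀ j, a j ≠ 0 ∨ b ≠ 0) :
    ∀ᵐ ω ∂(trainLaw ι ν N d s), (stack e (mixedChannels h k l a b ω)).det ≠ 0 := by
  let y : ι → 𝒳 × Matrix (Fin N) (Fin d) ℂ → Matrix (Fin d) (Fin N) ℂ :=
    fun j p => a j • h j p.1 + b • p.2ᵀ
  have hy : ∀ j, Measurable (y j) := by
    intro j
    have h1 : Measurable fun p : 𝒳 × Matrix (Fin N) (Fin d) ℂ => a j • h j p.1 :=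
      (continuous_const_smul (a j)).measurable.comp ((hh.measurable j).comp measurable_fst)
    have h2 : Measurable fun p : 𝒳 × Matrix (Fin N) (Fin d) ℂ => b • p.2ᵀ :=
      (continuous_const_smul b).measurable.comp measurable_snd.matrix_transpose
    exact h1.add h2
  have hydet : ∀ j, ∀ V : Matrix (Fin N) (Fin d) ℂ, Vᴴ * V = 1 →
      ∀ᵐ p ∂(ν.prod (gaussianMatrix N d s)), (y j p * V).det ≠ 0 := by
    intro j V hV
    have hm : MeasurableSet {p | (y j p * V).det ≠ 0} :=
      (((hy j).matrix_mul measurable_const).matrix_det (measurableSet_singleton 0)).compl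
    refine (Measure.ae_prod_iff_ae_ae hm).2 ?_
    by_cases hb : b = 0
    · filter_upwards [hh.ae_det_ne_zero j hV] with x hx
      refine ae_of_all _ fun Z => ?_
      have ha : a j ≠ 0 := (hab j).resolve_right (not_not.2 hb)
      simp only [y, hb, zero_smul, add_zero, Matrix.smul_mul, det_smul]
      exact mul_ne_zero (pow_ne_zero _ ha) hx
    · refine ae_of_all _ fun x => ?_
      filter_upwards [ae_det_transpose_gaussianMatrix_ne_zero hs hV
        (b⁻¹ • (a j • h j x * V))] with Z hZ
      have h1 : y j (x, Z) * V = b • (b⁻¹ • (a j • h j x * V) + Zᵀ * V) := by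
        simp only [y]
        rw [Matrix.add_mul, smul_add, smul_smul, mul_inv_cancel₀ hb, one_smul, Matrix.smul_mul b]
      rw [h1, det_smul]
      exact mul_ne_zero (pow_ne_zero _ hb) hZ
  -- Blocks `k` and `l` use the same coordinate of `ω` and so are not independent across users. They
  -- are filled last, with the other users fixed: first the channel of user `k`, then its
  -- independent noise.
  set t : Finset ι := (Finset.univ.erase k).erase l with ht
  have h0 := ae_stack_ite_det_ne_zero (ν := ν.prod (gaussianMatrix N d s)) e hW hy t
    fun j _ V hV => hydet j V hV
  have hm : Measurable fun ω : ι → 𝒳 × Matrix (Fin N) (Fin d) ℂ =>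
      (stack e (mixedChannels h k l a b ω)).det :=
    (measurable_det_stack e).comp (measurable_mixedChannels hh k l a b)
  refine (ae_pi_update (fun _ => ν.prod (gaussianMatrix N d s)) k
    (hm (measurableSet_singleton 0).compl)).2 ?_
  filter_upwards [h0] with ω hω
  have hm2 : Measurable fun p : 𝒳 × Matrix (Fin N) (Fin d) ℂ =>
      (stack e (mixedChannels h k l a b (Function.update ω k p))).det :=
    hm.comp (measurable_update ω)
  refine (Measure.ae_prod_iff_ae_ae (hm2 (measurableSet_singleton 0).compl)).2 ?_
  set G : ι → Matrix (Fin d) (Fin N) ℂ :=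
    fun j => if j ∈ t then y j (ω j) else unitChannels e j with hG
  filter_upwards [hh.ae_det_ne_zero k (hW.semiUnitary G k)] with x hx
  have h1 := stack_update_det_ne_zero e hω (hW.semiUnitary G k) (hW.zeroForcing G k) hx
  set G' := Function.update G k (h k x) with hG'
  filter_upwards [ae_det_transpose_gaussianMatrix_ne_zero hs (hW.semiUnitary G' l) 0] with Z hZ
  rw [zero_add] at hZ
  have h2 := stack_update_det_ne_zero e h1 (hW.semiUnitary G' l) (hW.zeroForcing G' l) hZ
  have h3 : mixedChannels h k l a b (Function.update ω k (x, Z)) = Function.update G' l Zᵀ := by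
    funext j
    unfold mixedChannels
    by_cases hjl : j = l
    · rw [hjl, if_neg hl, if_pos rfl, Function.update_self, Function.update_self]
    · rw [Function.update_of_ne hjl]
      by_cases hjk : j = k
      · rw [hjk, if_pos rfl, hG', Function.update_self, Function.update_self]
      · rw [if_neg hjk, if_neg hjl, hG', Function.update_of_ne hjk, hG, Function.update_of_ne hjk]
        rw [if_pos (Finset.mem_erase.2 ⟨hjl, Finset.mem_erase.2 ⟨hjk, Finset.mem_univ j⟩⟩)]
  rw [← h3] at h2
  simpa only [Set.mem_compl_iff, Set.mem_preimage, Set.mem_singleton_iff] using h2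

theorem tendsto_frobSq_inv {n α : Type*} [Fintype n] [DecidableEq n] {l : Filter α}
    {f : α → Matrix n n ℂ} {A : Matrix n n ℂ} (hf : Tendsto f l (𝓝 A)) (hA : A.det ≠ 0) :
    Tendsto (fun x => frobSq (f x)⁻¹) l (𝓝 (frobSq A⁻¹)) := by
  have h1 := tendsto_matrix_inv hf hA
  exact tendsto_finsetSum _ fun i _ => tendsto_finsetSum _ fun j _ =>
    ((tendsto_pi_nhds.1 (tendsto_pi_nhds.1 h1 i) j).norm).pow 2

end ScalarTraining

/-! ### Divergence of the interference for single streams -/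

section SingleStream

variable {ι : Type*} [Fintype ι] [DecidableEq ι] {N : ℕ} {𝒳 : Type*} [MeasurableSpace 𝒳]
  {ν : Measure 𝒳} [IsProbabilityMeasure ν] {s : ℝ≥0}
  {W : (ι → Matrix (Fin 1) (Fin N) ℂ) → ι → Matrix (Fin N) (Fin 1) ℂ}
  {h : ι → 𝒳 → Matrix (Fin 1) (Fin N) ℂ}

/-- The interference is unbounded along any sequence along which the training power is of lower
order than the transmit power. -/
theorem not_forall_integral_log_interference_le (hs : s ≠ 0) (e : ι × Fin 1 ≃ Fin N) (hN0 : 0 < N)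
    (hW : IsBDPrecoder W) (hh : IsChannelFamily ν h) {k l : ι} (hl : l ≠ k) (P : ℕ → ℝ)
    {J : ℕ → ι → Matrix (Fin 1) (Fin 1) ℂ} (hJ : ∀ n k, (J n k).det ≠ 0) {t : ℕ → ι → ℂ}
    {ψ : ℕ → ℝ} (ht : ∀ n k, ‖t n k‖ ^ 2 = ψ n) (hP : ∀ n, 0 ≤ P n)
    (hPψ : Tendsto (fun n => P n / (1 + ψ n)) atTop atTop) (C : ℝ) :
    ¬ ∀ n, ∫ ω, Real.log (covDet (P n) (h k (ω k).1)
      (trainPrecoder W h (J n) (fun j => t n j • 1) ω) (Finset.univ.erase k))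
        ∂(trainLaw ι ν N 1 s) ≤ C := by
  intro hC
  have hψ : ∀ n, 0 ≤ ψ n := fun n => (ht n k) ▸ sq_nonneg _
  -- All pilots have power `ψ n`, so one factor `b n` puts the pair of weights of every user on the
  -- unit sphere. The phases of the pilots are arbitrary, hence a subsequence is needed. In the
  -- limit no user has both weights zero, so the limiting stack is almost surely invertible.
  let b : ℕ → ℝ := fun n => (√(1 + ψ n))⁻¹
  have hb0 : ∀ n, 0 < b n := fun n => inv_pos.2 (Real.sqrt_pos.2 (by linarith [hψ n]))
  have hb2 : ∀ n, b n ^ 2 = (1 + ψ n)⁻¹ := fun n => by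
    simp only [b]
    rw [inv_pow, Real.sq_sqrt (by linarith [hψ n])]
  let u : ℕ → (ι → ℂ) × ℝ := fun n => (fun j => (b n : ℂ) * t n j, b n)
  have hunit : ∀ n j, ‖(u n).1 j‖ ^ 2 + (u n).2 ^ 2 = 1 := by
    intro n j
    simp only [u, norm_mul, mul_pow, Complex.norm_real, Real.norm_eq_abs, sq_abs, hb2, ht]
    have : 1 + ψ n ≠ 0 := by linarith [hψ n]
    field_simp
    ring
  have hball : ∀ n, u n ∈ Metric.closedBall (0 : (ι → ℂ) × ℝ) 1 := by
    intro n
    rw [mem_closedBall_zero_iff, Prod.norm_def, max_le_iff, pi_norm_le_iff_of_nonneg zero_le_one]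
    refine ⟨fun j => ?_, ?_⟩
    · exact (sq_le_one_iff₀ (norm_nonneg _)).1 (by linarith [hunit n j, sq_nonneg (u n).2])
    · rw [Real.norm_eq_abs]
      refine (sq_le_one_iff₀ (abs_nonneg _)).1 ?_
      rw [sq_abs]
      linarith [hunit n k, sq_nonneg ‖(u n).1 k‖]
  obtain ⟨v, -, φ, hφ, hv⟩ := (isCompact_closedBall (0 : (ι → ℂ) × ℝ) 1).tendsto_subseq hball
  have hv1 : ∀ j, Tendsto (fun n => (u (φ n)).1 j) atTop (𝓝 (v.1 j)) := fun j =>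
    (tendsto_pi_nhds.1 ((continuous_fst.tendsto v).comp hv)) j
  have hv2 : Tendsto (fun n => (u (φ n)).2) atTop (𝓝 v.2) := (continuous_snd.tendsto v).comp hv
  have hvunit : ∀ j, ‖v.1 j‖ ^ 2 + v.2 ^ 2 = 1 := fun j =>
    tendsto_nhds_unique (((hv1 j).norm.pow 2).add (hv2.pow 2))
      (by simp only [hunit]; exact tendsto_const_nhds)
  have hvne : ∀ j, v.1 j ≠ 0 ∨ (v.2 : ℂ) ≠ 0 := by
    intro j
    by_contra! h0
    have h1 := hvunit j
    rw [h0.1, Complex.ofReal_eq_zero.1 h0.2] at h1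
    simp at h1
  have hae1 := ae_det_mixedChannels_ne_zero (ν := ν) hs e hW hh hl (b := (v.2 : ℂ)) hvne
  have hae2 : ∀ᵐ ω ∂(trainLaw ι ν N 1 s), ∀ n,
      (stack e (mixedChannels h k l (fun j => (b n : ℂ) * t n j) (b n) ω)).det ≠ 0 :=
    ae_all_iff.2 fun n => ae_det_mixedChannels_ne_zero hs e hW hh hl
      fun j => Or.inr (Complex.ofReal_ne_zero.2 (hb0 n).ne')
  let L : ℕ → (ι → 𝒳 × Matrix (Fin N) (Fin 1) ℂ) → ℝ := fun n ω =>
    Real.log (covDet (P n) (h k (ω k).1) (trainPrecoder W h (J n) (fun j => t n j • 1) ω)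
      (Finset.univ.erase k))
  have hLm : ∀ n, Measurable (L n) := fun n =>
    (measurable_covDet (measurable_channel hh k)
      (measurable_trainPrecoder hW hh.measurable _ _) (P n) _).log
  have hNr : (0 : ℝ) < N := by exact_mod_cast hN0
  have hlim : ∀ᵐ ω ∂(trainLaw ι ν N 1 s), Tendsto (fun n => L (φ n) ω) atTop atTop := by
    filter_upwards [hae1, hae2] with ω h1 h2
    have hD : Tendsto (fun n => stack e (mixedChannels h k l (u (φ n)).1 ((u (φ n)).2 : ℂ) ω)) atTop
        (𝓝 (stack e (mixedChannels h k l v.1 (v.2 : ℂ) ω))) := by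
      refine ((continuous_stack e).tendsto _).comp (tendsto_pi_nhds.2 fun j => ?_)
      unfold mixedChannels
      split_ifs
      · exact tendsto_const_nhds
      · exact tendsto_const_nhds
      · exact ((hv1 j).smul_const _).add
          (((Complex.continuous_ofReal.tendsto _).comp hv2).smul_const _)
    set F := frobSq (stack e (mixedChannels h k l v.1 (v.2 : ℂ) ω))⁻¹ with hF
    have hF0 : 0 ≤ F := frobSq_nonneg _
    have hFle := (tendsto_frobSq_inv hD h1).eventually_le_const (lt_add_one F)
    have hgrow : Tendsto (fun n => Real.log (P (φ n) / (1 + ψ (φ n)) * (N * (F + 1))⁻¹)) atTop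
        atTop :=
      Real.tendsto_log_atTop.comp ((hPψ.comp hφ.tendsto_atTop).atTop_mul_const (by positivity))
    refine tendsto_atTop_mono' atTop ?_ hgrow
    have hpos := (hPψ.comp hφ.tendsto_atTop).eventually_gt_atTop 0
    filter_upwards [hFle, hpos] with n hn hpn
    simp only [Function.comp_apply] at hpn
    have h3 := card_le_frobSq_inv_mul (h := h) e hW (hJ (φ n)) (t (φ n)) hl (b (φ n) : ℂ) ω
      (h2 (φ n))
    have h4 := log_one_add_le_log_covDet (hP (φ n)) (h k (ω k).1)
      (trainPrecoder W h (J (φ n)) (fun j => t (φ n) j • 1) ω)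
      (Finset.mem_erase.2 ⟨hl, Finset.mem_univ l⟩) 0 0
    refine le_trans (Real.log_le_log (by positivity) ?_) h4
    set q := frobSq (h k (ω k).1 * trainPrecoder W h (J (φ n)) (fun j => t (φ n) j • 1) ω l)
      with hq
    have hq0 : 0 ≤ q := frobSq_nonneg _
    have hqe : ‖(h k (ω k).1 * trainPrecoder W h (J (φ n)) (fun j => t (φ n) j • 1) ω l) 0 0‖ ^ 2
        = q := by simp [hq, frobSq]
    rw [hqe]
    have hψn : 0 < 1 + ψ (φ n) := by linarith [hψ (φ n)]
    rw [ht, Nat.cast_one] at h3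
    have h5 : 1 ≤ (F + 1) * ((1 + ψ (φ n)) * q) :=
      h3.trans (mul_le_mul_of_nonneg_right hn (by positivity))
    have hPn := hP (φ n)
    calc P (φ n) / (1 + ψ (φ n)) * (N * (F + 1))⁻¹
        ≤ P (φ n) / (1 + ψ (φ n)) * (N * (F + 1))⁻¹ * ((F + 1) * ((1 + ψ (φ n)) * q)) :=
          le_mul_of_one_le_right (by positivity) h5
      _ = P (φ n) / N * q := by field_simp
      _ ≤ _ := by linarith
  -- The log-interference is nonnegative and tends to `∞` almost surely along the subsequence.
  -- Fatou's lemma contradicts the uniform bound `C` on its mean.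
  have hfatou := lintegral_liminf_le (μ := trainLaw ι ν N 1 s) (u := atTop)
    (f := fun n ω => ENNReal.ofReal (L (φ n) ω)) fun n => (hLm (φ n)).ennreal_ofReal
  have htop : ∫⁻ ω, liminf (fun n => ENNReal.ofReal (L (φ n) ω)) atTop ∂(trainLaw ι ν N 1 s)
      = ∞ := by
    have h1 : ∀ᵐ ω ∂(trainLaw ι ν N 1 s),
        liminf (fun n => ENNReal.ofReal (L (φ n) ω)) atTop = ∞ := by
      filter_upwards [hlim] with ω hω
      exact (ENNReal.tendsto_ofReal_atTop.comp hω).liminf_eq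
    rw [lintegral_congr_ae h1]
    simp
  rw [htop, top_le_iff] at hfatou
  have hle : ∀ n, ∫⁻ ω, ENNReal.ofReal (L (φ n) ω) ∂(trainLaw ι ν N 1 s) ≤ ENNReal.ofReal C := by
    intro n
    rw [← ofReal_integral_eq_lintegral_ofReal (integrable_log_covDet (measurable_channel hh k)
      (integrable_channel hh k) (measurable_trainPrecoder hW hh.measurable _ _)
      (fun _ k => hW.semiUnitary _ k) (hP _) _)
      (ae_of_all _ fun ω => log_covDet_nonneg (hP _) _ _ _)]
    exact ENNReal.ofReal_le_ofReal (hC (φ n))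
  have h2 : liminf (fun n => ∫⁻ ω, ENNReal.ofReal (L (φ n) ω) ∂(trainLaw ι ν N 1 s)) atTop ≤
      ENNReal.ofReal C := by
    refine (liminf_le_liminf (v := fun _ => ENNReal.ofReal C)
      (Eventually.of_forall hle)).trans_eq ?_
    exact tendsto_const_nhds.liminf_eq
  rw [hfatou] at h2
  exact ENNReal.ofReal_ne_top (top_le_iff.1 h2)

theorem isBigO_of_hasMultiplexingGain_scalar [Nontrivial ι] (hs : s ≠ 0) (e : ι × Fin 1 ≃ Fin N)
    (hN : Fintype.card ι * 1 = N) (hN0 : 0 < N) (hW : IsBDPrecoder W) (hh : IsChannelFamily ν h)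
    {Ψ : ℝ → ℝ} (hΨ : ∀ P, 0 < P → 0 < Ψ P) {J : ℝ → ι → Matrix (Fin 1) (Fin 1) ℂ}
    (hJ : ∀ P, 0 < P → ∀ k, (J P k).det ≠ 0) {t : ℝ → ι → ℂ}
    (ht : ∀ P, 0 < P → ∀ k, ‖t P k‖ ^ 2 = Ψ P)
    (hgain : HasMultiplexingGain
      (fun P => trainSumRate W ν h (J P) (fun k => t P k • 1) s P) N) :
    (fun P => P / Ψ P) =O[atTop] fun _ => (1 : ℝ) := by
  obtain ⟨C, -, hC⟩ := exists_integral_log_interference_le (T := fun P k => t P k • 1)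
    hN hN0 hW hh hgain
  by_contra hO
  have hfreq : ∀ n : ℕ, ∃ P : ℝ, n + 1 ≤ P ∧ (n : ℝ) + 1 ≤ P / Ψ P ∧
      ∀ k, ∫ ω, Real.log (covDet P (h k (ω k).1)
        (trainPrecoder W h (J P) (fun k => t P k • 1) ω) (Finset.univ.erase k))
          ∂(trainLaw ι ν N 1 s) ≤ C := by
    intro n
    have h1 : ∃ᶠ P in atTop, ¬ ‖P / Ψ P‖ ≤ (n + 1 : ℝ) * ‖(1 : ℝ)‖ := fun h0 =>
      hO (Asymptotics.IsBigO.of_bound (n + 1 : ℝ) (by simpa using h0))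
    obtain ⟨P, h2, h3, h4⟩ := (h1.and_eventually
      ((eventually_ge_atTop (n + 1 : ℝ)).and hC)).exists
    have hP0 : 0 < P := lt_of_lt_of_le (by positivity) h3
    rw [Real.norm_eq_abs, norm_one, mul_one, abs_of_pos (div_pos hP0 (hΨ P hP0)), not_le] at h2
    exact ⟨P, h3, h2.le, h4⟩
  choose P hP1 hP2 hP3 using hfreq
  have hP0 : ∀ n, 0 < P n := fun n => lt_of_lt_of_le (by positivity) (hP1 n)
  obtain ⟨k, l, hkl⟩ := exists_pair_ne ι
  refine not_forall_integral_log_interference_le (ν := ν) hs e hN0 hW hh hkl.symm P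
    (fun n => hJ (P n) (hP0 n)) (t := fun n => t (P n)) (ψ := fun n => Ψ (P n))
    (fun n => ht (P n) (hP0 n)) (fun n => (hP0 n).le) ?_ C fun n => hP3 n k
  -- Both `1` and `Ψ` are at most `P / (n + 1)`, so `P / (1 + Ψ)` is at least `(n + 1) / 2`.
  have hhalf : Tendsto (fun n : ℕ => ((n : ℝ) + 1) * (1 / 2)) atTop atTop :=
    (tendsto_atTop_add_const_right _ _ tendsto_natCast_atTop_atTop).atTop_mul_const (by norm_num)
  refine tendsto_atTop_mono (fun n => ?_) hhalf
  have hΨn := hΨ _ (hP0 n)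
  have h2 := hP2 n
  rw [le_div_iff₀ hΨn] at h2
  rw [le_div_iff₀ (by linarith)]
  linarith [hP1 n]

end SingleStream

/-! ### Zero-forcing as block-diagonalization with single streams -/

section SingleStreamReduction

variable {ι : Type*} [Fintype ι] [DecidableEq ι] {M N : ℕ} {s : ℝ≥0}
  {c : Matrix (Fin M) (Fin M) ℂ → Fin M → ℂ} {w : (ι → Fin N → ℂ) → ι → Fin N → ℂ}
  {A : ι → Matrix (Fin M) (Fin M) ℂ}

/-- A zero-forcing rule as a rule for precoding matrices with a single column. -/
def singleStreamPrecoder (w : (ι → Fin N → ℂ) → ι → Fin N → ℂ)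
    (G : ι → Matrix (Fin 1) (Fin N) ℂ) (k : ι) : Matrix (Fin N) (Fin 1) ℂ :=
  fun n _ => w (fun j => G j 0) k n

theorem isBDPrecoder_singleStreamPrecoder (hw : IsZFPrecoder w) :
    IsBDPrecoder (singleStreamPrecoder w) where
  measurable := by
    have h1 : Measurable fun G : ι → Matrix (Fin 1) (Fin N) ℂ => w fun j => G j 0 :=
      hw.measurable.comp (measurable_pi_iff.2 fun j =>
        (measurable_pi_apply 0).comp (measurable_pi_apply j))
    refine measurable_pi_iff.2 fun k => measurable_pi_iff.2 fun n => measurable_pi_iff.2 fun _ => ?_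
    exact (measurable_pi_apply n).comp ((measurable_pi_apply k).comp h1)
  semiUnitary G k := by
    ext i j
    rw [Subsingleton.elim i 0, Subsingleton.elim j 0, one_apply_eq]
    exact hw.unit (fun j => G j 0) k
  zeroForcing G k l hl := by
    ext i j
    rw [Subsingleton.elim i 0]
    exact hw.zeroForcing (fun j => G j 0) k l hl

theorem covDet_singleStream (P : ℝ) (g : Fin N → ℂ) (v : ι → Fin N → ℂ) (t : Finset ι) :
    covDet P (fun _ : Fin 1 => g) (fun l n _ => v l n) t = 1 + ∑ l ∈ t, P / N * ‖g ⬝ᵥ v l‖ ^ 2 := by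
  have h1 := trace_bdCovariance_re P (fun _ : Fin 1 => g) (fun l n _ => v l n) t
  rw [Matrix.trace, Finset.univ_unique, Finset.sum_singleton] at h1
  have h2 : covDet P (fun _ : Fin 1 => g) (fun l n _ => v l n) t =
      1 + (bdCovariance P (fun _ : Fin 1 => g) (fun l n _ => v l n) t 0 0).re := by
    unfold covDet
    rw [det_fin_one, Matrix.add_apply, one_apply_eq, Complex.add_re, Complex.one_re]
  refine h2.trans (congrArg (1 + ·) (h1.trans ?_))
  rw [Finset.mul_sum]
  refine Finset.sum_congr rfl fun l _ => ?_
  rw [frobSq, Finset.univ_unique, Finset.sum_singleton, Finset.sum_singleton]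
  rfl

/-- With one row the determinants are scalars, and `1 + S / (1 + I) = (1 + I + S) / (1 + I)`. -/
theorem zfRate_eq_bdRate {P : ℝ} (hP : 0 ≤ P) (g : Fin N → ℂ) (v : ι → Fin N → ℂ) (k : ι) :
    zfRate P g v k = bdRate P (fun _ : Fin 1 => g) (fun l n _ => v l n) k := by
  have h1 : bdRate P (fun _ : Fin 1 => g) (fun l n _ => v l n) k =
      Real.logb 2 (covDet P (fun _ : Fin 1 => g) (fun l n _ => v l n) Finset.univ /
        covDet P (fun _ : Fin 1 => g) (fun l n _ => v l n) (Finset.univ.erase k)) := rfl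
  have h2 : 0 < 1 + ∑ l ∈ Finset.univ.erase k, P / N * ‖g ⬝ᵥ v l‖ ^ 2 :=
    add_pos_of_pos_of_nonneg one_pos (Finset.sum_nonneg fun _ _ => by positivity)
  rw [h1, covDet_singleStream, covDet_singleStream, zfRate,
    ← Finset.add_sum_erase _ (fun l => P / N * ‖g ⬝ᵥ v l‖ ^ 2) (Finset.mem_univ k), one_add_div h2.ne']
  congr 2
  ring

theorem measurePreserving_toColumn (N : ℕ) (s : ℝ≥0) :
    MeasurePreserving (fun (v : Fin N → ℂ) => (fun n _ => v n : Matrix (Fin N) (Fin 1) ℂ))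
      (gaussianVector N s) (gaussianMatrix N 1 s) := by
  have h1 : MeasurePreserving (fun (z : ℂ) (_ : Fin 1) => z) (complexGaussian s)
      (gaussianVector 1 s) :=
    (measurePreserving_funUnique (complexGaussian s) (Fin 1)).symm
  exact measurePreserving_pi (fun _ => complexGaussian s) (fun _ => gaussianVector 1 s) fun _ => h1

/-- The LMMSE coefficient of the effective channel of gain `g` for the pilot symbol `t`. -/
def pilotCoeff (g : ℝ) (s : ℝ≥0) (t : ℂ) : ℂ :=
  ((s : ℂ)⁻¹) * (((g : ℝ) : ℂ)⁻¹ + (s : ℂ)⁻¹ * (star t * t))⁻¹ * star t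

/-- `g ≥ 0` suffices: at `g = 0` the inverse is `0` by convention, and the pilot term keeps the
denominator positive. Positivity of the mean gain is thus never needed. -/
theorem pilotCoeff_ne_zero {g : ℝ} (hg : 0 ≤ g) (hs : s ≠ 0) {t : ℂ} (ht : t ≠ 0) :
    pilotCoeff g s t ≠ 0 := by
  have hs0 : (0 : ℝ) < s := by
    have := pos_iff_ne_zero.2 hs
    exact_mod_cast this
  have h1 : ((g : ℝ) : ℂ)⁻¹ + (s : ℂ)⁻¹ * (star t * t) =
      ((g⁻¹ + (s : ℝ)⁻¹ * ‖t‖ ^ 2 : ℝ) : ℂ) := by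
    rw [Complex.star_def, Complex.conj_mul']
    push_cast
    rfl
  have h2 : 0 < g⁻¹ + (s : ℝ)⁻¹ * ‖t‖ ^ 2 := by
    have : 0 < ‖t‖ := norm_pos_iff.2 ht
    positivity
  rw [pilotCoeff, h1]
  refine mul_ne_zero (mul_ne_zero (inv_ne_zero ?_) (inv_ne_zero ?_)) (star_ne_zero.2 ht)
  · exact Complex.ofReal_ne_zero.2 hs0.ne'
  · exact Complex.ofReal_ne_zero.2 h2.ne'

theorem meanGain_nonneg (N : ℕ) (c : Matrix (Fin M) (Fin M) ℂ → Fin M → ℂ)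
    (A : Matrix (Fin M) (Fin M) ℂ) : 0 ≤ meanGain N c A :=
  integral_nonneg fun _ => Finset.sum_nonneg fun _ _ => by positivity

theorem zfSumRate_eq_trainSumRate [NeZero M] (hN0 : 0 < N) (hc : IsMRC c) (hw : IsZFPrecoder w)
    (hA : ∀ k, (A k).det ≠ 0) (t : ι → ℂ) {P : ℝ} (hP : 0 ≤ P) :
    zfSumRate c w A t s P = trainSumRate (singleStreamPrecoder w) (gaussianMatrix M N 1)
      (fun k X => effectiveRow c (A k * X))
      (fun k => pilotCoeff (meanGain N c (A k) / N) s (t k) • 1) (fun k => t k • 1) s P := by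
  have hW := isBDPrecoder_singleStreamPrecoder hw
  have hh := isChannelFamily_effectiveRow (M := M) hN0 hc hA
  set J : ι → Matrix (Fin 1) (Fin 1) ℂ :=
    fun k => pilotCoeff (meanGain N c (A k) / N) s (t k) • 1 with hJ
  let ψ : (ι → Matrix (Fin M) (Fin N) ℂ × (Fin N → ℂ)) →
      ι → Matrix (Fin M) (Fin N) ℂ × Matrix (Fin N) (Fin 1) ℂ :=
    fun ω k => ((ω k).1, fun n _ => (ω k).2 n)
  have hψ : MeasurePreserving ψ (zfLaw ι M N s) (trainLaw ι (gaussianMatrix M N 1) N 1 s) :=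
    measurePreserving_pi (fun _ => (gaussianMatrix M N 1).prod (gaussianVector N s))
      (fun _ => (gaussianMatrix M N 1).prod (gaussianMatrix N 1 s))
      (f := fun _ p => (p.1, fun n _ => p.2 n)) fun _ =>
        (MeasurePreserving.id _).prod (measurePreserving_toColumn N s)
  have hm : Measurable fun ω : ι → Matrix (Fin M) (Fin N) ℂ × Matrix (Fin N) (Fin 1) ℂ =>
      ∑ k, bdRate P (effectiveRow c (A k * (ω k).1))
      (trainPrecoder (singleStreamPrecoder w) (fun k X => effectiveRow c (A k * X)) J
        (fun k => t k • 1) ω) k :=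
    Finset.measurable_sum _ fun k _ => measurable_bdRate (measurable_channel hh k)
      (measurable_trainPrecoder hW hh.measurable _ _) P k
  unfold zfSumRate trainSumRate
  rw [← hψ.map_eq, integral_map hψ.measurable.aemeasurable hm.aestronglyMeasurable]
  refine integral_congr_ae (ae_of_all _ fun ω => Finset.sum_congr rfl fun k _ => ?_)
  rw [zfRate_eq_bdRate hP]
  have hest : zfEstimate c A t s ω = fun j => (J j * trainObs
      (fun k X => effectiveRow c (A k * X)) (fun k => t k • 1) (ψ ω) j) 0 := by
    funext j
    rw [hJ, trainObs, transpose_smul, transpose_one, Matrix.smul_mul, Matrix.smul_mul,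
      Matrix.one_mul, Matrix.one_mul]
    rfl
  rw [hest]
  rfl

end SingleStreamReduction

/-! ### The scaling laws of both schemes -/

theorem hasMultiplexingGain_congr {f g : ℝ → ℝ} (hfg : f =ᶠ[atTop] g) (m : ℝ) :
    HasMultiplexingGain f m ↔ HasMultiplexingGain g m :=
  Asymptotics.isBigO_congr (hfg.sub (EventuallyEq.refl _ _)) (EventuallyEq.refl _ _)

theorem hasMultiplexingGainWithOffset_congr {f g : ℝ → ℝ} (hfg : f =ᶠ[atTop] g) (m : ℝ) :
    HasMultiplexingGainWithOffset f m ↔ HasMultiplexingGainWithOffset g m :=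
  exists_congr fun _ => tendsto_congr' (hfg.sub (EventuallyEq.refl _ _))

theorem det_ne_zero_of_mul_conjTranspose_posDef {M : ℕ} {R A : Matrix (Fin M) (Fin M) ℂ}
    (hR : R.PosDef) (hA : A * Aᴴ = R) : A.det ≠ 0 := by
  intro h0
  have h1 := congrArg det hA
  rw [det_mul, h0, zero_mul] at h1
  exact hR.det_pos.ne h1

section Equivalences

variable {ι : Type*} [Fintype ι] [DecidableEq ι] [Nontrivial ι] {M N : ℕ} [NeZero M] {s : ℝ≥0}
  {R A : ι → Matrix (Fin M) (Fin M) ℂ} {Ψ : ℝ → ℝ}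

theorem bdSumRate_scaling (hs : s ≠ 0) (hN0 : 0 < N) (hN : Fintype.card ι * M = N)
    (hR : ∀ k, (R k).PosDef) (hA : ∀ k, A k * (A k)ᴴ = R k) (hΨ : ∀ P, 0 < P → 0 < Ψ P)
    {W : (ι → Matrix (Fin M) (Fin N) ℂ) → ι → Matrix (Fin N) (Fin M) ℂ} (hW : IsBDPrecoder W)
    {T : ℝ → ι → Matrix (Fin M) (Fin M) ℂ}
    (hT : ∀ P, 0 < P → ∀ k, ((T P k)ᴴ * T P k).trace = ((Ψ P : ℝ) : ℂ)) :
    (HasMultiplexingGain (fun P => bdSumRate W R A (T P) s P) N →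
      (fun P => P / Ψ P) =O[atTop] (fun _ => (1 : ℝ))) ∧
    ((∃ κ : ℝ, 0 < κ ∧ ∀ᶠ P in atTop, ∀ k,
        (T P k * (T P k)ᴴ - ((κ * Ψ P : ℝ) : ℂ) • 1).PosSemidef) →
      (fun P => P / Ψ P) =O[atTop] (fun _ => (1 : ℝ)) →
      HasMultiplexingGain (fun P => bdSumRate W R A (T P) s P) N) ∧
    ((∀ k, ∃ Q : Matrix (Fin M) (Fin M) ℂ, Q.PosDef ∧
        Tendsto (fun P => ((Ψ P : ℝ) : ℂ)⁻¹ • (T P k * (T P k)ᴴ)) atTop (𝓝 Q)) →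
      (HasMultiplexingGainWithOffset (fun P => bdSumRate W R A (T P) s P) N ↔
        ∃ a : ℝ, Tendsto (fun P => P / Ψ P) atTop (𝓝 a))) := by
  have hAdet : ∀ k, (A k).det ≠ 0 := fun k =>
    det_ne_zero_of_mul_conjTranspose_posDef (hR k) (hA k)
  have hh := isChannelFamily_mul_gaussianMatrix (N := N) hAdet
  let e : ι × Fin M ≃ Fin N := Fintype.equivFinOfCardEq (by simp [hN])
  simp only [bdSumRate_eq_trainSumRate]
  have hnec := fun hgain => isBigO_of_hasMultiplexingGain_bd (J := fun P k => ((s : ℂ)⁻¹) •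
    (((R k)⁻¹ + ((s : ℂ)⁻¹) • ((T P k)ᵀᴴ * (T P k)ᵀ))⁻¹ * (T P k)ᵀᴴ)) hs hN hN0 hW hAdet hΨ hT hgain
  refine ⟨hnec, ?_, fun hQ => ?_⟩
  · rintro ⟨κ, hκ, hTκ⟩ hO
    refine hasMultiplexingGain_trainSumRate hs e hN hN0 hW hh hΨ ?_ hκ hTκ hO
    filter_upwards [hTκ, eventually_gt_atTop 0] with P hP hP0 k
    exact det_estimator_ne_zero hs (hR k)
      (det_ne_zero_of_posSemidef_sub (mul_pos hκ (hΨ P hP0)) (hP k))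
  · choose Q hQ hTQ using hQ
    exact hasMultiplexingGainWithOffset_trainSumRate_iff hs e hN hN0 hW hh hΨ
      (Eventually.of_forall fun P k hTP => det_estimator_ne_zero hs (hR k) hTP) hQ hTQ hnec

/-- A scalar pilot satisfies `T Tᴴ = Ψ` exactly. The spreading condition holds with `κ = 1` and the
shape condition with `Q = 1`, so the equivalences need no further assumption on the pilots. -/
theorem zfSumRate_scaling (hs : s ≠ 0) (hN0 : 0 < N) (hN : Fintype.card ι = N)
    (hA : ∀ k, (A k).det ≠ 0) (hΨ : ∀ P, 0 < P → 0 < Ψ P)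
    {c : Matrix (Fin M) (Fin M) ℂ → Fin M → ℂ} (hc : IsMRC c)
    {w : (ι → Fin N → ℂ) → ι → Fin N → ℂ} (hw : IsZFPrecoder w)
    {t : ℝ → ι → ℂ} (ht : ∀ P, 0 < P → ∀ k, ‖t P k‖ ^ 2 = Ψ P) :
    (HasMultiplexingGain (fun P => zfSumRate c w A (t P) s P) N ↔
      (fun P => P / Ψ P) =O[atTop] (fun _ => (1 : ℝ))) ∧
    (HasMultiplexingGainWithOffset (fun P => zfSumRate c w A (t P) s P) N ↔
      ∃ a : ℝ, Tendsto (fun P => P / Ψ P) atTop (𝓝 a)) := by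
  have hW := isBDPrecoder_singleStreamPrecoder hw
  have hh := isChannelFamily_effectiveRow (M := M) hN0 hc hA
  have hN1 : Fintype.card ι * 1 = N := by rw [mul_one, hN]
  let e : ι × Fin 1 ≃ Fin N := Fintype.equivFinOfCardEq (by simp [hN])
  let J : ℝ → ι → Matrix (Fin 1) (Fin 1) ℂ :=
    fun P k => pilotCoeff (meanGain N c (A k) / N) s (t P k) • 1
  have hrate : (fun P => zfSumRate c w A (t P) s P) =ᶠ[atTop]
      fun P => trainSumRate (singleStreamPrecoder w) (gaussianMatrix M N 1)
        (fun k X => effectiveRow c (A k * X)) (J P) (fun k => t P k • 1) s P := by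
    filter_upwards [eventually_ge_atTop 0] with P hP
      using zfSumRate_eq_trainSumRate hN0 hc hw hA (t P) hP
  have hJ : ∀ P, 0 < P → ∀ k, (J P k).det ≠ 0 := by
    intro P hP k
    have ht0 : t P k ≠ 0 := by
      intro h0
      have h1 := ht P hP k
      rw [h0, norm_zero] at h1
      have h2 := hΨ P hP
      rw [← h1] at h2
      norm_num at h2
    simp only [J, det_smul, det_one, mul_one]
    exact pow_ne_zero _ (pilotCoeff_ne_zero
      (div_nonneg (meanGain_nonneg N c (A k)) (Nat.cast_nonneg N)) hs ht0)
  have hTT : ∀ P, 0 < P → ∀ k, (t P k • 1 : Matrix (Fin 1) (Fin 1) ℂ) * (t P k • 1)ᴴ =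
      ((Ψ P : ℝ) : ℂ) • 1 := by
    intro P hP k
    rw [conjTranspose_smul, conjTranspose_one, Matrix.smul_mul, Matrix.mul_smul, Matrix.one_mul,
      smul_smul, Complex.star_def, Complex.mul_conj', ← ht P hP k, Complex.ofReal_pow]
  rw [hasMultiplexingGain_congr hrate, hasMultiplexingGainWithOffset_congr hrate]
  have hnec := fun hgain => isBigO_of_hasMultiplexingGain_scalar (J := J) hs e hN1 hN0 hW hh hΨ hJ
    ht hgain
  refine ⟨⟨hnec, fun hO => ?_⟩, ?_⟩
  · refine hasMultiplexingGain_trainSumRate hs e hN1 hN0 hW hh hΨ ?_ one_pos ?_ hO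
    · filter_upwards [eventually_gt_atTop 0] with P hP using hJ P hP
    · filter_upwards [eventually_gt_atTop 0] with P hP k
      rw [hTT P hP k, one_mul, sub_self]
      exact PosSemidef.zero
  · refine hasMultiplexingGainWithOffset_trainSumRate_iff hs e hN1 hN0 hW hh hΨ ?_
      (Q := fun _ => 1) (fun _ => PosDef.one) (fun k => ?_) hnec
    · filter_upwards [eventually_gt_atTop 0] with P hP k _ using hJ P hP k
    · refine tendsto_const_nhds.congr' ?_
      filter_upwards [eventually_gt_atTop 0] with P hP
      rw [hTT P hP k, smul_smul, inv_mul_cancel₀ (Complex.ofReal_ne_zero.2 (hΨ P hP).ne'), one_smul]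

end Equivalences

end

theorem corollary2 {K M N : ℕ} (hM : 1 ≤ M) (hMN : M < N)
    (R A : Fin K → Matrix (Fin M) (Fin M) ℂ) (hR : ∀ k, (R k).PosDef)
    (hA : ∀ k, A k * (A k)ᴴ = R k)
    (s : ℝ≥0) (hs : 0 < s)
    (Ψ : ℝ → ℝ) (hΨ : ∀ P, 0 < P → 0 < Ψ P) :
    -- block-diagonalization
    (∀ (S : Finset (Fin K)), S.card * M = N →
      ∀ W : (S → Matrix (Fin M) (Fin N) ℂ) → S → Matrix (Fin N) (Fin M) ℂ, IsBDPrecoder W →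
      ∀ T : ℝ → S → Matrix (Fin M) (Fin M) ℂ,
        (∀ P, 0 < P → ∀ k, ((T P k)ᴴ * T P k).trace = ((Ψ P : ℝ) : ℂ)) →
        -- necessity, for all training matrices
        (HasMultiplexingGain
            (fun P => bdSumRate W (fun k => R k) (fun k => A k) (T P) s P) N →
          (fun P => P / Ψ P) =O[atTop] (fun _ => (1 : ℝ))) ∧
        -- sufficiency, for training matrices that spread the power over all dimensions
        ((∃ κ : ℝ, 0 < κ ∧ ∀ᶠ P in atTop, ∀ k,
            (T P k * (T P k)ᴴ - ((κ * Ψ P : ℝ) : ℂ) • 1).PosSemidef) →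
          (fun P => P / Ψ P) =O[atTop] (fun _ => (1 : ℝ)) →
          HasMultiplexingGain
            (fun P => bdSumRate W (fun k => R k) (fun k => A k) (T P) s P) N) ∧
        -- convergence, for training matrices with an asymptotic shape
        ((∀ k, ∃ Q : Matrix (Fin M) (Fin M) ℂ, Q.PosDef ∧
            Tendsto (fun P => ((Ψ P : ℝ) : ℂ)⁻¹ • (T P k * (T P k)ᴴ)) atTop (𝓝 Q)) →
          (HasMultiplexingGainWithOffset
              (fun P => bdSumRate W (fun k => R k) (fun k => A k) (T P) s P) N ↔
            ∃ a : ℝ, Tendsto (fun P => P / Ψ P) atTop (𝓝 a)))) ∧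
    -- zero-forcing with maximum ratio combining
    (∀ (S : Finset (Fin K)), S.card = N →
      ∀ c : Matrix (Fin M) (Fin M) ℂ → Fin M → ℂ, IsMRC c →
      ∀ w : (S → Fin N → ℂ) → S → Fin N → ℂ, IsZFPrecoder w →
      ∀ t : ℝ → S → ℂ, (∀ P, 0 < P → ∀ k, ‖t P k‖ ^ 2 = Ψ P) →
        (HasMultiplexingGain (fun P => zfSumRate c w (fun k => A k) (t P) s P) N ↔
          (fun P => P / Ψ P) =O[atTop] (fun _ => (1 : ℝ))) ∧
        (HasMultiplexingGainWithOffset (fun P => zfSumRate c w (fun k => A k) (t P) s P) N ↔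
          ∃ a : ℝ, Tendsto (fun P => P / Ψ P) atTop (𝓝 a))) := by
  have hM0 : NeZero M := ⟨by omega⟩
  have hN0 : 0 < N := by omega
  have hs' : s ≠ 0 := hs.ne'
  refine ⟨fun S hS W hW T hT => ?_, fun S hS c hc w hw t ht => ?_⟩
  -- Since `M < N`, at least two users are scheduled. With a single user there would be no
  -- interference, and the necessity of accurate training would fail.
  · have hnt : Nontrivial S := by
      rw [← Fintype.one_lt_card_iff_nontrivial, Fintype.card_coe]
      by_contra h1
      have h2 : S.card * M ≤ 1 * M := Nat.mul_le_mul_right M (not_lt.1 h1)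
      omega
    exact bdSumRate_scaling hs' hN0 (by rw [Fintype.card_coe, hS]) (fun k : S => hR k)
      (fun k : S => hA k) hΨ hW hT
  · have hnt : Nontrivial S := by
      rw [← Fintype.one_lt_card_iff_nontrivial, Fintype.card_coe]
      omega
    exact zfSumRate_scaling hs' hN0 (by rw [Fintype.card_coe, hS])
      (fun k : S => det_ne_zero_of_mul_conjTranspose_posDef (hR k) (hA k)) hΨ hc hw ht
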